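/- Let $n\ge 2$. Realize the positive roots of $A_n$ as $[a,b]=\alpha_a+\dots+\alpha_b=\varepsilon_a-\varepsilon_{b+1}$ ($1\le a\le b\le n$) and those of $D_{n+1}$ as $\langle a,-b\rangle=\varepsilon_a-\varepsilon_b$ and $\langle a,b\rangle=\varepsilon_a+\varepsilon_b$ ($1\le a<b\le n+1$), with simple roots $\alpha_i=\varepsilon_i-\varepsilon_{i+1}$ ($i\le n$) and $\alpha_{n+1}=\varepsilon_n+\varepsilon_{n+1}$. Let $\vee$ exchange the indices $n$ and $n+1$ of $D_{n+1}$ and fix the others, let $\bar\imath$ be the $\vee$-orbit of $i$, and identify the set of orbits with $\{1,\dots,n\}$. For a word $c=i_1\cdots i_n$ write $c^{k\vee}$ for the word obtained by applying $\vee$ $k$ times to each letter. A *twisted adapted class* is a commutation class $[\mathbf i_0]$ of reduced words of the longest element of the Weyl group of $D_{n+1}$ that is obtained from $\big[\prod_{k=0}^n(1\,2\cdots n)^{k\vee}\big]$ by reflection functors ($i\,\mathbf u\mapsto \mathbf u\,i^*$, $\mathbf u\,i\mapsto i^*\mathbf u$, where $w_0\alpha_i=-\alpha_{i^*}$). Every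 twisted adapted class $[\mathbf i_0]$ is of the form $\big[\prod_{k=0}^n c^{k\vee}\big]$ for a word $c=i_1\cdots i_n$ containing exactly one index of each $\vee$-orbit. Fix any such $c$, and put $\phi_{[\mathbf i_0]}=s_{i_1}\cdots s_{i_n}$. Replacing the letter $n+1$, if it occurs in $c$, by $n$ gives an expression of a Coxeter element of $A_n$, adapted to a Dynkin quiver $Q$ of type $A_n$: the projection of $[\mathbf i_0]$ is $[Q]$. Let $\xi$ be a height function of $Q$, that is, $\xi(i)=\xi(j)+1$ for each arrow $j\to i$ of $Q$. *The quivers.* The AR-quiver $\Gamma_Q$ has the positive roots of $A_n$ as labels of its vertices, with coordinates (residue, position): for an expression $\phi_Q=s_{j_1}\cdots s_{j_n}$ adapted to $Q$, the root $s_{j_1}\cdots s_{j_{k-1}}(\alpha_{j_k})$ is at $(j_k,\xi(j_k))$, and if $\beta$ is at $(i,p)$ and $\phi_Q(\beta)$ is positive, then $\phi_Q(\beta)$ is at $(i,p-2)$; the arrows are all $(i,p)\to(j,p+1)$ with $|i-j|=1$ between vertices. The folded AR-quiver $\widehat\Upsilon_{[\mathbf i_0]}$ has the positive roots of $D_{n+1}$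 as labels: $s_{i_1}\cdots s_{i_{k-1}}(\alpha_{i_k})$ is at $(\bar\imath_k,\xi(\bar\imath_k))$, $\phi_{[\mathbf i_0]}s_{i_1^\vee}\cdots s_{i_{k-1}^\vee}(\alpha_{i_k^\vee})$ is at $(\bar\imath_k,\xi(\bar\imath_k)-2)$, and if $\beta$ is at $(\bar\imath,p)$ and $\psi(\beta)$ is positive for $\psi=s_{i_1}\cdots s_{i_n}s_{i_1^\vee}\cdots s_{i_n^\vee}$, then $\psi(\beta)$ is at $(\bar\imath,p-4)$. Its arrows are those of the combinatorial AR-quiver of $[\mathbf i_0]$: for $\mathbf i_0=j_1j_2\cdots j_N$ and $\beta_k=s_{j_1}\cdots s_{j_{k-1}}(\alpha_{j_k})$, there is an arrow $\beta_k\to\beta_l$ iff $l<k$, $j_k$ and $j_l$ are adjacent in the Dynkin diagram of $D_{n+1}$, and neither $j_k$ nor $j_l$ occurs strictly between the positions $l$ and $k$. An $S$-sectional (resp. $N$-sectional) path is a path all of whose arrows raise (resp. lower) the residue by $1$; its length is its number of arrows. We draw the position $p$ from left to right. *Statement.* Let ${}_1\Gamma_Q=\Gamma_Q$, and let ${}_2\Gamma_{Q^*}$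 be the upside-down copy of ${}_1\Gamma_Q$ placed at its left: the vertex $(i,p)$ is moved, with its label, to $(n+1-i,\,p-(n+1))$. Then: 1. The vertices of ${}_2\Gamma_{Q^*}$ are those of the AR-quiver of $Q^*$ ($Q$ with $i\leftrightarrow n+1-i$ exchanged) for the height function $i\mapsto\xi(n+1-i)-(n+1)$. The vertex sets of ${}_1\Gamma_Q$ and ${}_2\Gamma_{Q^*}$ are disjoint, with union $\{(i,\xi(i)-2t)\mid 1\le i\le n,\ 0\le t\le n\}$. In $\widehat\Upsilon_{[\mathbf i_0]}$ each positive root of $D_{n+1}$ labels exactly one vertex, and each vertex has exactly one label. 2. There are a unique $S$-sectional path $\rho$ of length $n-1$ in ${}_1\Gamma_Q$ and a unique $N$-sectional path $\rho'$ of length $n-1$ in ${}_2\Gamma_{Q^*}$. The set of labels of each of them is $\{[i,n]\mid 1\le i\le n\}$. 3. Join ${}_1\Gamma_Q$ and ${}_2\Gamma_{Q^*}$ by taking all arrows $(i,p)\to(j,p+1)$ with $|i-j|=1$ between vertices, and change the labels as follows: - each label $[a,b]$ to the right of $\rho$ or to the left of $\rho'$ becomes $\langle a,-b-1\rangle$;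 - each label $[a,b]$ strictly between $\rho'$ and $\rho$ becomes $\langle a,b+1\rangle$; - on $\rho$, $[i,n]$ becomes $\langle i,-n-1\rangle$ if $n$ occurs in $c$, and $\langle i,n+1\rangle$ if $n+1$ occurs in $c$; - on $\rho'$, $[i,n]$ becomes $\langle i,n+1\rangle$ if $n$ occurs in $c$, and $\langle i,-n-1\rangle$ if $n+1$ occurs in $c$. The result is the folded AR-quiver $\widehat\Upsilon_{[\mathbf i_0]}$, with the same coordinates, labels and arrows. 4. In particular, for $1\le i<j\le n$, the vertex labelled $\langle i,j\rangle$ in $\widehat\Upsilon_{[\mathbf i_0]}$ carries the label $[i,j-1]$ in ${}_1\Gamma_Q\sqcup{}_2\Gamma_{Q^*}$. -/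

import Mathlib

namespace FoldedAR

/-! ### Root systems of types `A_n` and `D_{n+1}` inside `ℤ^{n+1}`

Indices are the usual `1`-based ones. The simple roots of `D_{n+1}` are
`α_i = ε_i - ε_{i+1}` for `1 ≤ i ≤ n` and `α_{n+1} = ε_n + ε_{n+1}`; the first `n` of them are the
simple roots of `A_n`. -/

/-- The ambient lattice `ℤ^{n+1}`, with the standard inner product `⬝ᵥ`. -/
abbrev Lat (n : ℕ) : Type := Fin (n + 1) → ℤ

/-- The standard basis vector `ε_i`, for `1 ≤ i ≤ n + 1`. -/
def eps (n i : ℕ) : Lat n := fun k => if (k : ℕ) + 1 = i then 1 else 0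

/-- The simple root `α_i`, for `1 ≤ i ≤ n + 1`. -/
def simpleRoot (n i : ℕ) : Lat n :=
  if i = n + 1 then eps n n + eps n (n + 1) else eps n i - eps n (i + 1)

/-- The simple reflection `s_i` (all roots have squared length `2`). -/
def refl (n i : ℕ) (v : Lat n) : Lat n := v - (v ⬝ᵥ simpleRoot n i) • simpleRoot n i

/-- The Weyl group element `s_{i_1} s_{i_2} ⋯ s_{i_l}` of a word `i_1 i_2 ⋯ i_l`,
as a transformation of the lattice. -/
def act (n : ℕ) : List ℕ → Lat n → Lat n
  | [], v => v
  | i :: u, v => refl n i (act n u v)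

/-- The root `[a, b] = α_a + ⋯ + α_b = ε_a - ε_{b+1}` of type `A_n`. -/
def rootA (n a b : ℕ) : Lat n := eps n a - eps n (b + 1)

/-- The root `⟨a, -b⟩ = ε_a - ε_b` of type `D_{n+1}`. -/
def rootDneg (n a b : ℕ) : Lat n := eps n a - eps n b

/-- The root `⟨a, b⟩ = ε_a + ε_b` of type `D_{n+1}`. -/
def rootDpos (n a b : ℕ) : Lat n := eps n a + eps n b

/-- Positive roots of type `A_n`. -/
def IsPosRootA (n : ℕ) (β : Lat n) : Prop :=
  ∃ a b, 1 ≤ a ∧ a ≤ b ∧ b ≤ n ∧ β = rootA n a b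

/-- Positive roots of type `D_{n+1}`. -/
def IsPosRootD (n : ℕ) (β : Lat n) : Prop :=
  ∃ a b, 1 ≤ a ∧ a < b ∧ b ≤ n + 1 ∧ (β = rootDneg n a b ∨ β = rootDpos n a b)

/-! ### Reduced words, commutation classes and reflection functors in type `D_{n+1}` -/

/-- Words in the index set `{1, …, n+1}` of `D_{n+1}`. -/
def IsWordD (n : ℕ) (w : List ℕ) : Prop := ∀ i ∈ w, 1 ≤ i ∧ i ≤ n + 1

/-- Reduced words of elements of the Weyl group of type `D_{n+1}`. -/
def IsReducedWord (n : ℕ) (w : List ℕ) : Prop :=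
  IsWordD n w ∧ ∀ w', IsWordD n w' → act n w' = act n w → w.length ≤ w'.length

/-- Reduced words of the longest element `w_0` of the Weyl group of type `D_{n+1}`. -/
def IsReducedWordOfLongest (n : ℕ) (w : List ℕ) : Prop :=
  IsReducedWord n w ∧ ∀ w', IsReducedWord n w' → w'.length ≤ w.length

/-- Two indices are joined in the Dynkin diagram of type `D_{n+1}`. -/
def Adj (n i j : ℕ) : Prop := simpleRoot n i ⬝ᵥ simpleRoot n j = -1

/-- One application of a commutation relation `s_i s_j = s_j s_i`. -/
def CommStep (n : ℕ) (w w' : List ℕ) : Prop :=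
  ∃ u v i j, simpleRoot n i ⬝ᵥ simpleRoot n j = 0 ∧
    w = u ++ i :: j :: v ∧ w' = u ++ j :: i :: v

/-- Commutation equivalence: `w` and `w'` belong to the same commutation class `[w] = [w']`. -/
def CommEquiv (n : ℕ) : List ℕ → List ℕ → Prop := Relation.EqvGen (CommStep n)

/-- The right and left reflection functors on representatives: for a reduced word of `w_0`,
`i u ↦ u i^*` and `u i ↦ i^* u`, where `w_0(α_i) = -α_{i^*}`. -/
inductive ReflStep (n : ℕ) : List ℕ → List ℕ → Prop
  | right (i j : ℕ) (u : List ℕ) (h : IsReducedWordOfLongest n (i :: u))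
      (hj : 1 ≤ j ∧ j ≤ n + 1) (hs : act n (i :: u) (simpleRoot n i) = -simpleRoot n j) :
      ReflStep n (i :: u) (u ++ [j])
  | left (i j : ℕ) (u : List ℕ) (h : IsReducedWordOfLongest n (u ++ [i]))
      (hj : 1 ≤ j ∧ j ≤ n + 1) (hs : act n (u ++ [i]) (simpleRoot n i) = -simpleRoot n j) :
      ReflStep n (u ++ [i]) (j :: u)

/-- `[w]` and `[w']` are reflection equivalent, i.e. lie in the same `r`-cluster point. -/
def ReflEquiv (n : ℕ) : List ℕ → List ℕ → Prop :=
  Relation.ReflTransGen (fun w w' => CommEquiv n w w' ∨ ReflStep n w w')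

/-- The diagram automorphism `∨` of `D_{n+1}`, which exchanges `n` and `n + 1`. -/
def vee (n i : ℕ) : ℕ := if i = n then n + 1 else if i = n + 1 then n else i

/-- The orbit `ī` of an index under `∨`, encoded by its smallest element,
so that `Ī = {1, …, n}`. -/
def orb (n i : ℕ) : ℕ := if i = n + 1 then n else i

/-- The word `∏_{k=0}^{n} c^{k∨}`. -/
def twistedWord (n : ℕ) (c : List ℕ) : List ℕ :=
  (List.range (n + 1)).flatMap fun k => c.map (vee n)^[k]

/-- `[w]` is a twisted adapted class: it lies in the `r`-cluster point of
`∏_{k=0}^{n} (1 2 ⋯ n)^{k∨}`. -/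
def IsTwistedAdapted (n : ℕ) (w : List ℕ) : Prop :=
  ReflEquiv n (twistedWord n (List.range' 1 n)) w

/-- `s_{i_1} ⋯ s_{i_n} ∨` is a twisted Coxeter element: the word `c = i_1 ⋯ i_n` contains exactly
one index of each orbit of `∨`. -/
def IsTwistedCoxeterWord (n : ℕ) (c : List ℕ) : Prop :=
  (c.map (orb n)).Perm (List.range' 1 n)

/-- `φ_{[w]} ∨ = s_{i_1} ⋯ s_{i_n} ∨` is the twisted Coxeter element of the class `[w]`,
for `c = i_1 ⋯ i_n`. -/
def IsTwistedCoxeterWordOf (n : ℕ) (w c : List ℕ) : Prop :=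
  IsTwistedCoxeterWord n c ∧ CommEquiv n w (twistedWord n c)

/-! ### Dynkin quivers of type `A_n` -/

/-- `Q i j` means that there is an arrow from `i` to `j`; `Q` is an orientation of the Dynkin
diagram of type `A_n`, with vertices `1, …, n`. -/
def IsDynkinQuiverA (n : ℕ) (Q : ℕ → ℕ → Prop) : Prop :=
  (∀ i j, Q i j → (1 ≤ i ∧ i ≤ n) ∧ (1 ≤ j ∧ j ≤ n) ∧ (i + 1 = j ∨ j + 1 = i)) ∧
    ∀ i, 1 ≤ i → i + 1 ≤ n → Xor (Q i (i + 1)) (Q (i + 1) i)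

/-- No arrow exits from `i`. -/
def IsSink (Q : ℕ → ℕ → Prop) (i : ℕ) : Prop := ∀ j, ¬ Q i j

/-- No arrow enters `i`. -/
def IsSource (Q : ℕ → ℕ → Prop) (i : ℕ) : Prop := ∀ j, ¬ Q j i

open Classical in
/-- The quiver `s_i Q`: the arrows at `i` are reversed if `i` is a sink or a source. -/
def reflQuiver (i : ℕ) (Q : ℕ → ℕ → Prop) : ℕ → ℕ → Prop := fun a b =>
  if (IsSink Q i ∨ IsSource Q i) ∧ (a = i ∨ b = i) then Q b a else Q a b

/-- The word `i_1 i_2 ⋯ i_l` is adapted to `Q`: `i_k` is a sink of `s_{i_{k-1}} ⋯ s_{i_1} Q`. -/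
def IsAdapted : (ℕ → ℕ → Prop) → List ℕ → Prop
  | _, [] => True
  | Q, i :: u => IsSink Q i ∧ IsAdapted (reflQuiver i Q) u

/-- `c` is an expression, adapted to `Q`, of the Coxeter element `φ_Q` of type `A_n`. -/
def IsCoxeterWordOf (n : ℕ) (Q : ℕ → ℕ → Prop) (c : List ℕ) : Prop :=
  c.Perm (List.range' 1 n) ∧ IsAdapted Q c

/-- The projection from twisted Coxeter elements of `D_{n+1}` to Coxeter elements of `A_n`. -/
def projWord (n : ℕ) (c : List ℕ) : List ℕ := if n + 1 ∈ c then c.map (vee n) else c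

/-- A height function: `ξ(i) = ξ(j) + 1` if there is an arrow from `j` to `i`. -/
def IsHeightFunction (Q : ℕ → ℕ → Prop) (ξ : ℕ → ℤ) : Prop := ∀ i j, Q j i → ξ i = ξ j + 1

/-- The Dynkin quiver `Q^*`, obtained from `Q` by exchanging the vertices `i` and `n + 1 - i`. -/
def starQuiver (n : ℕ) (Q : ℕ → ℕ → Prop) : ℕ → ℕ → Prop := fun i j =>
  i ≤ n ∧ j ≤ n ∧ Q (n + 1 - i) (n + 1 - j)

/-! ### Quivers with coordinates and labels -/

/-- A quiver whose vertices are some points `(i, p)` of the plane, `i` being the residue; its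
vertices are labelled by elements of `V`. In pictures, `p` increases from left to right and
`i` increases from top to bottom. -/
@[ext] structure CoordQuiver (V : Type) where
  /-- There is a vertex at this point, with this label. -/
  label : ℕ × ℤ → V → Prop
  /-- There is an arrow from the first point to the second. -/
  arrow : ℕ × ℤ → ℕ × ℤ → Prop

/-- The set of vertices. -/
def CoordQuiver.verts {V : Type} (X : CoordQuiver V) : Set (ℕ × ℤ) := {x | ∃ β, X.label x β}

/-- The points `(i, p)` and `(j, p + 1)` with `|i - j| = 1`. -/
def IsStep (x y : ℕ × ℤ) : Prop := (x.1 + 1 = y.1 ∨ y.1 + 1 = x.1) ∧ y.2 = x.2 + 1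

/-- The quiver with the given labels, with all arrows `(i, p) → (j, p + 1)`, `|i - j| = 1`,
between its vertices. -/
def CoordQuiver.ofLabels {V : Type} (L : ℕ × ℤ → V → Prop) : CoordQuiver V where
  label := L
  arrow x y := (∃ β, L x β) ∧ (∃ γ, L y γ) ∧ IsStep x y

/-- The list of points is an `S`-sectional path: consecutive points are joined by downward arrows.
Its length is the number of its arrows. -/
def IsSPath {V : Type} (X : CoordQuiver V) (l : List (ℕ × ℤ)) : Prop :=
  l ≠ [] ∧ (∀ x ∈ l, x ∈ X.verts) ∧ l.IsChain fun x y => X.arrow x y ∧ x.1 < y.1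

/-- The list of points is an `N`-sectional path: consecutive points are joined by upward arrows. -/
def IsNPath {V : Type} (X : CoordQuiver V) (l : List (ℕ × ℤ)) : Prop :=
  l ≠ [] ∧ (∀ x ∈ l, x ∈ X.verts) ∧ l.IsChain fun x y => X.arrow x y ∧ y.1 < x.1

/-- `x` lies to the right of the path `l` (in the row of `x`). -/
def RightOf (l : List (ℕ × ℤ)) (x : ℕ × ℤ) : Prop := ∃ q, (x.1, q) ∈ l ∧ q < x.2

/-- `x` lies to the left of the path `l` (in the row of `x`). -/
def LeftOf (l : List (ℕ × ℤ)) (x : ℕ × ℤ) : Prop := ∃ q, (x.1, q) ∈ l ∧ x.2 < q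

/-! ### Auslander–Reiten quivers of type `A_n` -/

/-- The labels obtained from an expression `c = i_1 ⋯ i_n` of `φ_Q`: the root
`s_{i_1} ⋯ s_{i_{k-1}}(α_{i_k})` sits at `(i_k, ξ(i_k))`, and if `β` sits at `(i, p)` then the root
`φ_Q(β)`, if positive, sits at `(i, p - 2)`. -/
inductive ARLabel (n : ℕ) (c : List ℕ) (ξ : ℕ → ℤ) : ℕ × ℤ → Lat n → Prop
  | init (u v : List ℕ) (i : ℕ) (h : c = u ++ i :: v) :
      ARLabel n c ξ (i, ξ i) (act n u (simpleRoot n i))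
  | next (i : ℕ) (p : ℤ) (β : Lat n) (h : ARLabel n c ξ (i, p) β) (hβ : IsPosRootA n β)
      (hφ : IsPosRootA n (act n c β)) : ARLabel n c ξ (i, p - 2) (act n c β)

/-- The Auslander–Reiten quiver `Γ_Q` of type `A_n`, with the coordinates given by `ξ`. -/
def ARQuiver (n : ℕ) (Q : ℕ → ℕ → Prop) (ξ : ℕ → ℤ) : CoordQuiver (Lat n) :=
  CoordQuiver.ofLabels fun x β => ∃ c, IsCoxeterWordOf n Q c ∧ ARLabel n c ξ x β

/-! ### Twisted and folded Auslander–Reiten quivers of type `D_{n+1}` -/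

/-- The arrows of the combinatorial Auslander–Reiten quiver `Υ_{[w]}`, whose vertices are the roots
`β_k = s_{i_1} ⋯ s_{i_{k-1}}(α_{i_k})` of `w = i_1 i_2 ⋯`: there is an arrow `β_k → β_j` if
`j < k`, the indices `i_j` and `i_k` are joined in the Dynkin diagram, and neither of them occurs in
`w` strictly between the positions `j` and `k`. -/
def CombArrow (n : ℕ) (w : List ℕ) (β γ : Lat n) : Prop :=
  ∃ u₁ a u₂ b u₃, w = u₁ ++ a :: u₂ ++ b :: u₃ ∧ Adj n a b ∧ a ∉ u₂ ∧ b ∉ u₂ ∧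
    β = act n (u₁ ++ a :: u₂) (simpleRoot n b) ∧ γ = act n u₁ (simpleRoot n a)

/-- The coordinates `(i, p)`, `1 ≤ i ≤ n + 1`, of positive roots in the twisted AR-quiver with
twisted Coxeter element `s_{i_1} ⋯ s_{i_n} ∨`, where `c = i_1 ⋯ i_n`: the roots
`s_{i_1} ⋯ s_{i_{k-1}}(α_{i_k})` sit at `(i_k, ξ(i_k))`, the next `n` roots of the word
`ψ = i_1 ⋯ i_n i_1^∨ ⋯ i_n^∨` sit at `(i_k^∨, ξ(i_k) - 2)`, and if `β` sits at `(i, p)` then the root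
`ψ(β)`, if positive, sits at `(i, p - 4)`. -/
inductive TwistedLabel (n : ℕ) (c : List ℕ) (ξ : ℕ → ℤ) : ℕ × ℤ → Lat n → Prop
  | init (u v : List ℕ) (i : ℕ) (h : c = u ++ i :: v) :
      TwistedLabel n c ξ (i, ξ (orb n i)) (act n u (simpleRoot n i))
  | second (u v : List ℕ) (i : ℕ) (h : c.map (vee n) = u ++ i :: v) :
      TwistedLabel n c ξ (i, ξ (orb n i) - 2) (act n (c ++ u) (simpleRoot n i))
  | next (i : ℕ) (p : ℤ) (β : Lat n) (h : TwistedLabel n c ξ (i, p) β) (hβ : IsPosRootD n β)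
      (hψ : IsPosRootD n (act n (c ++ c.map (vee n)) β)) :
      TwistedLabel n c ξ (i, p - 4) (act n (c ++ c.map (vee n)) β)

/-- A root with coordinates `(i, p)` in the twisted AR-quiver has folded coordinates `(ī, p)`. -/
def FoldedLabel (n : ℕ) (c : List ℕ) (ξ : ℕ → ℤ) (x : ℕ × ℤ) (β : Lat n) : Prop :=
  ∃ i, orb n i = x.1 ∧ TwistedLabel n c ξ (i, x.2) β

/-- The folded AR-quiver of the class `[w]` with twisted Coxeter element `c ∨`. Its arrows are
the arrows of the combinatorial AR-quiver of `[w]`. -/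
def FoldedARQuiver (n : ℕ) (w c : List ℕ) (ξ : ℕ → ℤ) : CoordQuiver (Lat n) where
  label := FoldedLabel n c ξ
  arrow x y := ∃ β γ, FoldedLabel n c ξ x β ∧ FoldedLabel n c ξ y γ ∧ CombArrow n w β γ

/-! ### Gluing -/

/-- The quiver `X` turned upside down and put `n + 1` units to the left: the vertex `(i, p)` goes,
with its label, to `(n + 1 - i, p - (n + 1))`. -/
def upsideDown (n : ℕ) (X : CoordQuiver (Lat n)) : CoordQuiver (Lat n) :=
  CoordQuiver.ofLabels fun x β => ∃ i p, X.label (i, p) β ∧ x.1 + i = n + 1 ∧ x.2 = p - (n + 1)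

/-- `X` and `Y` together, with the arrows `(i, p) → (j, p + 1)`, `|i - j| = 1`, between any two of
their vertices. -/
def glue {n : ℕ} (X Y : CoordQuiver (Lat n)) : CoordQuiver (Lat n) :=
  CoordQuiver.ofLabels fun x β => X.label x β ∨ Y.label x β

/-- The change of labels on the quiver glued from `X = ₁Γ_Q` and `Y = ₂Γ_{Q^*}`, for
an `S`-sectional path `ρ` in `X` and an `N`-sectional path `ρ'` in `Y`. -/
inductive NewLabel (n : ℕ) (c : List ℕ) (X Y : CoordQuiver (Lat n)) (ρ ρ' : List (ℕ × ℤ)) :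
    ℕ × ℤ → Lat n → Prop
  | outside (x : ℕ × ℤ) (a b : ℕ) (ha : 1 ≤ a) (hab : a ≤ b) (hb : b ≤ n)
      (h : (glue X Y).label x (rootA n a b)) (hx : RightOf ρ x ∨ LeftOf ρ' x) :
      NewLabel n c X Y ρ ρ' x (rootDneg n a (b + 1))
  | inside (x : ℕ × ℤ) (a b : ℕ) (ha : 1 ≤ a) (hab : a ≤ b) (hb : b ≤ n)
      (h : (glue X Y).label x (rootA n a b)) (hx : LeftOf ρ x ∧ RightOf ρ' x) :
      NewLabel n c X Y ρ ρ' x (rootDpos n a (b + 1))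
  | right_n (x : ℕ × ℤ) (i : ℕ) (hi : 1 ≤ i) (hin : i ≤ n) (h : X.label x (rootA n i n))
      (hx : x ∈ ρ) (hc : n ∈ c) : NewLabel n c X Y ρ ρ' x (rootDneg n i (n + 1))
  | right_succ (x : ℕ × ℤ) (i : ℕ) (hi : 1 ≤ i) (hin : i ≤ n) (h : X.label x (rootA n i n))
      (hx : x ∈ ρ) (hc : n + 1 ∈ c) : NewLabel n c X Y ρ ρ' x (rootDpos n i (n + 1))
  | left_n (x : ℕ × ℤ) (i : ℕ) (hi : 1 ≤ i) (hin : i ≤ n) (h : Y.label x (rootA n i n))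
      (hx : x ∈ ρ') (hc : n ∈ c) : NewLabel n c X Y ρ ρ' x (rootDpos n i (n + 1))
  | left_succ (x : ℕ × ℤ) (i : ℕ) (hi : 1 ≤ i) (hin : i ≤ n) (h : Y.label x (rootA n i n))
      (hx : x ∈ ρ') (hc : n + 1 ∈ c) : NewLabel n c X Y ρ ρ' x (rootDneg n i (n + 1))

/-- The glued quiver, with the new labels. -/
def relabel {n : ℕ} (c : List ℕ) (X Y : CoordQuiver (Lat n)) (ρ ρ' : List (ℕ × ℤ)) :
    CoordQuiver (Lat n) where
  label := NewLabel n c X Y ρ ρ'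
  arrow := (glue X Y).arrow

end FoldedAR

open FoldedAR

namespace FoldedAR

/-! ### Vectors, reflections and actions of words -/

/-! Both labellings are read off from one sequence of signed basis vectors. With x(i) = (ξ(1) + 1 -
ξ(i) - i)/2 (`prof`), the point (i, ξ(i) - 2t) is encoded by the interval of integers [k, k + i],
where k = x(i) + t. If p is its position then 2k + i = ξ(1) + 1 - p. So a move by 2 to the left
shifts the interval by 1, an S-sectional path keeps the right end, and an N-sectional path keeps the
left end.

The sets [x(i), x(i) + i - 1] form a chain that grows by one point at a time. The step at which a
point appears numbers the points of the window [x(n), x(n) + n] from 1 to n + 1. This number,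
extended with period n + 1, is `lvl`. A letter of an adapted word moves one row by one, which
exchanges two consecutive points of the chain exactly as the simple reflection exchanges two basis
vectors. Therefore a prefix of the word sends ε_j to the j-th point of the current chain
(`movesBasis_prefix`), and a word that moves every row equally acts as a shift. In type A the label
of [k, k + i] is ε_{lvl k} - ε_{lvl (k+i)}, present when this root is positive (`ARLabel_iff`). In
type D it is e_k - e_{k+i} for all n + 1 intervals of each row (`FoldedLabel_iff`), where e = `cyc`
changes sign after n + 1 steps. This is consistent because the letters n and n + 1 alternate in the
word. The vector ε_{n+1} enters at x(n) + n, with sign + or - according to whether n or n + 1 occurs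
in c.

The comparison is now direct. If lvl k > lvl (k+i), the complementary interval [k + i, k + n + 1],
of length n + 1 - i, has increasing end levels; it accounts for the upside-down copy
(`upsideDown_label_iff`). So in the glued quiver every point carries its two end levels in
increasing order. The path ρ consists of the intervals with right end x(n) + n, and ρ' of those with
left end x(n) + n. The position relative to ρ and ρ' says which ends have passed x(n) + n, hence
which basis vectors have changed sign. With no end past it, or both, the D-label is a difference;
with one it is a sum.

The coordinates of a letter are its row and the number of earlier letters of that row. Letters of
neighbouring rows alternate, so the combinatorial arrows are the unit steps
(`combArrow_iff_isStep`), and they depend only on the commutation class (`CommEquiv.combArrow_iff`).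
Finally, every twisted adapted class has a word c because a reflection functor rotates one letter of
c and applies ∨ to it (`blocks_rotate`). This uses i^* = ∨^{n+1}(i), which follows from
`act_twistedWord`. -/

theorem eps_dot {n i : ℕ} (h1 : 1 ≤ i) (h2 : i ≤ n + 1) (v : Lat n) :
    eps n i ⬝ᵥ v = v ⟨i - 1, by omega⟩ := by
  simp only [eps, dotProduct]
  rw [Finset.sum_eq_single (⟨i - 1, by omega⟩ : Fin (n + 1))]
  · rw [if_pos (by simp; omega), one_mul]
  · intro b _ hb
    rw [if_neg, zero_mul]
    intro h
    apply hb
    ext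
    simp
    omega
  · simp

theorem eps_dot_eps {n i : ℕ} (h1 : 1 ≤ i) (h2 : i ≤ n + 1) (j : ℕ) :
    eps n i ⬝ᵥ eps n j = if i = j then 1 else 0 := by
  rw [eps_dot h1 h2]
  unfold eps
  simp only
  congr 1
  simp
  omega

theorem refl_add (n i : ℕ) (v w : Lat n) : refl n i (v + w) = refl n i v + refl n i w := by
  simp only [refl, add_dotProduct, add_smul]
  abel

theorem refl_neg (n i : ℕ) (v : Lat n) : refl n i (-v) = -refl n i v := by
  simp only [refl, neg_dotProduct, neg_smul]
  abel

theorem act_add (n : ℕ) (u : List ℕ) (v w : Lat n) : act n u (v + w) = act n u v + act n u w := by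
  induction u with
  | nil => rfl
  | cons i u ih => simp only [act, ih, refl_add]

theorem act_neg (n : ℕ) (u : List ℕ) (v : Lat n) : act n u (-v) = -act n u v := by
  induction u with
  | nil => rfl
  | cons i u ih => simp only [act, ih, refl_neg]

theorem act_sub (n : ℕ) (u : List ℕ) (v w : Lat n) : act n u (v - w) = act n u v - act n u w := by
  rw [sub_eq_add_neg, act_add, act_neg, ← sub_eq_add_neg]

theorem act_units_smul (n : ℕ) (u : List ℕ) (s : ℤˣ) (v : Lat n) :
    act n u (s • v) = s • act n u v := by
  rcases Int.units_eq_one_or s with rfl | rfl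
  · simp
  · simp [Units.smul_def, act_neg]

theorem act_append (n : ℕ) (u u' : List ℕ) (v : Lat n) :
    act n (u ++ u') v = act n u (act n u' v) := by
  induction u with
  | nil => rfl
  | cons i u ih => simp only [List.cons_append, act, ih]

theorem simpleRoot_of_le {n i : ℕ} (h : i ≤ n) : simpleRoot n i = eps n i - eps n (i + 1) := by
  rw [simpleRoot, if_neg (by omega)]

theorem simpleRoot_last (n : ℕ) : simpleRoot n (n + 1) = eps n n + eps n (n + 1) := by
  rw [simpleRoot, if_pos rfl]

theorem eps_dot_simpleRoot {n i j : ℕ} (hj : 1 ≤ j) (hj' : j ≤ n + 1) :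
    eps n j ⬝ᵥ simpleRoot n i =
      if i = n + 1 then (if j = n ∨ j = n + 1 then 1 else 0)
      else if j = i then 1 else if j = i + 1 then -1 else 0 := by
  unfold simpleRoot
  split_ifs <;>
    simp only [dotProduct_add, dotProduct_sub, eps_dot_eps hj hj'] <;> split_ifs <;> omega

theorem refl_eps_of_ne {n i j : ℕ} (hj : 1 ≤ j) (hj' : j ≤ n + 1) (hi : i ≤ n) (h : j ≠ i)
    (h' : j ≠ i + 1) : refl n i (eps n j) = eps n j := by
  rw [refl, eps_dot_simpleRoot hj hj', if_neg (by omega), if_neg h, if_neg h']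
  simp

theorem refl_eps_self {n i : ℕ} (hi : 1 ≤ i) (hi' : i ≤ n) :
    refl n i (eps n i) = eps n (i + 1) := by
  rw [refl, eps_dot_simpleRoot hi (by omega), if_neg (by omega), if_pos rfl, simpleRoot_of_le hi']
  simp

theorem refl_eps_succ {n i : ℕ} (hi' : i ≤ n) :
    refl n i (eps n (i + 1)) = eps n i := by
  rw [refl, eps_dot_simpleRoot (by omega) (by omega), if_neg (by omega), if_neg (by omega),
    if_pos rfl, simpleRoot_of_le hi']
  simp

theorem refl_last_eps_of_lt {n j : ℕ} (hj : 1 ≤ j) (hj' : j < n) :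
    refl n (n + 1) (eps n j) = eps n j := by
  rw [refl, eps_dot_simpleRoot hj (by omega), if_pos rfl, if_neg (by omega)]
  simp

theorem refl_last_eps_n {n : ℕ} (hn : 1 ≤ n) :
    refl n (n + 1) (eps n n) = -eps n (n + 1) := by
  rw [refl, eps_dot_simpleRoot hn (by omega), if_pos rfl, if_pos (by omega), simpleRoot_last]
  simp

theorem refl_last_eps_last {n : ℕ} :
    refl n (n + 1) (eps n (n + 1)) = -eps n n := by
  rw [refl, eps_dot_simpleRoot (by omega) (by omega), if_pos rfl, if_pos (by omega),
    simpleRoot_last]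
  simp

/-! ### Signed pairs of basis vectors and positive roots -/

theorem eps_apply {n i j : ℕ} (h1 : 1 ≤ j) (h2 : j ≤ n + 1) :
    eps n i ⟨j - 1, by omega⟩ = if j = i then 1 else 0 := by
  unfold eps
  simp only
  congr 1
  simp
  omega

/-- The coordinates of a sum of two multiples of basis vectors. -/
theorem smul_eps_add_apply {n a b : ℕ} (s t : ℤ) {j : ℕ} (h1 : 1 ≤ j) (h2 : j ≤ n + 1) :
    (s • eps n a + t • eps n b) ⟨j - 1, by omega⟩ =
      (if j = a then s else 0) + (if j = b then t else 0) := by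
  simp only [Pi.add_apply, Pi.smul_apply, eps_apply h1 h2]
  split_ifs <;> simp

/-- A sum of two signed, distinct basis vectors determines the unordered pair of them. -/
theorem signed_pair_unique {n a b c d : ℕ} (s t s' t' : ℤˣ) (ha : 1 ≤ a) (ha' : a ≤ n + 1)
    (hb : 1 ≤ b) (hb' : b ≤ n + 1) (hc : 1 ≤ c) (hc' : c ≤ n + 1) (hd : 1 ≤ d) (hd' : d ≤ n + 1)
    (hab : a ≠ b) (hcd : c ≠ d)
    (h : (s : ℤ) • eps n a + (t : ℤ) • eps n b = (s' : ℤ) • eps n c + (t' : ℤ) • eps n d) :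
    (a = c ∧ b = d ∧ s = s' ∧ t = t') ∨ (a = d ∧ b = c ∧ s = t' ∧ t = s') := by
  have key : ∀ j, 1 ≤ j → j ≤ n + 1 →
      (if j = a then (s : ℤ) else 0) + (if j = b then (t : ℤ) else 0) =
      (if j = c then (s' : ℤ) else 0) + (if j = d then (t' : ℤ) else 0) := by
    intro j h1 h2
    rw [← smul_eps_add_apply _ _ h1 h2, h, smul_eps_add_apply _ _ h1 h2]
  have k1 := key a ha ha'
  have k2 := key b hb hb'
  have k3 := key c hc hc'
  rw [if_pos rfl, if_neg hab] at k1
  rw [if_pos rfl, if_neg (Ne.symm hab)] at k2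
  rw [if_pos rfl, if_neg hcd] at k3
  simp only [add_zero, zero_add] at k1 k2 k3
  rcases eq_or_ne a c with rfl | hac
  · rw [if_pos rfl, if_neg hcd] at k1
    rw [if_neg (Ne.symm hab)] at k2
    by_cases hbd : b = d
    · rw [if_pos hbd] at k2
      left
      refine ⟨rfl, hbd, ?_, ?_⟩ <;> ext <;> omega
    · rw [if_neg hbd] at k2
      exact absurd k2 (by simp)
  · rw [if_neg hac] at k1
    by_cases had : a = d
    · rw [if_pos had] at k1
      subst had
      rw [if_neg (Ne.symm hab)] at k2
      by_cases hbc : b = c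
      · rw [if_pos hbc] at k2
        right
        refine ⟨rfl, hbc, ?_, ?_⟩ <;> ext <;> omega
      · rw [if_neg hbc] at k2
        exact absurd k2 (by simp)
    · rw [if_neg had] at k1
      exact absurd k1 (by simp)

theorem rootA_injective {n a b c d : ℕ} (ha : 1 ≤ a) (hab : a ≤ b) (hb : b ≤ n) (hc : 1 ≤ c)
    (hcd : c ≤ d) (hd : d ≤ n) (h : rootA n a b = rootA n c d) : a = c ∧ b = d := by
  have := signed_pair_unique (n := n) (a := a) (b := b + 1) (c := c) (d := d + 1) 1 (-1) 1 (-1)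
    ha (by omega) (by omega) (by omega) hc (by omega) (by omega) (by omega) (by omega) (by omega)
    (by simpa [rootA, sub_eq_add_neg] using h)
  omega

/-- A signed pair of basis vectors is a positive root of `D_{n+1}` iff the sign of the basis
vector with smaller index is positive. -/
theorem isPosRootD_signed_iff {n a b : ℕ} (s t : ℤˣ) (ha : 1 ≤ a) (hab : a < b)
    (hb : b ≤ n + 1) :
    IsPosRootD n ((s : ℤ) • eps n a + (t : ℤ) • eps n b) ↔ s = 1 := by
  constructor
  · rintro ⟨c, d, hc, hcd, hd, h | h⟩
    · have := signed_pair_unique s t 1 (-1) ha (by omega) (by omega) hb hc (by omega) (by omega) hd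
        (by omega) (by omega) (by simpa [rootDneg, sub_eq_add_neg] using h)
      rcases this with ⟨_, _, h, _⟩ | ⟨_, _, _, _⟩
      · exact h
      · omega
    · have := signed_pair_unique s t 1 1 ha (by omega) (by omega) hb hc (by omega) (by omega) hd
        (by omega) (by omega) (by simpa [rootDpos] using h)
      rcases this with ⟨_, _, h, _⟩ | ⟨_, _, h, _⟩
      · exact h
      · exact h
  · rintro rfl
    refine ⟨a, b, ha, hab, hb, ?_⟩
    rcases Int.units_eq_one_or t with rfl | rfl
    · right; simp [rootDpos]
    · left; simp [rootDneg, sub_eq_add_neg]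

theorem isPosRootA_eps_sub_iff {n a b : ℕ} (ha : 1 ≤ a) (ha' : a ≤ n + 1) (hb : 1 ≤ b)
    (hb' : b ≤ n + 1) (hab : a ≠ b) : IsPosRootA n (eps n a - eps n b) ↔ a < b := by
  constructor
  · rintro ⟨c, d, hc, hcd, hd, h⟩
    have := signed_pair_unique (n := n) (a := a) (b := b) (c := c) (d := d + 1) 1 (-1) 1 (-1)
      ha (by omega) (by omega) (by omega) hc (by omega) (by omega) (by omega) (by omega) (by omega)
      (by simpa [rootA, sub_eq_add_neg] using h)
    rcases this with h | ⟨_, _, h, _⟩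
    · omega
    · exact absurd h (by decide)
  · intro h
    exact ⟨a, b - 1, ha, by omega, by omega, by rw [rootA, Nat.sub_add_cancel hb]⟩

theorem orb_vee (n i : ℕ) : orb n (vee n i) = orb n i := by
  unfold orb vee; split_ifs <;> omega

theorem orb_vee_iterate (n k i : ℕ) : orb n ((vee n)^[k] i) = orb n i := by
  induction k with
  | zero => rfl
  | succ k ih => rw [Function.iterate_succ_apply', orb_vee, ih]

theorem vee_vee (n i : ℕ) : vee n (vee n i) = i := by
  unfold vee; split_ifs <;> omega

/-! ### Profiles

A vertex in row `i` is encoded by an interval `[k, k + i]` of integers. The rightmost vertices of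
the rows are the intervals `[x i, x i + i]` of a profile `x`, and they are nested. -/

/-- The intervals `[x i, x i + i - 1]`, `1 ≤ i ≤ n`, grow by one point, on the left or on the right.
The value at `n + 1` is a convention. -/
structure IsProfile (n : ℕ) (x : ℕ → ℤ) : Prop where
  step : ∀ i, 1 ≤ i → i < n → x (i + 1) = x i ∨ x (i + 1) = x i - 1
  last : x (n + 1) = x n

/-- Each step extends the interval by one point, to the left when x drops and to the right
otherwise, so the intervals are nested. By the convention at n + 1 the last point is added on the
right. -/
theorem IsProfile.mono {n : ℕ} {x : ℕ → ℤ} (hx : IsProfile n x) {i j : ℕ} (hi : 1 ≤ i)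
    (hij : i ≤ j) (hj : j ≤ n + 1) : x j ≤ x i ∧ x i + i ≤ x j + j := by
  induction j, hij using Nat.le_induction with
  | base => simp
  | succ j hij ih =>
    have := ih (by omega)
    rcases Nat.lt_or_ge j n with h | h
    · have := hx.step j (by omega) h
      push_cast
      omega
    · obtain rfl : j = n := by omega
      have := hx.last
      push_cast
      omega

/-- The representative of `k` modulo `n + 1` in `[x n, x n + n]`. -/
def window (n : ℕ) (x : ℕ → ℤ) (k : ℤ) : ℤ := x n + (k - x n) % (n + 1)

/-- The smallest `i` for which `k` lies in `[x i, x i + i - 1]`, up to a multiple of `n + 1`. -/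
noncomputable def lvl (n : ℕ) (x : ℕ → ℤ) (k : ℤ) : ℕ :=
  sInf {i | 1 ≤ i ∧ x i ≤ window n x k ∧ window n x k < x i + i}

theorem window_add_mul (n : ℕ) (x : ℕ → ℤ) (k m : ℤ) :
    window n x (k + (n + 1) * m) = window n x k := by
  unfold window
  rw [show k + (n + 1) * m - x n = k - x n + (n + 1) * m by ring, Int.add_mul_emod_self_left]

theorem window_of_mem {n : ℕ} {x : ℕ → ℤ} {k : ℤ} (h : x n ≤ k) (h' : k ≤ x n + n) :
    window n x k = k := by
  unfold window
  rw [Int.emod_eq_of_lt (by omega) (by omega)]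
  ring

theorem window_mem (n : ℕ) (x : ℕ → ℤ) (k : ℤ) :
    x n ≤ window n x k ∧ window n x k ≤ x n + n := by
  unfold window
  have h1 := Int.emod_nonneg (k - x n) (b := (n : ℤ) + 1) (by omega)
  have h2 := Int.emod_lt_of_pos (k - x n) (b := (n : ℤ) + 1) (by omega)
  omega

theorem lvl_add_mul (n : ℕ) (x : ℕ → ℤ) (k m : ℤ) : lvl n x (k + (n + 1) * m) = lvl n x k := by
  unfold lvl
  rw [window_add_mul]

theorem lvl_add_period (n : ℕ) (x : ℕ → ℤ) (k : ℤ) : lvl n x (k + (n + 1)) = lvl n x k := by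
  simpa using lvl_add_mul n x k 1

theorem lvl_sub_period (n : ℕ) (x : ℕ → ℤ) (k : ℤ) : lvl n x (k - (n + 1)) = lvl n x k := by
  rw [← lvl_add_period, sub_add_cancel]

theorem window_eq_add_mul (n : ℕ) (x : ℕ → ℤ) (k : ℤ) :
    k = window n x k + (n + 1) * ((k - x n) / (n + 1)) := by
  unfold window
  have := Int.emod_add_mul_ediv (k - x n) (n + 1)
  linarith

theorem lvl_window (n : ℕ) (x : ℕ → ℤ) (k : ℤ) : lvl n x (window n x k) = lvl n x k := by
  conv_rhs => rw [window_eq_add_mul n x k, lvl_add_mul]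

theorem IsProfile.lvl_mem {n : ℕ} {x : ℕ → ℤ} (hx : IsProfile n x) (k : ℤ) :
    1 ≤ lvl n x k ∧ x (lvl n x k) ≤ window n x k ∧ window n x k < x (lvl n x k) + lvl n x k := by
  apply Nat.sInf_mem (s := {i | 1 ≤ i ∧ x i ≤ window n x k ∧ window n x k < x i + i})
  have := window_mem n x k
  have := hx.last
  -- The set defining `lvl` is nonempty: the interval of n + 1 is the whole window.
  exact ⟨n + 1, by omega, by omega, by push_cast; omega⟩

theorem IsProfile.lvl_pos {n : ℕ} {x : ℕ → ℤ} (hx : IsProfile n x) (k : ℤ) : 1 ≤ lvl n x k :=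
  (hx.lvl_mem k).1

theorem IsProfile.lvl_le {n : ℕ} {x : ℕ → ℤ} (hx : IsProfile n x) (k : ℤ) :
    lvl n x k ≤ n + 1 := by
  apply Nat.sInf_le
  have := window_mem n x k
  have := hx.last
  exact ⟨by omega, by omega, by push_cast; omega⟩

/-- By nesting, a point that belongs to one interval of the chain belongs to all later ones. -/
theorem IsProfile.lvl_le_iff {n : ℕ} {x : ℕ → ℤ} (hx : IsProfile n x) {i : ℕ} {k : ℤ}
    (hi : 1 ≤ i) (hi' : i ≤ n + 1) (hk : x n ≤ k) (hk' : k ≤ x n + n) :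
    lvl n x k ≤ i ↔ x i ≤ k ∧ k < x i + i := by
  constructor
  · intro h
    have h1 := hx.lvl_mem k
    rw [window_of_mem hk hk'] at h1
    have := hx.mono h1.1 h hi'
    omega
  · intro h
    apply Nat.sInf_le
    rw [Set.mem_ofPred_eq, window_of_mem hk hk']
    exact ⟨hi, h⟩

/-- Only one new point appears at each step of the chain, so two points that appear at the same step
coincide. -/
theorem IsProfile.lvl_injective_of_mem {n : ℕ} {x : ℕ → ℤ} (hx : IsProfile n x) {k l : ℤ}
    (hk : x n ≤ k) (hk' : k ≤ x n + n) (hl : x n ≤ l) (hl' : l ≤ x n + n)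
    (h : lvl n x k = lvl n x l) : k = l := by
  have h1 := hx.lvl_pos k
  have h2 := hx.lvl_le k
  have a1 := (hx.lvl_le_iff h1 h2 hk hk').1 le_rfl
  have a2 := (hx.lvl_le_iff h1 h2 hl hl').1 h.ge
  generalize hj : lvl n x k = j at *
  rcases Nat.eq_or_lt_of_le h1 with rfl | h3
  · push_cast at a1 a2
    omega
  · obtain ⟨i, rfl⟩ : ∃ i, j = i + 1 := ⟨j - 1, by omega⟩
    have b1 := mt (hx.lvl_le_iff (i := i) (by omega) (by omega) hk hk').2 (by omega)
    have b2 := mt (hx.lvl_le_iff (i := i) (by omega) (by omega) hl hl').2 (by omega)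
    push_cast at a1 a2
    rcases Nat.lt_or_ge i n with h4 | h4
    · have := hx.step i (by omega) h4
      omega
    · obtain rfl : i = n := by omega
      have := hx.last
      omega

theorem IsProfile.lvl_eq_iff {n : ℕ} {x : ℕ → ℤ} (hx : IsProfile n x) {k l : ℤ} :
    lvl n x k = lvl n x l ↔ ∃ m : ℤ, l = k + (n + 1) * m := by
  constructor
  · intro h
    have h1 := window_mem n x k
    have h2 := window_mem n x l
    have := hx.lvl_injective_of_mem h1.1 h1.2 h2.1 h2.2 (by rw [lvl_window, lvl_window, h])
    refine ⟨(l - x n) / (n + 1) - (k - x n) / (n + 1), ?_⟩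
    have e1 := window_eq_add_mul n x k
    have e2 := window_eq_add_mul n x l
    linear_combination e2 - e1 - this
  · rintro ⟨m, rfl⟩
    rw [lvl_add_mul]

/-- Two integers that differ by less than `n + 1` have different levels. -/
theorem IsProfile.lvl_ne {n : ℕ} {x : ℕ → ℤ} (hx : IsProfile n x) {k l : ℤ} (h : k < l)
    (h' : l < k + (n + 1)) : lvl n x k ≠ lvl n x l := by
  rw [Ne, hx.lvl_eq_iff]
  rintro ⟨m, rfl⟩
  rcases le_or_gt m 0 with hm | hm
  · nlinarith
  · nlinarith

/-- The integer attached to the `j`-th step of a path with heights `f`. -/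
def kap (n : ℕ) (f : ℕ → ℤ) (j : ℕ) : ℤ :=
  if j = 1 then f 1 else if j = n + 1 then f n + n else
    if f j = f (j - 1) then f (j - 1) + (j - 1) else f j

theorem IsProfile.lvl_last {n : ℕ} {x : ℕ → ℤ} (hx : IsProfile n x) (hn : 1 ≤ n) :
    lvl n x (x n + n) = n + 1 := by
  have h := mt (hx.lvl_le_iff (i := n) (k := x n + n) hn (by omega) (by omega) (by omega)).1
    (by omega)
  have := hx.lvl_le (x n + n)
  omega

theorem IsProfile.lvl_le_n {n : ℕ} {x : ℕ → ℤ} (hx : IsProfile n x) (hn : 1 ≤ n) {k : ℤ}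
    (hk : x n ≤ k) (hk' : k < x n + n) : lvl n x k ≤ n :=
  (hx.lvl_le_iff (i := n) hn (by omega) hk (by omega)).2 ⟨hk, hk'⟩

/-- `kap` names the point added at step j: the one just beyond the old right end if the left end
stays, and the new left end otherwise. -/
theorem IsProfile.kap_mem {n : ℕ} {x : ℕ → ℤ} (hx : IsProfile n x) (hn : 1 ≤ n) {j : ℕ}
    (hj : 1 ≤ j) (hj' : j ≤ n) :
    x n ≤ kap n x j ∧ kap n x j < x n + n ∧ lvl n x (kap n x j) = j := by
  obtain ⟨i, rfl⟩ : ∃ i, j = i + 1 := ⟨j - 1, by omega⟩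
  have h1 := hx.mono hj hj' (by omega)
  rcases Nat.eq_zero_or_pos i with rfl | hi
  · have hk : kap n x (0 + 1) = x 1 := by simp [kap]
    simp only [zero_add] at *
    have := hx.lvl_pos (x 1)
    have := (hx.lvl_le_iff (i := 1) (k := x 1) le_rfl (by omega) (by omega) (by omega)).2 (by omega)
    rw [hk]
    omega
  · have h2 := hx.mono hi (Nat.le_succ i) (by omega)
    have h3 := hx.step i hi (by omega)
    have hk : kap n x (i + 1) = x (i + 1) ∧ x (i + 1) = x i - 1 ∨
        kap n x (i + 1) = x i + i ∧ x (i + 1) = x i := by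
      rw [kap, if_neg (by omega), if_neg (by omega)]
      simp only [add_tsub_cancel_right, Nat.cast_add, Nat.cast_one]
      split_ifs <;> omega
    push_cast at *
    have h4 : x n ≤ kap n x (i + 1) := by omega
    have h5 : kap n x (i + 1) < x n + n := by omega
    have h6 := (hx.lvl_le_iff (i := i + 1) (by omega) (by omega) h4 h5.le).2 (by push_cast; omega)
    have h7 := mt (hx.lvl_le_iff (i := i) hi (by omega) h4 h5.le).1 (by omega)
    omega

/-- Every `j` is the level of an integer in the window. -/
theorem IsProfile.exists_lvl {n : ℕ} {x : ℕ → ℤ} (hx : IsProfile n x) (hn : 1 ≤ n) {j : ℕ}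
    (hj : 1 ≤ j) (hj' : j ≤ n + 1) : ∃ k, x n ≤ k ∧ k ≤ x n + n ∧ lvl n x k = j := by
  rcases Nat.lt_or_ge n j with h | h
  · obtain rfl : j = n + 1 := by omega
    exact ⟨x n + n, by omega, le_rfl, hx.lvl_last hn⟩
  · have := hx.kap_mem hn hj h
    exact ⟨_, this.1, this.2.1.le, this.2.2⟩

/-! ### Comparing the levels of the two ends of an interval -/

/-- The chain starts at the point x 1. An interval of the chain that contains l also contains
everything between x 1 and l, so points further from x 1 on the same side appear later. -/
theorem IsProfile.lvl_lt_of_right {n : ℕ} {x : ℕ → ℤ} (hx : IsProfile n x) (hn : 1 ≤ n) {k l : ℤ}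
    (hk : x 1 ≤ k) (hkl : k < l) (hl : l ≤ x n + n) : lvl n x k < lvl n x l := by
  have h1 := hx.lvl_pos l
  have h2 := hx.lvl_le l
  have h0 := hx.mono le_rfl hn (by omega)
  have h3 := (hx.lvl_le_iff h1 h2 (by omega) hl).1 le_rfl
  have h4 := hx.mono le_rfl h1 h2
  have h5 := (hx.lvl_le_iff h1 h2 (k := k) (by omega) (by omega)).2 (by omega)
  have h6 := hx.lvl_ne hkl (by omega)
  omega

theorem IsProfile.lvl_lt_of_left {n : ℕ} {x : ℕ → ℤ} (hx : IsProfile n x) (hn : 1 ≤ n) {k l : ℤ}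
    (hk : x n ≤ k) (hkl : k < l) (hl : l ≤ x 1) : lvl n x l < lvl n x k := by
  have h1 := hx.lvl_pos k
  have h2 := hx.lvl_le k
  have h0 := hx.mono le_rfl hn (by omega)
  have h3 := (hx.lvl_le_iff h1 h2 hk (by omega)).1 le_rfl
  have h4 := hx.mono le_rfl h1 h2
  have h5 := (hx.lvl_le_iff h1 h2 (k := l) (by omega) (by omega)).2 (by omega)
  have h6 := hx.lvl_ne hkl (by omega)
  omega

/-- Intervals within the window, not to the left of the profile, have increasing ends. -/
theorem IsProfile.lvl_lt_of_low {n : ℕ} {x : ℕ → ℤ} (hx : IsProfile n x) (hn : 1 ≤ n) {i : ℕ}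
    (hi : 1 ≤ i) (hi' : i ≤ n) {k : ℤ} (hk : x i ≤ k) (hk' : k + i ≤ x n + n) :
    lvl n x k < lvl n x (k + i) := by
  have h0 := hx.mono le_rfl hi (by omega)
  have h1 := hx.mono hi hi' (by omega)
  -- Either both ends lie to the right of x 1, or k is in the i-th set of the chain. This set has i
  -- points, so in the second case it misses k + i.
  rcases le_or_gt (x i + i) k with h | h
  · exact hx.lvl_lt_of_right hn (by omega) (by omega) hk'
  · have h2 := (hx.lvl_le_iff hi (by omega) (k := k) (by omega) (by omega)).2 (by omega)
    have h3 := mt (hx.lvl_le_iff hi (by omega) (k := k + i) (by omega) (by omega)).1 (by omega)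
    omega

/-- Intervals in the window, to the left of the profile, have decreasing ends. -/
theorem IsProfile.lvl_lt_of_lt {n : ℕ} {x : ℕ → ℤ} (hx : IsProfile n x) (hn : 1 ≤ n) {i : ℕ}
    (hi : 1 ≤ i) (hi' : i ≤ n) {k : ℤ} (hk : x n ≤ k) (hk' : k < x i) :
    lvl n x (k + i) < lvl n x k := by
  have h0 := hx.mono le_rfl hi (by omega)
  have h1 := hx.mono hi hi' (by omega)
  rcases le_or_gt (x i) (k + i) with h | h
  · have h2 := mt (hx.lvl_le_iff hi (by omega) (k := k) (by omega) (by omega)).1 (by omega)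
    have h3 := (hx.lvl_le_iff hi (by omega) (k := k + i) (by omega) (by omega)).2 (by omega)
    omega
  · exact hx.lvl_lt_of_left hn hk (by omega) (by omega)

/-- One period further to the left, this is `lvl_lt_of_lt`. -/
theorem IsProfile.lvl_lt_of_high {n : ℕ} {x : ℕ → ℤ} (hx : IsProfile n x) (hn : 1 ≤ n) {i : ℕ}
    (hi : 1 ≤ i) (hi' : i ≤ n) {k : ℤ} (hk : x n + n < k) (hk' : k ≤ x i + n) :
    lvl n x (k + i) < lvl n x k := by
  have := hx.lvl_lt_of_lt hn hi hi' (k := k - (n + 1)) (by omega) (by omega)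
  rwa [lvl_sub_period, show k - (n + 1) + i = k + i - (n + 1) by ring, lvl_sub_period] at this

/-- Once the ends of an interval are decreasing, they remain so when the interval moves. -/
theorem IsProfile.lvl_lt_succ {n : ℕ} {x : ℕ → ℤ} (hx : IsProfile n x) (hn : 1 ≤ n) {i : ℕ}
    (hi : 1 ≤ i) (hi' : i ≤ n) {k : ℤ} (hk : x i ≤ k) (hk' : k < x i + n)
    (h : lvl n x (k + i) < lvl n x k) : lvl n x (k + 1 + i) < lvl n x (k + 1) := by
  have h0 := hx.mono le_rfl hi (by omega)
  have h1 := hx.mono hi hi' (by omega)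
  rcases le_or_gt (k + i) (x n + n) with h2 | h2
  · have := hx.lvl_lt_of_low hn hi hi' hk h2
    omega
  · rcases le_or_gt (x n + n) k with h3 | h3
    · exact hx.lvl_lt_of_high hn hi hi' (by omega) (by omega)
    -- The interval straddles the end of the window. Its right end is brought back by a period, to a
    -- point l on the left of k.
    · have e1 : lvl n x (k + i) = lvl n x (k + i - (n + 1)) := (lvl_sub_period _ _ _).symm
      have e2 : lvl n x (k + 1 + i) = lvl n x (k + i - (n + 1) + 1) := by
        rw [← lvl_sub_period]; congr 1; ring
      rw [e1] at h
      rw [e2]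
      generalize hl : k + i - (n + 1) = l at *
      -- To the left of x 1 levels decrease, which would contradict lvl l < lvl k.
      have h4 : x 1 ≤ k := by
        by_contra h4
        have := hx.lvl_lt_of_left hn (k := l) (l := k) (by omega) (by omega) (by omega)
        omega
      have h5 := hx.lvl_lt_of_right hn (k := k) (l := k + 1) h4 (by omega) (by omega)
      -- If l < x 1, the step to l + 1 lowers its level while the step to k + 1 raises the other.
      -- Otherwise l + 1 < k + 1 both lie on the right of x 1.
      rcases lt_or_ge l (x 1) with h6 | h6
      · have := hx.lvl_lt_of_left hn (k := l) (l := l + 1) (by omega) (by omega) (by omega)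
        omega
      · exact hx.lvl_lt_of_right hn (by omega) (by omega) (by omega)

/-- The last interval of each row never carries a root of type A. Its left end is either beyond the
window or the point x n + n of maximal level. -/
theorem IsProfile.lvl_lt_end {n : ℕ} {x : ℕ → ℤ} (hx : IsProfile n x) (hn : 1 ≤ n) {i : ℕ}
    (hi : 1 ≤ i) (hi' : i ≤ n) : lvl n x (x i + n + i) < lvl n x (x i + n) := by
  have h1 := hx.mono hi hi' (by omega)
  rcases Int.lt_or_eq_of_le h1.1 with h | h
  · exact hx.lvl_lt_of_high hn hi hi' (by omega) (by omega)
  · have h2 := hx.lvl_last hn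
    have h3 := hx.lvl_ne (k := x i + n) (l := x i + n + i) (by omega) (by omega)
    have h4 := hx.lvl_le (x i + n + i)
    rw [h] at h2
    omega

/-- An interval whose complementary interval is a vertex lies to the right of the profile. -/
theorem IsProfile.le_of_lvl_lt {n : ℕ} {x : ℕ → ℤ} (hx : IsProfile n x) (hn : 1 ≤ n) {i i' : ℕ}
    (hi : 1 ≤ i) (hi' : 1 ≤ i') (hii : i + i' = n + 1) {k : ℤ} (hk : x i ≤ k)
    (h : lvl n x (k + i) < lvl n x k) : x i' ≤ k - i' := by
  have h0 := hx.mono le_rfl hi (by omega)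
  have h1 := hx.mono hi (j := n) (by omega) (by omega)
  have h0' := hx.mono le_rfl hi' (by omega)
  have h1' := hx.mono hi' (j := n) (by omega) (by omega)
  rcases le_or_gt (k + i) (x n + n) with h2 | h2
  · have := hx.lvl_lt_of_low hn hi (by omega) hk h2
    omega
  · by_contra h3
    have := hx.lvl_lt_of_lt hn hi' (by omega) (k := k - i') (by omega) (by omega)
    rw [sub_add_cancel, show k - i' = k + i - (n + 1) by omega,
      lvl_sub_period] at this
    omega

/-- The mirror image of `le_of_lvl_lt`: the complementary interval, which starts at k + i, is not
beyond the last interval of its row i'. -/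
theorem IsProfile.le_of_lvl_gt {n : ℕ} {x : ℕ → ℤ} (hx : IsProfile n x) (hn : 1 ≤ n) {i i' : ℕ}
    (hi : 1 ≤ i) (hi' : 1 ≤ i') (hii : i + i' = n + 1) {k : ℤ} (hk' : k ≤ x i + n)
    (h : lvl n x k < lvl n x (k + i)) : k + i ≤ x i' + n := by
  have h0 := hx.mono le_rfl hi (by omega)
  have h1 := hx.mono hi (j := n) (by omega) (by omega)
  have h0' := hx.mono le_rfl hi' (by omega)
  have h1' := hx.mono hi' (j := n) (by omega) (by omega)
  rcases le_or_gt (k + i) (x n + n) with h2 | h2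
  · omega
  · by_contra h3
    rcases lt_or_ge (x n + n) k with h4 | h4
    · have := hx.lvl_lt_of_high hn hi (by omega) h4 hk'
      omega
    · have := hx.lvl_lt_of_low hn hi' (by omega) (k := k + i - (n + 1)) (by omega) (by omega)
      rw [lvl_sub_period, show k + i - (n + 1) + i' = k by omega] at this
      omega

/-! ### The cyclic sequence of signed basis vectors -/

/-- The sequence of signed basis vectors along which a (twisted) Coxeter element moves. It is
periodic of period `n + 1` up to the sign `σ`; the basis vector `ε_{n+1}` has initial sign `δ`. -/
noncomputable def cyc (n : ℕ) (x : ℕ → ℤ) (σ δ : ℤˣ) (k : ℤ) : Lat n :=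
  (σ ^ ((k - x n) / (n + 1)) * if lvl n x k = n + 1 then δ else 1) • eps n (lvl n x k)

theorem cyc_add_period (n : ℕ) (x : ℕ → ℤ) (σ δ : ℤˣ) (k : ℤ) :
    cyc n x σ δ (k + (n + 1)) = σ • cyc n x σ δ k := by
  unfold cyc
  rw [lvl_add_period, show k + (n + 1) - x n = k - x n + (n + 1) by ring,
    Int.add_ediv_of_dvd_right (dvd_refl _), Int.ediv_self (by omega), zpow_add_one, smul_smul,
    mul_comm _ σ, mul_assoc]

theorem cyc_add_mul (n : ℕ) (x : ℕ → ℤ) (σ δ : ℤˣ) (k m : ℤ) :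
    cyc n x σ δ (k + (n + 1) * m) = σ ^ m • cyc n x σ δ k := by
  unfold cyc
  rw [lvl_add_mul, show k + (n + 1) * m - x n = k - x n + (n + 1) * m by ring,
    Int.add_mul_ediv_left _ _ (by omega), zpow_add, smul_smul, ← mul_assoc, mul_comm (σ ^ m)]

theorem IsProfile.cyc_of_mem {n : ℕ} {x : ℕ → ℤ} (hx : IsProfile n x) (hn : 1 ≤ n) (σ δ : ℤˣ)
    {k : ℤ} (hk : x n ≤ k) (hk' : k < x n + n) : cyc n x σ δ k = eps n (lvl n x k) := by
  unfold cyc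
  rw [Int.ediv_eq_zero_of_lt (by omega) (by omega),
    if_neg (by have := hx.lvl_le_n hn hk hk'; omega)]
  simp

theorem IsProfile.cyc_last {n : ℕ} {x : ℕ → ℤ} (hx : IsProfile n x) (hn : 1 ≤ n) (σ δ : ℤˣ) :
    cyc n x σ δ (x n + n) = δ • eps n (n + 1) := by
  unfold cyc
  rw [hx.lvl_last hn, Int.ediv_eq_zero_of_lt (by omega) (by omega), if_pos rfl]
  simp

theorem cyc_one_one (n : ℕ) (x : ℕ → ℤ) (k : ℤ) : cyc n x 1 1 k = eps n (lvl n x k) := by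
  simp [cyc]

theorem IsProfile.cyc_kap {n : ℕ} {x : ℕ → ℤ} (hx : IsProfile n x) (hn : 1 ≤ n) (σ δ : ℤˣ)
    {j : ℕ} (hj : 1 ≤ j) (hj' : j ≤ n) : cyc n x σ δ (kap n x j) = eps n j := by
  obtain ⟨h1, h2, h3⟩ := hx.kap_mem hn hj hj'
  rw [hx.cyc_of_mem hn σ δ h1 h2, h3]

/-! ### Legal words -/

/-- The heights `f` after the rows in the list `r` have been moved by one. -/
def adv (f : ℕ → ℤ) (r : List ℕ) : ℕ → ℤ := fun i => f i + r.count i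

/-- Every row in the list moves at a moment when its height permits it. -/
def RowLegal (n : ℕ) (f : ℕ → ℤ) (r : List ℕ) : Prop :=
  ∀ u i v, r = u ++ i :: v → 1 ≤ i ∧ i ≤ n ∧
    (2 ≤ i → adv f u (i - 1) = adv f u i + 1) ∧ (i < n → adv f u (i + 1) = adv f u i)

/-- The letters of row `n` are chosen according to a sign `δ`, which is multiplied by `σ` after each
of them. -/
def LetterLegal (n : ℕ) (σ δ : ℤˣ) (w : List ℕ) : Prop :=
  ∀ u a v, w = u ++ a :: v → orb n a = n →
    a = if δ * σ ^ (u.map (orb n)).count n = 1 then n else n + 1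

theorem adv_nil (f : ℕ → ℤ) : adv f [] = f := by
  funext i; simp [adv]

theorem adv_append (f : ℕ → ℤ) (r s : List ℕ) : adv f (r ++ s) = adv (adv f r) s := by
  funext i; simp [adv, add_assoc]

theorem adv_singleton_self (f : ℕ → ℤ) (i : ℕ) : adv f [i] i = f i + 1 := by
  simp [adv]

theorem adv_singleton_of_ne (f : ℕ → ℤ) {i j : ℕ} (h : j ≠ i) : adv f [i] j = f j := by
  simp [adv, Ne.symm h]

/-- When row i < n may move, the points number i and i + 1 of the chain are f i and f i + i. After
the move they have changed places and the other points are the same. This lemma and the four below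
express that exchange; row n has no partner among 1, …, n and is completed by the point f n + n. -/
theorem kap_self {n : ℕ} {f : ℕ → ℤ} {i : ℕ} (hi : 1 ≤ i) (hi' : i ≤ n)
    (h : 2 ≤ i → f (i - 1) = f i + 1) : kap n f i = f i := by
  unfold kap
  split_ifs with h1 h2 h3
  · rw [h1]
  · omega
  · have := h (by omega)
    omega
  · rfl

theorem kap_succ {n : ℕ} {f : ℕ → ℤ} {i : ℕ} (hi : 1 ≤ i) (hi' : i < n)
    (h : f (i + 1) = f i) : kap n f (i + 1) = f i + i := by
  unfold kap
  rw [if_neg (by omega), if_neg (by omega), Nat.add_sub_cancel, if_pos h]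
  push_cast
  ring

theorem kap_adv_self {n : ℕ} {f : ℕ → ℤ} {i : ℕ} (hi : 1 ≤ i) (hi' : i ≤ n)
    (h : 2 ≤ i → f (i - 1) = f i + 1) : kap n (adv f [i]) i = f i + i := by
  unfold kap
  split_ifs with h1 h2 h3
  · rw [h1, adv_singleton_self]; rfl
  · omega
  · rw [adv_singleton_of_ne _ (by omega), h (by omega)]
    ring
  · rw [adv_singleton_self, adv_singleton_of_ne _ (by omega), h (by omega)] at h3
    exact absurd rfl h3

theorem kap_adv_succ {n : ℕ} {f : ℕ → ℤ} {i : ℕ} (hi : 1 ≤ i) (hi' : i < n)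
    (h : f (i + 1) = f i) : kap n (adv f [i]) (i + 1) = f i := by
  unfold kap
  rw [if_neg (by omega), if_neg (by omega), Nat.add_sub_cancel, adv_singleton_self,
    adv_singleton_of_ne _ (by omega), if_neg (by omega), h]

theorem kap_adv_of_ne {n : ℕ} {f : ℕ → ℤ} {i j : ℕ} (hj : 1 ≤ j) (hj' : j ≤ n) (h : j ≠ i)
    (h' : j ≠ i + 1) : kap n (adv f [i]) j = kap n f j := by
  unfold kap
  by_cases h1 : j = 1
  · subst h1
    rw [if_pos rfl, if_pos rfl, adv_singleton_of_ne _ h]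
  · have h2 : ¬ j = n + 1 := by omega
    rw [if_neg h1, if_neg h1, if_neg h2, if_neg h2, adv_singleton_of_ne _ h,
      adv_singleton_of_ne _ (by omega)]

/-- The values of the transformation attached to a legal word on the basis vectors. -/
def MovesBasis (n : ℕ) (x : ℕ → ℤ) (σ δ : ℤˣ) (f : ℕ → ℤ) (δ' : ℤˣ) (A : Lat n → Lat n) : Prop :=
  (∀ j, 1 ≤ j → j ≤ n → A (eps n j) = cyc n x σ δ (kap n f j)) ∧
    A (eps n (n + 1)) = δ' • cyc n x σ δ (f n + n)

theorem units_mul_self (s : ℤˣ) : s * s = 1 := by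
  rcases Int.units_eq_one_or s with rfl | rfl <;> rfl

theorem neg_eq_units_smul {n : ℕ} (v : Lat n) : -v = (-1 : ℤˣ) • v := by
  simp [Units.smul_def]

/-- In a row i < n the reflection swaps ε_i and ε_{i+1}, as the move swaps two points. In row n the
point f n leaves the chain and returns as f n + n + 1, one period later, whence the factor σ. The
sign δ' of ε_{n+1} selects the letter: s_n swaps ε_n and ε_{n+1}, and s_{n+1} swaps them with a
change of sign, so either way ε_n receives the point f n + n with coefficient 1. -/
theorem MovesBasis.step {n : ℕ} {x : ℕ → ℤ} {σ δ δ' : ℤˣ} {f : ℕ → ℤ} {u : List ℕ} {a : ℕ}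
    (h : MovesBasis n x σ δ f δ' (act n u)) (h1 : 1 ≤ orb n a) (h2 : orb n a ≤ n)
    (h3 : 2 ≤ orb n a → f (orb n a - 1) = f (orb n a) + 1)
    (h4 : orb n a < n → f (orb n a + 1) = f (orb n a))
    (h5 : orb n a = n → a = if δ' = 1 then n else n + 1) :
    MovesBasis n x σ δ (adv f [orb n a]) (if orb n a = n then δ' * σ else δ')
      (act n (u ++ [a])) := by
  obtain ⟨hA, hB⟩ := h
  have hact : ∀ v, act n (u ++ [a]) v = act n u (refl n a v) := fun v => act_append n u [a] v
  rcases Nat.lt_trichotomy a n with ha | rfl | ha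
  · have ho : orb n a = a := by unfold orb; split_ifs <;> omega
    simp only [ho] at h1 h2 h3 h4 h5 ⊢
    refine ⟨fun j hj hj' => ?_, ?_⟩
    · rw [hact]
      rcases eq_or_ne j a with rfl | hja
      · rw [refl_eps_self hj hj', hA _ (by omega) (by omega), kap_succ hj ha (h4 ha),
          kap_adv_self hj hj' h3]
      · rcases eq_or_ne j (a + 1) with rfl | hja'
        · rw [refl_eps_succ ha.le, hA _ (by omega) (by omega), kap_self h1 ha.le h3,
            kap_adv_succ h1 ha (h4 ha)]
        · rw [refl_eps_of_ne hj (by omega) ha.le hja hja', hA _ hj hj', kap_adv_of_ne hj hj' hja hja']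
    · rw [hact, refl_eps_of_ne (by omega) le_rfl ha.le (by omega) (by omega), hB,
        if_neg (by omega), adv_singleton_of_ne _ (by omega)]
  · have ho : orb a a = a := by unfold orb; split_ifs <;> omega
    simp only [ho] at h1 h2 h3 h4 h5 ⊢
    have hδ : δ' = 1 := by
      by_contra hne
      have := h5 trivial
      rw [if_neg hne] at this
      omega
    subst hδ
    refine ⟨fun j hj hj' => ?_, ?_⟩
    · rw [hact]
      rcases eq_or_ne j a with rfl | hja
      · rw [refl_eps_self hj hj', hB, one_smul, kap_adv_self hj hj' h3]
      · rw [refl_eps_of_ne hj (by omega) le_rfl hja (by omega), hA _ hj hj',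
          kap_adv_of_ne hj hj' hja (by omega)]
    · rw [hact, refl_eps_succ le_rfl, if_pos trivial, adv_singleton_self, hA _ h1 le_rfl,
        kap_self h1 le_rfl h3, add_right_comm, add_assoc (f a), cyc_add_period, one_mul, smul_smul,
        units_mul_self, one_smul]
  · obtain rfl : a = n + 1 := by
      unfold orb at h2; split_ifs at h2 <;> omega
    have ho : orb n (n + 1) = n := by simp [orb]
    simp only [ho] at h1 h2 h3 h4 h5 ⊢
    have hδ : δ' = -1 := by
      rcases Int.units_eq_one_or δ' with rfl | h
      · have := h5 trivial
        simp at this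
      · exact h
    subst hδ
    refine ⟨fun j hj hj' => ?_, ?_⟩
    · rw [hact]
      rcases eq_or_ne j n with rfl | hja
      · rw [refl_last_eps_n hj, act_neg, hB, neg_eq_units_smul, smul_smul, units_mul_self,
          one_smul, kap_adv_self hj hj' h3]
      · rw [refl_last_eps_of_lt hj (by omega), hA _ hj hj', kap_adv_of_ne hj hj' hja (by omega)]
    · rw [hact, refl_last_eps_last, if_pos trivial, adv_singleton_self, act_neg, hA _ h1 le_rfl,
        kap_self h1 le_rfl h3, add_right_comm, add_assoc (f n), cyc_add_period, smul_smul,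
        mul_assoc, units_mul_self, mul_one, neg_eq_units_smul]

/-- In row n the selected letter satisfies α_a = ε_n - δ' ε_{n+1}. The two factors δ' cancel, and
the formula is the same as in the other rows. -/
theorem MovesBasis.simpleRoot {n : ℕ} {x : ℕ → ℤ} {σ δ δ' : ℤˣ} {f : ℕ → ℤ} {u : List ℕ} {a : ℕ}
    (h : MovesBasis n x σ δ f δ' (act n u)) (h1 : 1 ≤ orb n a) (h2 : orb n a ≤ n)
    (h3 : 2 ≤ orb n a → f (orb n a - 1) = f (orb n a) + 1)
    (h4 : orb n a < n → f (orb n a + 1) = f (orb n a))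
    (h5 : orb n a = n → a = if δ' = 1 then n else n + 1) :
    act n u (simpleRoot n a) =
      cyc n x σ δ (f (orb n a)) - cyc n x σ δ (f (orb n a) + orb n a) := by
  obtain ⟨hA, hB⟩ := h
  rcases Nat.lt_trichotomy a n with ha | rfl | ha
  · have ho : orb n a = a := by unfold orb; split_ifs <;> omega
    simp only [ho] at h1 h2 h3 h4 h5 ⊢
    rw [simpleRoot_of_le ha.le, act_sub, hA _ h1 h2, hA _ (by omega) ha, kap_self h1 h2 h3,
      kap_succ h1 ha (h4 ha)]
  · have ho : orb a a = a := by unfold orb; split_ifs <;> omega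
    simp only [ho] at h1 h2 h3 h4 h5 ⊢
    have hδ : δ' = 1 := by
      by_contra hne
      have := h5 trivial
      rw [if_neg hne] at this
      omega
    subst hδ
    rw [simpleRoot_of_le le_rfl, act_sub, hA _ h1 h2, hB, kap_self h1 h2 h3, one_smul]
  · obtain rfl : a = n + 1 := by
      unfold orb at h2; split_ifs at h2 <;> omega
    have ho : orb n (n + 1) = n := by simp [orb]
    simp only [ho] at h1 h2 h3 h4 h5 ⊢
    have hδ : δ' = -1 := by
      rcases Int.units_eq_one_or δ' with rfl | h
      · have := h5 trivial
        simp at this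
      · exact h
    subst hδ
    rw [simpleRoot_last, act_add, hA _ h1 h2, hB, kap_self h1 h2 h3, ← neg_eq_units_smul,
      sub_eq_add_neg]

section
variable {n : ℕ} {x : ℕ → ℤ} {σ δ : ℤˣ} {w : List ℕ}

/-- The invariant that drives all label computations, in type A (σ = δ = 1) and in type D (σ = -1).
For the empty prefix it says that point number j of the profile has level j. -/
theorem movesBasis_prefix (hx : IsProfile n x) (hn : 1 ≤ n) (hr : RowLegal n x (w.map (orb n)))
    (hl : LetterLegal n σ δ w) (u v : List ℕ) (h : w = u ++ v) :
    MovesBasis n x σ δ (adv x (u.map (orb n))) (δ * σ ^ (u.map (orb n)).count n) (act n u) := by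
  induction u using List.reverseRecOn generalizing v with
  | nil =>
    simp only [List.map_nil, adv_nil, List.count_nil, pow_zero, mul_one]
    refine ⟨fun j hj hj' => (hx.cyc_kap hn σ δ hj hj').symm, ?_⟩
    rw [hx.cyc_last hn, smul_smul, units_mul_self, one_smul]
    rfl
  | append_singleton u a ih =>
    have h' : w = u ++ a :: v := by simpa using h
    have h0 := hr (u.map (orb n)) (orb n a) (v.map (orb n)) (by simp [h'])
    have h1 := (ih _ h').step h0.1 h0.2.1 h0.2.2.1 h0.2.2.2 (hl u a v h')
    simp only [List.map_append, List.map_cons, List.map_nil, adv_append]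
    convert h1 using 1
    split_ifs with h2
    · rw [h2, List.count_append, List.count_singleton_self, pow_add, pow_one, mul_assoc]
    · rw [List.count_append, List.count_singleton, if_neg (by simpa using h2), add_zero]

theorem act_simpleRoot_of_legal (hx : IsProfile n x) (hn : 1 ≤ n)
    (hr : RowLegal n x (w.map (orb n))) (hl : LetterLegal n σ δ w) {u v : List ℕ} {a : ℕ}
    (h : w = u ++ a :: v) :
    act n u (simpleRoot n a) =
      cyc n x σ δ (adv x (u.map (orb n)) (orb n a)) -
        cyc n x σ δ (adv x (u.map (orb n)) (orb n a) + orb n a) := by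
  have h0 := hr (u.map (orb n)) (orb n a) (v.map (orb n)) (by simp [h])
  exact (movesBasis_prefix hx hn hr hl u _ h).simpleRoot h0.1 h0.2.1 h0.2.2.1 h0.2.2.2 (hl u a v h)

theorem kap_add (n : ℕ) (f g : ℕ → ℤ) (s : ℤ) (hf : ∀ i, 1 ≤ i → i ≤ n → g i = f i + s) {j : ℕ}
    (hj : 1 ≤ j) (hj' : j ≤ n) : kap n g j = kap n f j + s := by
  unfold kap
  by_cases h1 : j = 1
  · rw [if_pos h1, if_pos h1, hf _ le_rfl (by omega)]
  · have h2 : ¬ j = n + 1 := by omega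
    rw [if_neg h1, if_neg h1, if_neg h2, if_neg h2, hf j hj hj',
      hf (j - 1) (by omega) (by omega)]
    simp only [add_left_inj]
    split_ifs <;> ring

/-- A word that moves all rows by `s`, without a change of sign, shifts the cyclic sequence. -/
theorem MovesBasis.shift (hx : IsProfile n x) (hn : 1 ≤ n) {f : ℕ → ℤ} {s : ℤ}
    (hf : ∀ i, 1 ≤ i → i ≤ n → f i = x i + s) {u : List ℕ}
    (h : MovesBasis n x σ δ f δ (act n u)) (k : ℤ) :
    act n u (cyc n x σ δ k) = cyc n x σ δ (k + s) := by
  -- One period suffices, since both sides acquire the factor σ^m when k moves by m periods.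
  have key : ∀ k, x n ≤ k → k ≤ x n + n → act n u (cyc n x σ δ k) = cyc n x σ δ (k + s) := by
    intro k hk hk'
    rcases Int.lt_or_eq_of_le hk' with h1 | rfl
    · have h2 := hx.lvl_le_n hn hk h1
      have h3 := hx.kap_mem hn (hx.lvl_pos k) h2
      rw [hx.cyc_of_mem hn σ δ hk h1, h.1 _ (hx.lvl_pos k) h2, kap_add n x f s hf (hx.lvl_pos k) h2,
        hx.lvl_injective_of_mem h3.1 h3.2.1.le hk hk' h3.2.2]
    · rw [hx.cyc_last hn, act_units_smul, h.2, smul_smul, units_mul_self, one_smul, hf n hn le_rfl,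
        add_right_comm]
  have h1 := window_mem n x k
  rw [window_eq_add_mul n x k, cyc_add_mul, act_units_smul, key _ h1.1 h1.2, ← cyc_add_mul,
    add_right_comm]

end

/-! ### Height functions, adapted words and profiles -/

theorem IsHeightFunction.step {n : ℕ} {Q : ℕ → ℕ → Prop} {ξ : ℕ → ℤ} (hQ : IsDynkinQuiverA n Q)
    (hξ : IsHeightFunction Q ξ) {i : ℕ} (hi : 1 ≤ i) (hi' : i < n) :
    ξ (i + 1) = ξ i + 1 ∨ ξ i = ξ (i + 1) + 1 := by
  rcases hQ.2 i hi hi' with ⟨h, _⟩ | ⟨h, _⟩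
  · exact Or.inl (hξ _ _ h)
  · exact Or.inr (hξ _ _ h)

/-- The profile of a height function. -/
def prof (n : ℕ) (ξ : ℕ → ℤ) (i : ℕ) : ℤ := (ξ 1 + 1 - ξ (min i n) - (min i n : ℕ)) / 2

/-- The parity of ξ(i) + i does not depend on i, so the division in `prof` is exact. -/
theorem two_mul_prof {n : ℕ} {Q : ℕ → ℕ → Prop} {ξ : ℕ → ℤ} (hQ : IsDynkinQuiverA n Q)
    (hξ : IsHeightFunction Q ξ) {i : ℕ} (hi : 1 ≤ i) (hi' : i ≤ n) :
    2 * prof n ξ i = ξ 1 + 1 - ξ i - i := by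
  have key : (2 : ℤ) ∣ ξ 1 + 1 - ξ i - i := by
    induction i, hi using Nat.le_induction with
    | base => simp
    | succ i hi ih =>
      have h1 := ih (by omega)
      have h2 := hξ.step hQ hi hi'
      push_cast
      omega
  unfold prof
  rw [min_eq_left hi']
  omega

theorem isProfile_prof {n : ℕ} {Q : ℕ → ℕ → Prop} {ξ : ℕ → ℤ} (hQ : IsDynkinQuiverA n Q)
    (hξ : IsHeightFunction Q ξ) : IsProfile n (prof n ξ) := by
  constructor
  · intro i hi hi'
    have h1 := two_mul_prof hQ hξ hi hi'.le
    have h2 := two_mul_prof hQ hξ (i := i + 1) (by omega) hi'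
    have h3 := hξ.step hQ hi hi'
    push_cast at h2
    omega
  · unfold prof
    rw [min_eq_right (by omega), min_self]

theorem reflQuiver_of_isSink {Q : ℕ → ℕ → Prop} {i : ℕ} (hi : IsSink Q i) (a b : ℕ) :
    reflQuiver i Q a b ↔ if a = i ∨ b = i then Q b a else Q a b := by
  simp only [reflQuiver, hi, true_or, true_and]

theorem isDynkinQuiverA_reflQuiver {n : ℕ} {Q : ℕ → ℕ → Prop} (hQ : IsDynkinQuiverA n Q) {i : ℕ}
    (hi : IsSink Q i) : IsDynkinQuiverA n (reflQuiver i Q) := by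
  constructor
  · intro a b h
    rw [reflQuiver_of_isSink hi] at h
    split_ifs at h
    · have := hQ.1 b a h
      tauto
    · exact hQ.1 a b h
  · intro a ha ha'
    have := hQ.2 a ha ha'
    rw [reflQuiver_of_isSink hi, reflQuiver_of_isSink hi]
    by_cases h : a = i ∨ a + 1 = i
    · rw [if_pos h, if_pos h.symm]
      exact this.symm
    · rw [if_neg h, if_neg (fun h' => h h'.symm)]
      exact this

/-- Reflecting the quiver at a sink lowers its height by 2 and yields a height function of the new
quiver. Hence after the prefix u the heights are ξ(j) - 2 · (number of letters j in u), and the next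
letter, being a sink, lies one above its neighbours. -/
theorem local_max_of_isAdapted {n : ℕ} {Q : ℕ → ℕ → Prop} {ξ : ℕ → ℤ} {c : List ℕ}
    (hQ : IsDynkinQuiverA n Q) (hξ : IsHeightFunction Q ξ) (hc : ∀ i ∈ c, 1 ≤ i ∧ i ≤ n)
    (h : IsAdapted Q c) (u : List ℕ) (i : ℕ) (v : List ℕ) (hu : c = u ++ i :: v) (j : ℕ)
    (hj : 1 ≤ j) (hj' : j ≤ n) (hij : i + 1 = j ∨ j + 1 = i) :
    ξ j - 2 * u.count j + 1 = ξ i - 2 * u.count i := by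
  induction c generalizing Q ξ u with
  | nil => simp at hu
  | cons a c ih =>
    obtain ⟨ha, hc'⟩ := h
    cases u with
    | nil =>
      obtain ⟨rfl, rfl⟩ : a = i ∧ c = v := by simpa using hu
      have h1 := hc a (by simp)
      have h2 : Q j a := by
        rcases hij with rfl | rfl
        · rcases hQ.2 a h1.1 hj' with ⟨h, _⟩ | ⟨h, _⟩
          · exact absurd h (ha _)
          · exact h
        · rcases hQ.2 j hj h1.2 with ⟨h, _⟩ | ⟨h, _⟩
          · exact h
          · exact absurd h (ha _)
      simp [hξ _ _ h2]
    | cons b u =>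
      obtain ⟨rfl, rfl⟩ : a = b ∧ c = u ++ i :: v := by simpa using hu
      have h1 : IsHeightFunction (reflQuiver a Q) (fun k => ξ k - 2 * if a = k then 1 else 0) := by
        intro p q hqp
        rw [reflQuiver_of_isSink ha] at hqp
        split_ifs at hqp with h2
        · have h3 : p ≠ a := by
            rintro rfl
            exact ha _ hqp
          obtain rfl : q = a := by tauto
          have := hξ _ _ hqp
          simp [Ne.symm h3]
          omega
        · have := hξ _ _ hqp
          push Not at h2
          simp [Ne.symm h2.1, Ne.symm h2.2, this]
      have := ih (isDynkinQuiverA_reflQuiver hQ ha) h1 (fun k hk => hc k (by simp [hk])) hc' u rfl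
      simp only [List.count_cons, beq_iff_eq] at this ⊢
      split_ifs at this ⊢ <;> push_cast <;> omega

theorem mem_of_perm_range {n : ℕ} {c : List ℕ} (hc : c.Perm (List.range' 1 n)) (i : ℕ) :
    i ∈ c ↔ 1 ≤ i ∧ i ≤ n := by
  rw [hc.mem_iff, List.mem_range'_1]
  omega

theorem count_of_perm_range {n : ℕ} {c : List ℕ} (hc : c.Perm (List.range' 1 n)) {i : ℕ}
    (hi : 1 ≤ i) (hi' : i ≤ n) : c.count i = 1 :=
  List.count_eq_one_of_mem (hc.nodup_iff.2 List.nodup_range') ((mem_of_perm_range hc i).2 ⟨hi, hi'⟩)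

theorem count_prefix_eq_zero {n : ℕ} {c : List ℕ} (hc : c.Perm (List.range' 1 n)) {u v : List ℕ}
    {i : ℕ} (h : c = u ++ i :: v) : u.count i = 0 := by
  have h1 := (mem_of_perm_range hc i).1 (by simp [h])
  have h2 := count_of_perm_range hc h1.1 h1.2
  rw [h, List.count_append, List.count_cons_self] at h2
  omega

/-- Translated by `two_mul_prof`, a neighbour that is one lower gives x(i-1) = x(i) + 1 above and
x(i+1) = x(i) below. These are the two conditions of `RowLegal`. -/
theorem rowLegal_of_isCoxeterWordOf {n : ℕ} {Q : ℕ → ℕ → Prop} {ξ : ℕ → ℤ} {c : List ℕ}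
    (hQ : IsDynkinQuiverA n Q) (hξ : IsHeightFunction Q ξ) (hc : IsCoxeterWordOf n Q c) :
    RowLegal n (prof n ξ) c := by
  intro u i v h
  have h1 := (mem_of_perm_range hc.1 i).1 (by simp [h])
  have h2 := local_max_of_isAdapted hQ hξ (fun j => (mem_of_perm_range hc.1 j).1) hc.2 u i v h
  have h3 := two_mul_prof hQ hξ h1.1 h1.2
  refine ⟨h1.1, h1.2, fun hi => ?_, fun hi => ?_⟩
  · have h4 := h2 (i - 1) (by omega) (by omega) (by omega)
    have h5 := two_mul_prof hQ hξ (i := i - 1) (by omega) (by omega)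
    unfold adv
    omega
  · have h4 := h2 (i + 1) (by omega) (by omega) (by omega)
    have h5 := two_mul_prof hQ hξ (i := i + 1) (by omega) (by omega)
    unfold adv
    push_cast at h5
    omega

theorem map_orb_of_le {n : ℕ} {c : List ℕ} (hc : ∀ i ∈ c, i ≤ n) : c.map (orb n) = c := by
  conv_rhs => rw [← List.map_id c]
  apply List.map_congr_left
  intro i hi
  have := hc i hi
  simp [orb]
  omega

/-! ### Labels of type `A` -/

/-- The word c gives the labels with t = 0, and φ_Q is the shift by one. The recursion stops at the
first nonpositive root; nothing is lost, because by `lvl_lt_succ` the positive roots form an initial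
segment of the row. -/
theorem ARLabel_iff {n : ℕ} {Q : ℕ → ℕ → Prop} {ξ : ℕ → ℤ} {c : List ℕ} (hn : 1 ≤ n)
    (hQ : IsDynkinQuiverA n Q) (hξ : IsHeightFunction Q ξ) (hc : IsCoxeterWordOf n Q c)
    (i : ℕ) (p : ℤ) (β : Lat n) :
    ARLabel n c ξ (i, p) β ↔ 1 ≤ i ∧ i ≤ n ∧ ∃ t : ℕ, t ≤ n ∧ p = ξ i - 2 * t ∧
      lvl n (prof n ξ) (prof n ξ i + t) < lvl n (prof n ξ) (prof n ξ i + t + i) ∧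
      β = eps n (lvl n (prof n ξ) (prof n ξ i + t)) -
        eps n (lvl n (prof n ξ) (prof n ξ i + t + i)) := by
  have hx := isProfile_prof hQ hξ
  have hr := rowLegal_of_isCoxeterWordOf hQ hξ hc
  generalize hxx : prof n ξ = x at *
  have hmem := mem_of_perm_range hc.1
  have hmap : c.map (orb n) = c := map_orb_of_le fun i hi => ((hmem i).1 hi).2
  have hr' : RowLegal n x (c.map (orb n)) := by rwa [hmap]
  have hl : LetterLegal n 1 1 c := by
    intro u a v h ha
    have := (hmem a).1 (by simp [h])
    simp [orb] at ha ⊢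
    omega
  have hinit : ∀ u i v, c = u ++ i :: v →
      act n u (simpleRoot n i) = eps n (lvl n x (x i)) - eps n (lvl n x (x i + i)) := by
    intro u i v h
    have h1 := act_simpleRoot_of_legal hx hn hr' hl h
    have h2 : u.map (orb n) = u :=
      map_orb_of_le fun j hj => ((hmem j).1 (by simp [h, hj])).2
    have h3 : orb n i = i := by
      have := (hmem i).1 (by simp [h])
      simp [orb]; omega
    rw [h2, h3, cyc_one_one, cyc_one_one, adv, count_prefix_eq_zero hc.1 h] at h1
    simpa using h1
  have hshift : ∀ k, act n c (eps n (lvl n x k)) = eps n (lvl n x (k + 1)) := by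
    intro k
    have h1 := movesBasis_prefix hx hn hr' hl c [] (by simp)
    rw [hmap, one_pow, mul_one] at h1
    have h2 := h1.shift hx hn (s := 1) (fun i hi hi' => by
      rw [adv, count_of_perm_range hc.1 hi hi']; rfl) k
    rwa [cyc_one_one, cyc_one_one] at h2
  have hpos : ∀ i k, 1 ≤ i → i ≤ n → (IsPosRootA n (eps n (lvl n x k) - eps n (lvl n x (k + i))) ↔
      lvl n x k < lvl n x (k + i)) := fun i k hi hi' =>
    isPosRootA_eps_sub_iff (hx.lvl_pos _) (hx.lvl_le _) (hx.lvl_pos _) (hx.lvl_le _)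
      (hx.lvl_ne (by omega) (by omega))
  constructor
  · intro h
    generalize hz : (i, p) = z at h
    induction h generalizing i p with
    | init u v j h =>
      obtain ⟨rfl, rfl⟩ : i = j ∧ p = ξ j := by simpa using hz
      have h1 := (hmem i).1 (by simp [h])
      refine ⟨h1.1, h1.2, 0, by omega, by simp, ?_, ?_⟩
      · have := hx.mono h1.1 h1.2 (by omega)
        exact hx.lvl_lt_of_low hn h1.1 h1.2 (by simp) (by push_cast; omega)
      · rw [hinit u i v h]
        simp
    | next j q β h hβ hφ ih =>
      obtain ⟨rfl, rfl⟩ : i = j ∧ p = q - 2 := by simpa using hz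
      obtain ⟨h1, h2, t, ht, rfl, h3, rfl⟩ := ih i q rfl
      rw [act_sub, hshift, hshift, add_right_comm _ (i : ℤ)] at hφ
      have h4 := (hpos _ _ h1 h2).1 hφ
      -- This keeps t + 1 ≤ n: the interval with t = n is already negative.
      have h5 : t ≠ n := by
        rintro rfl
        have := hx.lvl_lt_end hn h1 h2
        omega
      refine ⟨h1, h2, t + 1, by omega, by push_cast; ring, ?_, ?_⟩
      · push_cast
        rwa [← add_assoc]
      · rw [act_sub, hshift, hshift]
        push_cast
        rw [add_right_comm _ (i : ℤ), add_assoc _ (t : ℤ)]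
  · rintro ⟨h1, h2, t, ht, rfl, h3, rfl⟩
    induction t with
    | zero =>
      obtain ⟨u, v, h⟩ := List.append_of_mem ((hmem i).2 ⟨h1, h2⟩)
      have := ARLabel.init (n := n) (ξ := ξ) u v i h
      rw [hinit u i v h] at this
      simpa using this
    | succ t ih =>
      -- If the previous interval had decreasing levels, so would the current one.
      have h4 : lvl n x (x i + t) < lvl n x (x i + t + i) := by
        by_contra h4
        have h5 := hx.lvl_ne (k := x i + t) (l := x i + t + i) (by omega) (by omega)
        have h6 := hx.lvl_lt_succ hn h1 h2 (k := x i + t) (by omega) (by omega) (by omega)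
        push_cast at h3
        rw [← add_assoc] at h3
        omega
      have h5 := ih (by omega) h4
      have h6 : act n c (eps n (lvl n x (x i + t)) - eps n (lvl n x (x i + t + i))) =
          eps n (lvl n x (x i + (t + 1 : ℕ))) - eps n (lvl n x (x i + (t + 1 : ℕ) + i)) := by
        rw [act_sub, hshift, hshift]
        push_cast
        rw [add_right_comm _ (i : ℤ), add_assoc _ (t : ℤ)]
      have h7 := ARLabel.next i _ _ h5 ((hpos _ _ h1 h2).2 h4) (by
        rw [h6]; exact (hpos _ _ h1 h2).2 h3)
      rw [h6] at h7
      convert h7 using 2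
      push_cast
      ring

/-! ### The words `∏ c^{k∨}` -/

/-- The word `∏_{k=0}^{m-1} c^{k∨}`. -/
def blocks (n : ℕ) (c : List ℕ) (m : ℕ) : List ℕ :=
  (List.range m).flatMap fun k => c.map (vee n)^[k]

theorem twistedWord_eq_blocks (n : ℕ) (c : List ℕ) : twistedWord n c = blocks n c (n + 1) := rfl

theorem blocks_succ (n : ℕ) (c : List ℕ) (m : ℕ) :
    blocks n c (m + 1) = blocks n c m ++ c.map (vee n)^[m] := by
  simp [blocks, List.range_succ, List.flatMap_append]

theorem map_orb_map_vee (n : ℕ) (c : List ℕ) (m : ℕ) :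
    (c.map (vee n)^[m]).map (orb n) = c.map (orb n) := by
  rw [List.map_map]
  exact List.map_congr_left fun i _ => orb_vee_iterate n m i

theorem append_cons_of_append {α : Type*} {r s u v : List α} {a : α} (h : r ++ s = u ++ a :: v) :
    (∃ v', r = u ++ a :: v') ∨ ∃ u', u = r ++ u' ∧ s = u' ++ a :: v := by
  rcases List.append_eq_append_iff.1 h with ⟨as, h1, h2⟩ | ⟨cs, h1, h2⟩
  · exact Or.inr ⟨as, h1, h2⟩
  · cases cs with
    | nil => exact Or.inr ⟨[], by simpa using h1.symm, by simpa using h2.symm⟩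
    | cons b cs =>
      obtain ⟨rfl, rfl⟩ : a = b ∧ v = cs ++ s := by simpa using h2
      exact Or.inl ⟨cs, h1⟩

theorem RowLegal.append {n : ℕ} {f : ℕ → ℤ} {r s : List ℕ} (hr : RowLegal n f r)
    (hs : RowLegal n (adv f r) s) : RowLegal n f (r ++ s) := by
  intro u i v h
  rcases append_cons_of_append h with ⟨v', h'⟩ | ⟨u', rfl, h'⟩
  · exact hr u i v' h'
  · have := hs u' i v h'
    rwa [← adv_append] at this

theorem RowLegal.congr {n : ℕ} {f g : ℕ → ℤ} {r : List ℕ} (hr : RowLegal n f r) (s : ℤ)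
    (h : ∀ i, 1 ≤ i → i ≤ n → g i = f i + s) : RowLegal n g r := by
  intro u i v hu
  obtain ⟨h1, h2, h3, h4⟩ := hr u i v hu
  refine ⟨h1, h2, fun h5 => ?_, fun h5 => ?_⟩
  · have := h3 h5
    unfold adv at *
    rw [h i h1 h2, h (i - 1) (by omega) (by omega)]
    omega
  · have := h4 h5
    unfold adv at *
    rw [h i h1 h2, h (i + 1) (by omega) (by omega)]
    omega

theorem LetterLegal.append {n : ℕ} {σ δ : ℤˣ} {r s : List ℕ} (hr : LetterLegal n σ δ r)
    (hs : LetterLegal n σ (δ * σ ^ (r.map (orb n)).count n) s) : LetterLegal n σ δ (r ++ s) := by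
  intro u a v h
  rcases append_cons_of_append h with ⟨v', h'⟩ | ⟨u', rfl, h'⟩
  · exact hr u a v' h'
  · have := hs u' a v h'
    rwa [mul_assoc, ← pow_add, ← List.count_append, ← List.map_append] at this

section
variable {n : ℕ} {c : List ℕ}

theorem count_blocks (hc : IsTwistedCoxeterWord n c) {i : ℕ} (hi : 1 ≤ i) (hi' : i ≤ n) (m : ℕ) :
    ((blocks n c m).map (orb n)).count i = m := by
  induction m with
  | zero => rfl
  | succ m ih =>
    rw [blocks_succ, List.map_append, List.count_append, ih, map_orb_map_vee,
      count_of_perm_range hc hi hi']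

theorem rowLegal_blocks {x : ℕ → ℤ} (hc : IsTwistedCoxeterWord n c)
    (hr : RowLegal n x (c.map (orb n))) (m : ℕ) : RowLegal n x ((blocks n c m).map (orb n)) := by
  induction m with
  | zero => intro u i v h; simp [blocks] at h
  | succ m ih =>
    rw [blocks_succ, List.map_append, map_orb_map_vee]
    refine ih.append (hr.congr m fun i hi hi' => ?_)
    rw [adv, count_blocks hc hi hi']

theorem letter_le (hc : IsTwistedCoxeterWord n c) {a : ℕ} (ha : a ∈ c) : 1 ≤ a ∧ a ≤ n + 1 := by
  have := (mem_of_perm_range hc (orb n a)).1 (List.mem_map_of_mem ha)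
  unfold orb at this
  split_ifs at this <;> omega

theorem not_mem_both (hn : 1 ≤ n) (hc : IsTwistedCoxeterWord n c) (h : n ∈ c) : n + 1 ∉ c := by
  intro h'
  have h0 := count_of_perm_range hc hn le_rfl
  obtain ⟨u, v, rfl⟩ := List.append_of_mem h
  have h1 : n + 1 ∈ u ++ v := by simpa using h'
  have h2 : n ∈ (u ++ v).map (orb n) := List.mem_map.2 ⟨n + 1, h1, by simp [orb]⟩
  have h3 := List.count_pos_iff.2 h2
  have h4 : orb n n = n := by simp [orb]
  simp only [List.map_append, List.map_cons, List.count_append, h4, List.count_cons_self] at h0 h3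
  omega

theorem mem_or_mem (hn : 1 ≤ n) (hc : IsTwistedCoxeterWord n c) : n ∈ c ∨ n + 1 ∈ c := by
  obtain ⟨a, ha, h⟩ := List.mem_map.1 ((mem_of_perm_range hc n).2 ⟨hn, le_rfl⟩)
  unfold orb at h
  split_ifs at h with h1
  · exact Or.inr (h1 ▸ ha)
  · exact Or.inl (h ▸ ha)

/-- The sign which tells whether `n` or `n + 1` occurs in the word. -/
def wordSign (n : ℕ) (c : List ℕ) : ℤˣ := if n ∈ c then 1 else -1

/-- A block contains one letter of row n, and each application of ∨ exchanges n and n + 1. So the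
letter in block m follows the sign (-1)^m. -/
theorem letterLegal_block (hn : 1 ≤ n) (hc : IsTwistedCoxeterWord n c) (m : ℕ) :
    LetterLegal n (-1) (wordSign n c * (-1) ^ m) (c.map (vee n)^[m]) := by
  have h0 : ∀ a ∈ c, orb n a = n → ∀ m : ℕ, (vee n)^[m] a =
      if wordSign n c * (-1) ^ m = 1 then n else n + 1 := by
    intro a ha ho m
    induction m with
    | zero =>
      unfold wordSign
      split_ifs with h1 h2 h2
      · have := not_mem_both hn hc h1
        unfold orb at ho
        split_ifs at ho with h3
        · exact absurd (h3 ▸ ha) this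
        · exact ho
      · simp at h2
      · simp at h2
      · unfold orb at ho
        split_ifs at ho with h3
        · exact h3
        · exact absurd (ho ▸ ha) h1
    | succ m ih =>
      rw [Function.iterate_succ_apply', ih, pow_succ, ← mul_assoc]
      rcases Int.units_eq_one_or (wordSign n c * (-1) ^ m) with h | h <;> rw [h] <;> simp [vee]
  intro u a v h ha
  have h1 : c.map (orb n) = u.map (orb n) ++ n :: v.map (orb n) := by
    rw [← map_orb_map_vee n c m, h]
    simp [ha]
  rw [count_prefix_eq_zero hc h1, pow_zero, mul_one]
  obtain ⟨a', ha', rfl⟩ := List.mem_map.1 (show a ∈ c.map (vee n)^[m] by simp [h])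
  rw [orb_vee_iterate] at ha
  exact h0 a' ha' ha m

theorem letterLegal_blocks (hn : 1 ≤ n) (hc : IsTwistedCoxeterWord n c) (m : ℕ) :
    LetterLegal n (-1) (wordSign n c) (blocks n c m) := by
  induction m with
  | zero => intro u i v h; simp [blocks] at h
  | succ m ih =>
    rw [blocks_succ]
    apply ih.append
    rw [count_blocks hc hn le_rfl]
    exact letterLegal_block hn hc m

theorem projWord_eq (hn : 1 ≤ n) (hc : IsTwistedCoxeterWord n c) :
    projWord n c = c.map (orb n) := by
  unfold projWord
  split_ifs with h
  · apply List.map_congr_left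
    intro a ha
    have := letter_le hc ha
    have h1 : a ≠ n := by
      rintro rfl
      exact not_mem_both hn hc ha h
    unfold vee orb
    rw [if_neg h1]
  · rw [map_orb_of_le]
    intro a ha
    have := letter_le hc ha
    have h1 : a ≠ n + 1 := by
      rintro rfl
      exact h ha
    omega

end

/-! ### Labels of type `D` -/

section
variable {n : ℕ} {x : ℕ → ℤ}

/-- The label of the interval `[k, k + i]` in type `D`. -/
noncomputable def labelD (n : ℕ) (x : ℕ → ℤ) (δ : ℤˣ) (i : ℕ) (k : ℤ) : Lat n :=
  cyc n x (-1) δ k - cyc n x (-1) δ (k + i)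

theorem IsProfile.cyc_of_mem_next (hx : IsProfile n x) (hn : 1 ≤ n) (δ : ℤˣ)
    {k : ℤ} (hk : x n + n < k) (hk' : k ≤ x n + n + n) :
    cyc n x (-1) δ k = -eps n (lvl n x k) := by
  have := hx.cyc_of_mem hn (-1) δ (k := k - (n + 1)) (by omega) (by omega)
  rw [← sub_add_cancel k ((n : ℤ) + 1), cyc_add_period, this, sub_add_cancel, lvl_sub_period,
    neg_eq_units_smul]

theorem IsProfile.lvl_le_n_next (hx : IsProfile n x) (hn : 1 ≤ n)
    {k : ℤ} (hk : x n + n < k) (hk' : k ≤ x n + n + n) : lvl n x k ≤ n := by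
  rw [← lvl_sub_period]
  exact hx.lvl_le_n hn (by omega) (by omega)

variable {i : ℕ} {k : ℤ} (hx : IsProfile n x) (hn : 1 ≤ n) (δ : ℤˣ) (hi : 1 ≤ i) (hi' : i ≤ n)
include hx hn hi hi'

/-- This lemma and the next four treat an interval by the place of its ends relative to x n + n,
where ε_{n+1} sits and after which `cyc` becomes negative. In order: right of ρ, on ρ, strictly
between, on ρ', left of ρ'. -/
theorem labelD_right (hk : x i ≤ k) (h : k + i < x n + n) :
    labelD n x δ i k = rootDneg n (lvl n x k) (lvl n x (k + i)) ∧
      lvl n x k < lvl n x (k + i) ∧ lvl n x (k + i) ≤ n := by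
  have h1 := hx.mono hi hi' (by omega)
  refine ⟨?_, hx.lvl_lt_of_low hn hi hi' hk h.le, hx.lvl_le_n hn (by omega) (by omega)⟩
  rw [labelD, hx.cyc_of_mem hn _ _ (by omega) (by omega), hx.cyc_of_mem hn _ _ (by omega) h]
  rfl

theorem labelD_rho (h : k + i = x n + n) :
    labelD n x δ i k = eps n (lvl n x k) - δ • eps n (n + 1) ∧
      lvl n x (k + i) = n + 1 ∧ lvl n x k ≤ n := by
  have h1 := hx.mono hi hi' (by omega)
  refine ⟨?_, by rw [h, hx.lvl_last hn], hx.lvl_le_n hn (by omega) (by omega)⟩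
  rw [labelD, hx.cyc_of_mem hn _ _ (by omega) (by omega), h, hx.cyc_last hn]

theorem labelD_between (hk' : k ≤ x i + n) (h : k < x n + n)
    (h' : x n + n < k + i) :
    labelD n x δ i k = rootDpos n (lvl n x k) (lvl n x (k + i)) ∧
      lvl n x k ≤ n ∧ lvl n x (k + i) ≤ n := by
  have h1 := hx.mono hi hi' (by omega)
  refine ⟨?_, hx.lvl_le_n hn (by omega) (by omega), hx.lvl_le_n_next hn (by omega) (by omega)⟩
  rw [labelD, hx.cyc_of_mem hn _ _ (by omega) (by omega), hx.cyc_of_mem_next hn _ (by omega)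
    (by omega), sub_neg_eq_add]
  rfl

theorem labelD_rho' (h : k = x n + n) :
    labelD n x δ i k = δ • eps n (n + 1) + eps n (lvl n x (k + i)) ∧
      lvl n x k = n + 1 ∧ lvl n x (k + i) ≤ n := by
  have h1 := hx.mono hi hi' (by omega)
  refine ⟨?_, by rw [h, hx.lvl_last hn], hx.lvl_le_n_next hn (by omega) (by omega)⟩
  rw [labelD, hx.cyc_of_mem_next hn _ (k := k + i) (by omega) (by omega), h, hx.cyc_last hn,
    sub_neg_eq_add]

theorem labelD_left (hk' : k ≤ x i + n) (h : x n + n < k) :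
    labelD n x δ i k = rootDneg n (lvl n x (k + i)) (lvl n x k) ∧
      lvl n x (k + i) < lvl n x k ∧ lvl n x k ≤ n := by
  have h1 := hx.mono hi hi' (by omega)
  have h2 := hx.lvl_le_n_next hn h (k := k) (by omega)
  refine ⟨?_, hx.lvl_lt_of_high hn hi hi' h hk', h2⟩
  rw [labelD, hx.cyc_of_mem_next hn _ h (by omega),
    hx.cyc_of_mem_next hn _ (by omega) (by omega)]
  unfold rootDneg
  abel

/-- In contrast to type A, no interval of the row is excluded. When both ends are on the same side
of x n + n, the order of the levels gives positivity, and when they are on different sides the label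
is a sum. If an end is x n + n itself, the other basis vector has the smaller index and coefficient
1. -/
theorem isPosRootD_labelD (hk : x i ≤ k) (hk' : k ≤ x i + n) : IsPosRootD n (labelD n x δ i k) := by
  have p1 := hx.lvl_pos k
  have p2 := hx.lvl_pos (k + i)
  have p3 := hx.lvl_ne (k := k) (l := k + i) (by omega) (by omega)
  rcases lt_trichotomy (x n + n) k with h | h | h
  · obtain ⟨h1, h2, h3⟩ := labelD_left hx hn δ hi hi' hk' h
    exact ⟨_, _, p2, h2, by omega, Or.inl h1⟩
  · obtain ⟨h1, h2, h3⟩ := labelD_rho' hx hn δ hi hi' h.symm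
    rw [h1, add_comm]
    rcases Int.units_eq_one_or δ with rfl | rfl
    · exact ⟨_, n + 1, p2, by omega, le_rfl, Or.inr (by simp [rootDpos])⟩
    · exact ⟨_, n + 1, p2, by omega, le_rfl, Or.inl (by
        rw [← neg_eq_units_smul, ← sub_eq_add_neg]; rfl)⟩
  · rcases lt_trichotomy (k + i) (x n + n) with h' | h' | h'
    · obtain ⟨h1, h2, h3⟩ := labelD_right hx hn δ hi hi' hk h'
      exact ⟨_, _, p1, h2, by omega, Or.inl h1⟩
    · obtain ⟨h1, h2, h3⟩ := labelD_rho hx hn δ hi hi' h'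
      rw [h1]
      rcases Int.units_eq_one_or δ with rfl | rfl
      · exact ⟨_, n + 1, p1, by omega, le_rfl, Or.inl (by simp [rootDneg])⟩
      · exact ⟨_, n + 1, p1, by omega, le_rfl, Or.inr (by
          rw [← neg_eq_units_smul, sub_neg_eq_add]; rfl)⟩
    · obtain ⟨h1, h2, h3⟩ := labelD_between hx hn δ hi hi' hk' h h'
      rcases Nat.lt_or_gt_of_ne p3 with h4 | h4
      · exact ⟨_, _, p1, h4, by omega, Or.inr h1⟩
      · exact ⟨_, _, p2, h4, by omega, Or.inr (by rw [h1, rootDpos, rootDpos, add_comm])⟩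

end

theorem not_isPosRootD_neg {n : ℕ} {β : Lat n} (h : IsPosRootD n β) : ¬ IsPosRootD n (-β) := by
  obtain ⟨a, b, ha, hab, hb, h⟩ := h
  have : ∃ t : ℤˣ, -β = ((-1 : ℤˣ) : ℤ) • eps n a + (t : ℤ) • eps n b := by
    rcases h with rfl | rfl
    · exact ⟨1, by simp [rootDneg, sub_eq_add_neg, add_comm]⟩
    · exact ⟨-1, by simp [rootDpos, add_comm]⟩
  obtain ⟨t, ht⟩ := this
  rw [ht, isPosRootD_signed_iff _ _ ha hab hb]
  decide

theorem labelD_add_period (n : ℕ) (x : ℕ → ℤ) (δ : ℤˣ) (i : ℕ) (k : ℤ) :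
    labelD n x δ i (k + (n + 1)) = -labelD n x δ i k := by
  unfold labelD
  rw [cyc_add_period, add_right_comm, cyc_add_period, ← neg_eq_units_smul, ← neg_eq_units_smul]
  abel

/-- The labels of the folded AR-quiver. -/
theorem FoldedLabel_iff {n : ℕ} {Q : ℕ → ℕ → Prop} {ξ : ℕ → ℤ} {c : List ℕ} (hn : 1 ≤ n)
    (hQ : IsDynkinQuiverA n Q) (hξ : IsHeightFunction Q ξ) (hc : IsTwistedCoxeterWord n c)
    (hcQ : IsCoxeterWordOf n Q (projWord n c)) (i : ℕ) (p : ℤ) (β : Lat n) :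
    FoldedLabel n c ξ (i, p) β ↔ 1 ≤ i ∧ i ≤ n ∧ ∃ t : ℕ, t ≤ n ∧ p = ξ i - 2 * t ∧
      β = labelD n (prof n ξ) (wordSign n c) i (prof n ξ i + t) := by
  have hx := isProfile_prof hQ hξ
  have hr := rowLegal_of_isCoxeterWordOf hQ hξ hcQ
  rw [projWord_eq hn hc] at hr
  generalize prof n ξ = x at *
  generalize hδ : wordSign n c = δ
  have hmem := mem_of_perm_range hc
  have hblk : blocks n c 2 = c ++ c.map (vee n) := by
    simp [blocks, List.range_succ]
  have hr2 := rowLegal_blocks hc hr 2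
  have hl2 := letterLegal_blocks hn hc 2
  rw [hblk, hδ] at hl2
  rw [hblk] at hr2
  have hinit : ∀ u j v, c = u ++ j :: v → 1 ≤ orb n j ∧ orb n j ≤ n ∧
      act n u (simpleRoot n j) = labelD n x δ (orb n j) (x (orb n j)) := by
    intro u j v h
    have h1 := act_simpleRoot_of_legal hx hn hr2 hl2 (u := u) (a := j) (v := v ++ c.map (vee n))
      (by simp [h])
    have h2 := (hmem (orb n j)).1 (List.mem_map_of_mem (by simp [h]))
    rw [adv, count_prefix_eq_zero hc (i := orb n j) (v := v.map (orb n)) (by simp [h])] at h1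
    exact ⟨h2.1, h2.2, by simpa [labelD] using h1⟩
  have hsecond : ∀ u j v, c.map (vee n) = u ++ j :: v → 1 ≤ orb n j ∧ orb n j ≤ n ∧
      act n (c ++ u) (simpleRoot n j) = labelD n x δ (orb n j) (x (orb n j) + 1) := by
    intro u j v h
    have h1 := act_simpleRoot_of_legal hx hn hr2 hl2 (u := c ++ u) (a := j) (v := v) (by simp [h])
    have h3 : c.map (orb n) = u.map (orb n) ++ orb n j :: v.map (orb n) := by
      rw [← map_orb_map_vee n c 1]
      simp [h]
    have h2 := (hmem (orb n j)).1 (by simp [h3])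
    rw [List.map_append, adv, List.count_append, count_of_perm_range hc h2.1 h2.2,
      count_prefix_eq_zero hc h3] at h1
    exact ⟨h2.1, h2.2, by simpa [labelD] using h1⟩
  -- Two blocks change the sign δ twice, so it returns to its initial value and `MovesBasis.shift`
  -- applies. A single block would need ∨ as well.
  have hshift : ∀ i k, act n (c ++ c.map (vee n)) (labelD n x δ i k) = labelD n x δ i (k + 2) := by
    intro i k
    have h1 := movesBasis_prefix hx hn hr2 hl2 (c ++ c.map (vee n)) [] (by simp)
    rw [← hblk, count_blocks hc hn le_rfl, neg_one_sq, mul_one] at h1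
    have h2 := h1.shift hx hn (s := 2) (fun i hi hi' => by
      rw [adv, count_blocks hc hi hi']; rfl)
    rw [labelD, act_sub, ← hblk, h2, h2, labelD, add_right_comm]
  have hpos : ∀ (i t : ℕ), 1 ≤ i → i ≤ n → t ≤ n → IsPosRootD n (labelD n x δ i (x i + t)) :=
    fun i t hi hi' ht => isPosRootD_labelD hx hn δ hi hi' (by omega) (by omega)
  constructor
  · rintro ⟨j, ho, h⟩
    simp only at ho h
    generalize hz : (j, p) = z at h
    induction h generalizing p with
    | init u v a h =>
      obtain ⟨rfl, rfl⟩ : j = a ∧ p = ξ (orb n a) := by simpa using hz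
      obtain ⟨h1, h2, h3⟩ := hinit u j v h
      subst ho
      exact ⟨h1, h2, 0, by omega, by simp, by simpa using h3⟩
    | second u v a h =>
      obtain ⟨rfl, rfl⟩ : j = a ∧ p = ξ (orb n a) - 2 := by simpa using hz
      obtain ⟨h1, h2, h3⟩ := hsecond u j v h
      subst ho
      exact ⟨h1, h2, 1, by omega, by simp, by simpa using h3⟩
    | next a q β h hβ hψ ih =>
      obtain ⟨rfl, rfl⟩ : j = a ∧ p = q - 4 := by simpa using hz
      obtain ⟨h1, h2, t, ht, rfl, rfl⟩ := ih q rfl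
      rw [hshift] at hψ
      -- Otherwise the new interval is a full period beyond the interval with parameter t + 1 - n,
      -- so its label is the negative of a positive root.
      have h5 : t + 2 ≤ n := by
        by_contra h5
        obtain ⟨s, rfl⟩ : ∃ s, t = s + n - 1 := ⟨t + 1 - n, by omega⟩
        have h6 : x i + ((s + n - 1 : ℕ) : ℤ) + 2 = x i + s + (n + 1) := by omega
        rw [h6, labelD_add_period] at hψ
        exact not_isPosRootD_neg (hpos i s h1 h2 (by omega)) hψ
      refine ⟨h1, h2, t + 2, h5, by push_cast; ring, ?_⟩
      rw [hshift]
      push_cast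
      rw [add_assoc]
  · rintro ⟨h1, h2, t, ht, rfl, rfl⟩
    induction t using Nat.strong_induction_on with
    | _ t ih =>
      -- Since ψ moves by two, the induction needs both t = 0 (letters of c) and t = 1 (letters of
      -- c^∨) as starting points.
      match t, ht with
      | 0, _ =>
        obtain ⟨j, hj, ho⟩ := List.mem_map.1 ((hmem i).2 ⟨h1, h2⟩)
        obtain ⟨u, v, h⟩ := List.append_of_mem hj
        have := TwistedLabel.init (n := n) (ξ := ξ) u v j h
        rw [(hinit u j v h).2.2, ho] at this
        exact ⟨j, ho, by simpa using this⟩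
      | 1, _ =>
        obtain ⟨j, hj, ho⟩ := List.mem_map.1 ((hmem i).2 ⟨h1, h2⟩)
        obtain ⟨u, v, h⟩ := List.append_of_mem (List.mem_map_of_mem (f := vee n) hj)
        have := TwistedLabel.second (n := n) (ξ := ξ) u v _ h
        rw [(hsecond u _ v h).2.2, orb_vee, ho] at this
        exact ⟨vee n j, by simpa [orb_vee] using ho, by simpa using this⟩
      | t + 2, ht =>
        obtain ⟨j, ho, h⟩ := ih t (by omega) (by omega)
        have h3 : act n (c ++ c.map (vee n)) (labelD n x δ i (x i + t)) =
            labelD n x δ i (x i + ((t + 2 : ℕ) : ℤ)) := by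
          rw [hshift]; push_cast; rw [add_assoc]
        have h4 := TwistedLabel.next j _ _ h (hpos i t h1 h2 (by omega)) (by
          rw [h3]; exact hpos i (t + 2) h1 h2 ht)
        rw [h3] at h4
        refine ⟨j, ho, ?_⟩
        convert h4 using 2
        push_cast
        ring

/-! ### Each positive root of type `D` is the label of exactly one vertex -/

section
variable {n : ℕ} {x : ℕ → ℤ}

theorem cyc_eq_smul (n : ℕ) (x : ℕ → ℤ) (σ δ : ℤˣ) (k : ℤ) :
    ∃ s : ℤˣ, cyc n x σ δ k = (s : ℤ) • eps n (lvl n x k) := ⟨_, rfl⟩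

theorem smul_eps_injective {a b : ℕ} {s t : ℤˣ} (ha : 1 ≤ a) (ha' : a ≤ n + 1)
    (h : (s : ℤ) • eps n a = (t : ℤ) • eps n b) : a = b ∧ s = t := by
  have h1 := congrFun h ⟨a - 1, by omega⟩
  simp only [Pi.smul_apply, eps_apply ha ha'] at h1
  simp only [if_true, smul_eq_mul, mul_one] at h1
  split_ifs at h1 with h2
  · refine ⟨h2, ?_⟩
    ext
    omega
  · exact absurd h1 (by simp)

/-- Equal basis vectors mean a difference of m periods, and m must be even because an odd m reverses
the sign. -/
theorem IsProfile.cyc_injective (hx : IsProfile n x) {δ : ℤˣ} {k l : ℤ}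
    (h : cyc n x (-1) δ k = cyc n x (-1) δ l) : ∃ m : ℤ, l = k + 2 * (n + 1) * m := by
  obtain ⟨s, hs⟩ := cyc_eq_smul n x (-1) δ k
  obtain ⟨t, ht⟩ := cyc_eq_smul n x (-1) δ l
  obtain ⟨m, rfl⟩ := hx.lvl_eq_iff.1
    (smul_eps_injective (hx.lvl_pos _) (hx.lvl_le _) (hs.symm.trans (h.trans ht))).1
  rcases Int.even_or_odd' m with ⟨q, rfl | rfl⟩
  · exact ⟨q, by ring⟩
  · exfalso
    rw [cyc_add_mul, zpow_add, zpow_mul, zpow_one, hs] at h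
    have h1 : ((-1 : ℤˣ) ^ (2 : ℤ)) = 1 := by decide
    rw [h1, one_zpow, one_mul, ← neg_eq_units_smul, ← neg_smul, ← Units.val_neg] at h
    have := (smul_eps_injective (hx.lvl_pos _) (hx.lvl_le _) h).2
    rcases Int.units_eq_one_or s with rfl | rfl <;> revert this <;> decide

/-- The ends match either in order or crosswise. In order, i and j agree modulo 2(n + 1), hence are
equal. Crosswise, i + j would be a multiple of 2(n + 1), which is impossible for 0 < i + j ≤ 2n. -/
theorem IsProfile.labelD_injective (hx : IsProfile n x) {δ : ℤˣ} {i j : ℕ} {k l : ℤ} (hi : 1 ≤ i)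
    (hi' : i ≤ n) (hj : 1 ≤ j) (hj' : j ≤ n) (h : labelD n x δ i k = labelD n x δ j l) :
    i = j ∧ ∃ m : ℤ, l = k + 2 * (n + 1) * m := by
  obtain ⟨s, hs⟩ := cyc_eq_smul n x (-1) δ k
  obtain ⟨t, ht⟩ := cyc_eq_smul n x (-1) δ (k + i)
  obtain ⟨s', hs'⟩ := cyc_eq_smul n x (-1) δ l
  obtain ⟨t', ht'⟩ := cyc_eq_smul n x (-1) δ (l + j)
  have h0 := h
  rw [labelD, labelD, hs, ht, hs', ht', sub_eq_add_neg, sub_eq_add_neg, ← neg_smul, ← neg_smul,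
    ← Units.val_neg, ← Units.val_neg] at h0
  rcases signed_pair_unique s (-t) s' (-t') (hx.lvl_pos _) (hx.lvl_le _) (hx.lvl_pos _)
    (hx.lvl_le _) (hx.lvl_pos _) (hx.lvl_le _) (hx.lvl_pos _) (hx.lvl_le _)
    (hx.lvl_ne (by omega) (by omega)) (hx.lvl_ne (by omega) (by omega)) h0 with
    ⟨h1, h2, h3, h4⟩ | ⟨h1, h2, h3, h4⟩
  · obtain ⟨m, hm⟩ := hx.cyc_injective (k := k) (l := l) (δ := δ) (by rw [hs, hs', h1, h3])
    obtain ⟨m', hm'⟩ := hx.cyc_injective (k := k + i) (l := l + j) (δ := δ)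
      (by rw [ht, ht', h2, neg_injective h4])
    refine ⟨?_, m, hm⟩
    have h5 : (j : ℤ) - i = 2 * (n + 1) * (m' - m) := by linear_combination hm' - hm
    have h6 : m' - m = 0 := by
      by_contra h6
      rcases lt_or_gt_of_ne h6 with h6 | h6 <;> nlinarith
    rw [h6] at h5
    omega
  · exfalso
    obtain ⟨m, hm⟩ := hx.cyc_injective (k := k) (l := l + j + (n + 1)) (δ := δ) (by
      rw [cyc_add_period, hs, ht', h1, h3, ← neg_eq_units_smul, Units.val_neg, neg_smul])
    obtain ⟨m', hm'⟩ := hx.cyc_injective (k := k + i) (l := l + (n + 1)) (δ := δ) (by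
      rw [cyc_add_period, hs', ht, h2, ← h4, ← neg_eq_units_smul, Units.val_neg, neg_smul, neg_neg])
    have h5 : (j : ℤ) + i = 2 * (n + 1) * (m - m') := by linear_combination hm - hm'
    rcases lt_trichotomy (m - m') 0 with h6 | h6 | h6
    · nlinarith
    · rw [h6] at h5
      omega
    · nlinarith

theorem IsProfile.exists_cyc (hx : IsProfile n x) (hn : 1 ≤ n) (δ : ℤˣ) {a : ℕ} (ha : 1 ≤ a)
    (ha' : a ≤ n + 1) (s : ℤˣ) : ∃ k, cyc n x (-1) δ k = s • eps n a := by
  obtain ⟨k, _, _, rfl⟩ := hx.exists_lvl hn ha ha'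
  obtain ⟨t, ht⟩ := cyc_eq_smul n x (-1) δ k
  rcases eq_or_ne s t with rfl | h
  · exact ⟨k, ht⟩
  · refine ⟨k + (n + 1), ?_⟩
    rw [cyc_add_period, ht, Int.units_ne_iff_eq_neg.1 h, ← neg_eq_units_smul, Units.smul_def,
      Units.val_neg, neg_smul]

theorem labelD_add_mul (n : ℕ) (x : ℕ → ℤ) (δ : ℤˣ) (i : ℕ) (k m : ℤ) :
    labelD n x δ i (k + (n + 1) * m) = (-1 : ℤˣ) ^ m • labelD n x δ i k := by
  unfold labelD
  rw [cyc_add_mul, add_right_comm, cyc_add_mul, smul_sub]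

/-- Both terms of the root occur in the sequence, at k and l say. Their distance d modulo 2(n + 1)
is neither 0 nor n + 1, so one of d and 2(n + 1) - d is an admissible length. -/
theorem IsProfile.exists_labelD (hx : IsProfile n x) (hn : 1 ≤ n) (δ : ℤˣ) {β : Lat n}
    (hβ : IsPosRootD n β) : ∃ i, 1 ≤ i ∧ i ≤ n ∧ ∃ t : ℕ, t ≤ n ∧ β = labelD n x δ i (x i + t) := by
  have key : ∃ (i : ℕ) (k : ℤ) (s : ℤˣ), 1 ≤ i ∧ i ≤ n ∧ β = s • labelD n x δ i k := by
    obtain ⟨a, b, ha, hab, hb, h⟩ := hβ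
    obtain ⟨t, rfl⟩ : ∃ t : ℤˣ, β = eps n a - t • eps n b := by
      rcases h with rfl | rfl
      · exact ⟨1, by simp [rootDneg]⟩
      · exact ⟨-1, by rw [← neg_eq_units_smul, sub_neg_eq_add]; rfl⟩
    obtain ⟨k, hk⟩ := hx.exists_cyc hn δ ha (by omega) 1
    obtain ⟨l, hl⟩ := hx.exists_cyc hn δ (by omega) hb t
    rw [one_smul] at hk
    have hne : lvl n x k ≠ lvl n x l := by
      obtain ⟨s, hs⟩ := cyc_eq_smul n x (-1) δ k
      obtain ⟨s', hs'⟩ := cyc_eq_smul n x (-1) δ l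
      have e1 := smul_eps_injective (s := s) (t := 1) (b := a) (hx.lvl_pos _) (hx.lvl_le _)
        (by rw [← hs, hk]; simp)
      have e2 := smul_eps_injective (s := s') (t := t) (b := b) (hx.lvl_pos _) (hx.lvl_le _)
        (by rw [← hs', hl]; rfl)
      omega
    have hdiv := Int.emod_add_mul_ediv (l - k) (2 * (n + 1))
    have hnn := Int.emod_nonneg (l - k) (b := 2 * ((n : ℤ) + 1)) (by omega)
    have hlt := Int.emod_lt_of_pos (l - k) (b := 2 * ((n : ℤ) + 1)) (by omega)
    generalize hd : (l - k) % (2 * ((n : ℤ) + 1)) = d at *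
    generalize (l - k) / (2 * ((n : ℤ) + 1)) = m at *
    have hd0 : d ≠ 0 := by
      rintro rfl
      exact hne (hx.lvl_eq_iff.2 ⟨2 * m, by linarith⟩)
    have hd1 : d ≠ n + 1 := by
      rintro rfl
      exact hne (hx.lvl_eq_iff.2 ⟨2 * m + 1, by linarith⟩)
    have hl' : cyc n x (-1) δ (k + d) = t • eps n b := by
      rw [← hl, show l = k + d + (n + 1) * (2 * m) by linarith, cyc_add_mul, zpow_mul]
      have h1 : ((-1 : ℤˣ) ^ (2 : ℤ)) = 1 := by decide
      rw [h1, one_zpow, one_smul]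
    rcases lt_or_gt_of_ne hd1 with h2 | h2
    · refine ⟨d.toNat, k, 1, by omega, by omega, ?_⟩
      rw [one_smul, labelD, Int.toNat_of_nonneg hnn, hk, hl']
    -- The distance is too long in this direction. The interval from k + d to k + 2(n + 1) has the
    -- opposite label.
    · refine ⟨(2 * (n + 1) - d).toNat, k + d, -1, by omega, by omega, ?_⟩
      rw [labelD, Int.toNat_of_nonneg (by omega), hl',
        show k + d + (2 * (n + 1) - d) = k + (n + 1) + (n + 1) by ring, cyc_add_period,
        cyc_add_period, smul_smul, hk, units_mul_self, one_smul, ← neg_eq_units_smul, neg_sub]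
  obtain ⟨i, k, s, hi, hi', rfl⟩ := key
  -- A translation by periods brings the interval into its row. The sign left over is +, since the
  -- labels before and after are both positive.
  have hdiv := Int.emod_add_mul_ediv (k - x i) (n + 1)
  have hnn := Int.emod_nonneg (k - x i) (b := (n : ℤ) + 1) (by omega)
  have hlt := Int.emod_lt_of_pos (k - x i) (b := (n : ℤ) + 1) (by omega)
  generalize (k - x i) % ((n : ℤ) + 1) = d at *
  generalize (k - x i) / ((n : ℤ) + 1) = m at *
  obtain ⟨t, rfl⟩ := Int.eq_ofNat_of_zero_le hnn
  have h1 := isPosRootD_labelD hx hn δ hi hi' (k := x i + t) (by omega) (by omega)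
  refine ⟨i, hi, hi', t, by omega, ?_⟩
  rw [show k = x i + t + (n + 1) * m by linarith, labelD_add_mul, smul_smul] at hβ ⊢
  rcases Int.units_eq_one_or (s * (-1) ^ m) with h2 | h2
  · rw [h2, one_smul]
  · rw [h2, ← neg_eq_units_smul] at hβ
    exact absurd hβ (not_isPosRootD_neg h1)

end

/-! ### Commutation classes -/

section
variable {n : ℕ}

theorem CommStep.symm {w w' : List ℕ} (h : CommStep n w w') : CommStep n w' w := by
  obtain ⟨u, v, i, j, hij, rfl, rfl⟩ := h
  exact ⟨u, v, j, i, by rwa [dotProduct_comm], rfl, rfl⟩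

theorem refl_simpleRoot_of_comm {i j : ℕ} (h : simpleRoot n i ⬝ᵥ simpleRoot n j = 0) :
    refl n j (simpleRoot n i) = simpleRoot n i := by
  simp [refl, h]

theorem refl_comm {i j : ℕ} (h : simpleRoot n i ⬝ᵥ simpleRoot n j = 0) (v : Lat n) :
    refl n i (refl n j v) = refl n j (refl n i v) := by
  have h' : simpleRoot n j ⬝ᵥ simpleRoot n i = 0 := by rwa [dotProduct_comm]
  simp only [refl, sub_dotProduct, smul_dotProduct, h, h', smul_zero, sub_zero]
  abel

theorem CommStep.act_eq {w w' : List ℕ} (h : CommStep n w w') (v : Lat n) :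
    act n w v = act n w' v := by
  obtain ⟨u, r, i, j, hij, rfl, rfl⟩ := h
  simp only [act_append, act, refl_comm hij]

theorem CommEquiv.act_eq {w w' : List ℕ} (h : CommEquiv n w w') (v : Lat n) :
    act n w v = act n w' v := by
  induction h with
  | rel _ _ h => exact h.act_eq v
  | refl => rfl
  | symm _ _ _ ih => exact ih.symm
  | trans _ _ _ _ _ ih1 ih2 => exact ih1.trans ih2

/-- The four cases are the places of the pair i j relative to the marked letter a: before it, ending
at it, starting at it, after it. -/
theorem pair_of_append {u r U V : List ℕ} {a i j : ℕ} (h : u ++ a :: r = U ++ i :: j :: V) :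
    (∃ s, u = U ++ i :: j :: s ∧ V = s ++ a :: r) ∨ (u = U ++ [i] ∧ a = j ∧ r = V) ∨
      (u = U ∧ a = i ∧ r = j :: V) ∨ ∃ U', U = u ++ a :: U' ∧ r = U' ++ i :: j :: V := by
  rcases append_cons_of_append h.symm with ⟨v', rfl⟩ | ⟨u', rfl, h'⟩
  · exact Or.inr (Or.inr (Or.inr ⟨v', rfl, by simpa using h⟩))
  · match u', h' with
    | [], h' =>
      obtain ⟨rfl, rfl⟩ : i = a ∧ j :: V = r := by simpa using h'
      simp
    | [b], h' =>
      obtain ⟨rfl, rfl, rfl⟩ : i = b ∧ j = a ∧ V = r := by simpa using h'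
      simp
    | b :: b' :: s, h' =>
      obtain ⟨rfl, rfl, rfl⟩ : i = b ∧ j = b' ∧ V = s ++ a :: r := by simpa using h'
      exact Or.inl ⟨s, rfl, rfl⟩

theorem Adj.ne_of_comm_self {a b : ℕ} (h : Adj n a b) : simpleRoot n a ⬝ᵥ simpleRoot n a ≠ 0 := by
  intro h0
  have : simpleRoot n a = 0 := dotProduct_self_eq_zero.1 h0
  rw [Adj, this, zero_dotProduct] at h
  exact absurd h (by decide)

theorem Adj.symm {a b : ℕ} (h : Adj n a b) : Adj n b a := by
  rwa [Adj, dotProduct_comm]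

/-- A commutation does not change the root attached to a letter. A letter that passes a or b is
orthogonal to it, so it is neither a nor b, and it may enter or leave the stretch between them
freely. -/
theorem CombArrow.of_commStep {w w' : List ℕ} {β γ : Lat n} (h : CombArrow n w β γ)
    (hw : CommStep n w w') : CombArrow n w' β γ := by
  have hact := hw.act_eq
  obtain ⟨u₁, a, u₂, b, u₃, h1, hab, ha, hb, rfl, rfl⟩ := h
  obtain ⟨U, V, i, j, hij, h2, rfl⟩ := hw
  have hji : simpleRoot n j ⬝ᵥ simpleRoot n i = 0 := by rwa [dotProduct_comm]
  have hadj : ∀ {k}, simpleRoot n k ⬝ᵥ simpleRoot n a = 0 → k ≠ a ∧ k ≠ b := by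
    intro k hk
    refine ⟨?_, ?_⟩
    · rintro rfl
      exact hab.ne_of_comm_self hk
    · rintro rfl
      have := hab.symm
      rw [Adj, hk] at this
      exact absurd this (by decide)
  have hadj' : ∀ {k}, simpleRoot n k ⬝ᵥ simpleRoot n b = 0 → k ≠ a ∧ k ≠ b := by
    intro k hk
    refine ⟨?_, ?_⟩
    · rintro rfl
      rw [Adj, hk] at hab
      exact absurd hab (by decide)
    · rintro rfl
      exact hab.symm.ne_of_comm_self hk
  rw [h1] at h2
  rw [List.append_assoc, List.cons_append] at h2
  rcases pair_of_append h2 with ⟨s, rfl, rfl⟩ | ⟨rfl, rfl, rfl⟩ | ⟨rfl, rfl, h3⟩ | ⟨U', rfl, h3⟩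
  · refine ⟨U ++ j :: i :: s, a, u₂, b, u₃, by simp, hab, ha, hb, ?_, ?_⟩ <;>
      simp only [act_append, act, refl_comm hij]
  · refine ⟨U, a, i :: u₂, b, u₃, by simp, hab, ?_, ?_, ?_, ?_⟩
    · simp [ha, (hadj hij).1.symm]
    · simp [hb, (hadj hij).2.symm]
    · simp only [act_append, act, refl_comm hij]
    · simp only [act_append, act, refl_simpleRoot_of_comm hji]
  · cases u₂ with
    | nil =>
      obtain ⟨rfl, rfl⟩ : b = j ∧ u₃ = V := by simpa using h3
      rw [Adj, hij] at hab
      exact absurd hab (by decide)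
    | cons j' u₂ =>
      obtain ⟨rfl, rfl⟩ : j' = j ∧ u₂ ++ b :: u₃ = V := by simpa using h3
      simp only [List.mem_cons, not_or] at ha hb
      refine ⟨u₁ ++ [j'], a, u₂, b, u₃, by simp, hab, ha.2, hb.2, ?_, ?_⟩
      · simp only [act_append, act, refl_comm hij]
      · simp only [act_append, act, refl_simpleRoot_of_comm hij]
  · rcases pair_of_append h3 with ⟨s, rfl, rfl⟩ | ⟨rfl, rfl, rfl⟩ | ⟨rfl, rfl, rfl⟩ | ⟨U'', rfl, rfl⟩
    · refine ⟨u₁, a, U' ++ j :: i :: s, b, u₃, by simp, hab, ?_, ?_, ?_, rfl⟩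
      · simp at ha ⊢; tauto
      · simp at hb ⊢; tauto
      · simp only [act_append, act, refl_comm hij]
    · simp only [List.mem_append, List.mem_singleton, not_or] at ha hb
      refine ⟨u₁, a, U', b, i :: u₃, by simp, hab, ha.1, hb.1, ?_, rfl⟩
      simp only [act_append, act, refl_simpleRoot_of_comm hji]
    · refine ⟨u₁, a, u₂ ++ [j], b, V, by simp, hab, ?_, ?_, ?_, rfl⟩
      · simp [ha, (hadj' hji).1.symm]
      · simp [hb, (hadj' hji).2.symm]
      · simp only [act_append, act, refl_simpleRoot_of_comm hij]
    · exact ⟨u₁, a, u₂, b, U'' ++ j :: i :: V, by simp, hab, ha, hb, rfl, rfl⟩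

theorem CommEquiv.combArrow_iff {w w' : List ℕ} (h : CommEquiv n w w') (β γ : Lat n) :
    CombArrow n w β γ ↔ CombArrow n w' β γ := by
  induction h with
  | rel _ _ h => exact ⟨fun h' => h'.of_commStep h, fun h' => h'.of_commStep h.symm⟩
  | refl => rfl
  | symm _ _ _ ih => exact ih.symm
  | trans _ _ _ _ _ ih1 ih2 => exact ih1.trans ih2

end

/-! ### Arrows of the combinatorial Auslander–Reiten quiver -/

theorem simpleRoot_dot (n a b : ℕ) :
    simpleRoot n a ⬝ᵥ simpleRoot n b =
      if a = n + 1 then eps n n ⬝ᵥ simpleRoot n b + eps n (n + 1) ⬝ᵥ simpleRoot n b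
      else eps n a ⬝ᵥ simpleRoot n b - eps n (a + 1) ⬝ᵥ simpleRoot n b := by
  rw [simpleRoot]
  split_ifs <;> simp only [add_dotProduct, sub_dotProduct]

theorem adj_iff {n a b : ℕ} (hn : 2 ≤ n) (ha : 1 ≤ a) (ha' : a ≤ n + 1) :
    Adj n a b ↔ orb n a + 1 = orb n b ∨ orb n b + 1 = orb n a := by
  unfold Adj orb
  rw [simpleRoot_dot]
  by_cases h1 : a = n + 1
  · rw [if_pos h1, eps_dot_simpleRoot (by omega) (by omega),
      eps_dot_simpleRoot (by omega) (by omega)]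
    split_ifs <;> omega
  · rw [if_neg h1, eps_dot_simpleRoot (by omega) (by omega),
      eps_dot_simpleRoot (by omega) (by omega)]
    split_ifs <;> omega

theorem comm_iff {n a b : ℕ} (hn : 2 ≤ n) (ha : 1 ≤ a) (ha' : a ≤ n + 1) (hb' : b ≤ n + 1) :
    simpleRoot n a ⬝ᵥ simpleRoot n b = 0 ↔ a ≠ b ∧ ¬ Adj n a b := by
  rw [adj_iff hn ha ha']
  unfold orb
  rw [simpleRoot_dot]
  by_cases h1 : a = n + 1
  · rw [if_pos h1, eps_dot_simpleRoot (by omega) (by omega),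
      eps_dot_simpleRoot (by omega) (by omega)]
    split_ifs <;> omega
  · rw [if_neg h1, eps_dot_simpleRoot (by omega) (by omega),
      eps_dot_simpleRoot (by omega) (by omega)]
    split_ifs <;> omega

theorem exists_split_of_lt_count {f : ℕ → ℕ} {L : List ℕ} {i t : ℕ} (h : t < (L.map f).count i) :
    ∃ u a v, L = u ++ a :: v ∧ f a = i ∧ (u.map f).count i = t := by
  induction L generalizing t with
  | nil => simp at h
  | cons a L ih =>
    by_cases ha : f a = i
    · cases t with
      | zero => exact ⟨[], a, L, rfl, ha, rfl⟩
      | succ t =>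
        obtain ⟨u, b, v, rfl, hb, hu⟩ := ih (t := t) (by
          simp only [List.map_cons, List.count_cons, ha, beq_self_eq_true, if_true] at h
          omega)
        exact ⟨a :: u, b, v, rfl, hb, by simp [ha, hu]⟩
    · obtain ⟨u, b, v, rfl, hb, hu⟩ := ih (t := t) (by
        simpa [List.count_cons, ha] using h)
      exact ⟨a :: u, b, v, rfl, hb, by simp [ha, hu]⟩

/-- Every letter of the word sits at its row and at ξ minus twice the number of earlier letters of
that row. Legality puts it one above the neighbouring rows at the moment it is read (`hmax`), so
letters of neighbouring rows alternate, and consecutive ones differ by 1 in position. -/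
theorem combArrow_iff_isStep {n : ℕ} {Q : ℕ → ℕ → Prop} {ξ : ℕ → ℤ} {c : List ℕ} (hn : 2 ≤ n)
    (hQ : IsDynkinQuiverA n Q) (hξ : IsHeightFunction Q ξ) (hc : IsTwistedCoxeterWord n c)
    (hcQ : IsCoxeterWordOf n Q (projWord n c)) (x y : ℕ × ℤ) :
    (∃ β γ, FoldedLabel n c ξ x β ∧ FoldedLabel n c ξ y γ ∧ CombArrow n (twistedWord n c) β γ) ↔
      (∃ β, FoldedLabel n c ξ x β) ∧ (∃ γ, FoldedLabel n c ξ y γ) ∧ IsStep x y := by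
  have hx := isProfile_prof hQ hξ
  have hr := rowLegal_of_isCoxeterWordOf hQ hξ hcQ
  rw [projWord_eq (by omega) hc] at hr
  have hF := FoldedLabel_iff (by omega) hQ hξ hc hcQ
  have hrW := rowLegal_blocks hc hr (n + 1)
  have hlW := letterLegal_blocks (by omega) hc (n + 1)
  have hcount : ∀ i, 1 ≤ i → i ≤ n → ((blocks n c (n + 1)).map (orb n)).count i = n + 1 :=
    fun i hi hi' => count_blocks hc hi hi' _
  rw [twistedWord_eq_blocks]
  generalize hW : blocks n c (n + 1) = W at *
  have hrow : ∀ {u a v}, W = u ++ a :: v → 1 ≤ orb n a ∧ orb n a ≤ n := by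
    intro u a v h
    have h0 := hrW (u.map (orb n)) (orb n a) (v.map (orb n)) (by simp [h])
    exact ⟨h0.1, h0.2.1⟩
  have hletter : ∀ {u a v}, W = u ++ a :: v → 1 ≤ a ∧ a ≤ n + 1 := by
    intro u a v h
    have := hrow h
    unfold orb at this
    split_ifs at this <;> omega
  have hmax : ∀ {u a v}, W = u ++ a :: v → ∀ j, 1 ≤ j → j ≤ n →
      (orb n a + 1 = j ∨ j + 1 = orb n a) →
      ξ j - 2 * (u.map (orb n)).count j + 1 = ξ (orb n a) - 2 * (u.map (orb n)).count (orb n a) := by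
    intro u a v h j hj hj' haj
    obtain ⟨h1, h2, h3, h4⟩ := hrW (u.map (orb n)) (orb n a) (v.map (orb n)) (by simp [h])
    have e1 := two_mul_prof hQ hξ h1 h2
    have e2 := two_mul_prof hQ hξ hj hj'
    rcases haj with rfl | h5
    · have h6 := h4 (by omega)
      unfold adv at h6
      push_cast at e2
      omega
    · have h6 := h3 (by omega)
      rw [show orb n a - 1 = j by omega] at h6
      unfold adv at h6
      omega
  have hocc : ∀ {u a v}, W = u ++ a :: v → FoldedLabel n c ξ
      (orb n a, ξ (orb n a) - 2 * (u.map (orb n)).count (orb n a)) (act n u (simpleRoot n a)) := by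
    intro u a v h
    have h1 := hrow h
    have h2 := hcount _ h1.1 h1.2
    simp only [h, List.map_append, List.map_cons, List.count_append, List.count_cons_self] at h2
    exact (hF _ _ _).2 ⟨h1.1, h1.2, _, by omega, rfl,
      act_simpleRoot_of_legal hx (by omega) hrW hlW h⟩
  have huniq : ∀ {x y β}, FoldedLabel n c ξ x β → FoldedLabel n c ξ y β → x = y := by
    rintro ⟨i, p⟩ ⟨j, q⟩ β h h'
    obtain ⟨h1, h2, t, ht, rfl, rfl⟩ := (hF _ _ _).1 h
    obtain ⟨h3, h4, s, hs, rfl, h5⟩ := (hF _ _ _).1 h'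
    obtain ⟨rfl, m, hm⟩ := hx.labelD_injective h1 h2 h3 h4 h5
    have : m = 0 := by
      by_contra h6
      rcases lt_or_gt_of_ne h6 with h6 | h6 <;> nlinarith
    rw [this] at hm
    congr 2
    omega
  constructor
  · rintro ⟨β, γ, hβ, hγ, u₁, a, u₂, b, u₃, h, hab, ha, hb, rfl, rfl⟩
    refine ⟨⟨_, hβ⟩, ⟨_, hγ⟩, ?_⟩
    have sb : W = (u₁ ++ a :: u₂) ++ b :: u₃ := h
    have sa : W = u₁ ++ a :: (u₂ ++ b :: u₃) := by simpa using h
    obtain rfl := huniq hβ (hocc sb)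
    obtain rfl := huniq hγ (hocc sa)
    have la := hletter sa
    have ra := hrow sa
    have rb := hrow sb
    rw [adj_iff hn la.1 la.2] at hab
    have m1 := hmax sa (orb n b) rb.1 rb.2 (by omega)
    -- `CombArrow` only excludes the letter b, whereas row n has two letters. If the other one
    -- occurred in between, alternation would require a letter of row n - 1 before b; the only such
    -- letter is a, which is excluded.
    have hzero : (u₂.map (orb n)).count (orb n b) = 0 := by
      by_contra h0
      have hbn : orb n b = n := by
        by_contra hbn
        obtain ⟨d, hd, hd'⟩ := List.mem_map.1 (List.count_pos_iff.1 (Nat.pos_of_ne_zero h0))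
        have : d = b := by unfold orb at hbn hd'; split_ifs at hbn hd' <;> omega
        exact hb (this ▸ hd)
      obtain ⟨p, d, q, rfl, hd, hp⟩ := exists_split_of_lt_count (Nat.pos_of_ne_zero h0)
      have m2 := hmax (u := u₁ ++ a :: p) (a := d) (v := q ++ b :: u₃) (by simpa using sa)
        (orb n a) ra.1 ra.2 (by omega)
      have m3 := hmax sb (orb n a) ra.1 ra.2 (by omega)
      have ha0 : ((p ++ d :: q).map (orb n)).count (orb n a) = 0 := by
        rw [List.count_eq_zero]
        intro hmem
        obtain ⟨e, he, he'⟩ := List.mem_map.1 hmem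
        have : e = a := by unfold orb at hab hbn he'; split_ifs at hab hbn he' <;> omega
        exact ha (this ▸ he)
      rw [hd] at m2
      simp only [List.map_append, List.map_cons, List.count_append, List.count_cons, hd, hp]
        at m2 m3 ha0
      have hne : orb n a ≠ orb n b := by omega
      simp only [beq_self_eq_true, if_true, beq_eq_false_iff_ne.2 hne, beq_eq_false_iff_ne.2 hne.symm,
        Bool.false_eq_true, if_false] at m2 m3 ha0
      push_cast at m2 m3
      omega
    refine ⟨by simp only; omega, ?_⟩
    simp only [List.map_append, List.map_cons, List.count_append, List.count_cons, hzero]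
    rw [if_neg (by simp; omega)]
    push_cast
    omega
  · rintro ⟨⟨β, hβ⟩, ⟨γ, hγ⟩, hstep⟩
    obtain ⟨j, p⟩ := x
    obtain ⟨i, q⟩ := y
    obtain ⟨hij, hpq⟩ := hstep
    simp only at hij hpq
    obtain ⟨hj, hj', s, hs, rfl, rfl⟩ := (hF _ _ _).1 hβ
    obtain ⟨hi, hi', t, ht, rfl, rfl⟩ := (hF _ _ _).1 hγ
    -- The target is letter number t of row i, counted from 0, and the source is the first letter of
    -- row j after it.
    obtain ⟨u₁, a, v, sa, rfl, hu⟩ := exists_split_of_lt_count (f := orb n) (L := W) (i := i)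
      (t := t) (by rw [hcount i hi hi']; omega)
    have m1 := hmax sa j hj hj' (by omega)
    have hv : 0 < (v.map (orb n)).count j := by
      have h2 := hcount j hj hj'
      simp only [sa, List.map_append, List.map_cons, List.count_append, List.count_cons] at h2
      rw [if_neg (by simp; omega)] at h2
      omega
    obtain ⟨u₂, b, u₃, rfl, rfl, hu₂⟩ := exists_split_of_lt_count hv
    have sb : W = (u₁ ++ a :: u₂) ++ b :: u₃ := by simpa using sa
    have la := hletter sa
    have hγ' := hocc sa
    have hβ' := hocc sb
    refine ⟨_, _, ?_, ?_, u₁, a, u₂, b, u₃, sb, ?_, ?_, ?_, rfl, rfl⟩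
    · convert hβ' using 2
      simp only [List.map_append, List.map_cons, List.count_append, List.count_cons, hu₂]
      rw [if_neg (by simp; omega)]
      push_cast
      omega
    · rwa [hu] at hγ'
    · rw [adj_iff hn la.1 la.2]
      omega
    · intro hmem
      -- A second a would force a letter of row j in between, against the choice of b.
      obtain ⟨r, r', rfl⟩ := List.append_of_mem hmem
      have m2 := hmax (u := u₁ ++ a :: r) (a := a) (v := r' ++ b :: u₃) (by simpa using sa)
        (orb n b) hj hj' (by omega)
      simp only [List.map_append, List.map_cons, List.count_append, List.count_cons] at m2 hu₂
      rw [if_neg (by simp; omega)] at m2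
      simp only [beq_self_eq_true, if_true] at m2
      push_cast at m2
      omega
    · intro hmem
      exact absurd hu₂ (List.count_pos_iff.2 (List.mem_map_of_mem hmem)).ne'

/-! ### The Dynkin quiver of a word and its height function -/

/-- The quiver with an arrow `a → b` between neighbours whenever `b` precedes `a` in the word. -/
def orderQuiver (n : ℕ) (r : List ℕ) (a b : ℕ) : Prop :=
  (1 ≤ a ∧ a ≤ n) ∧ (1 ≤ b ∧ b ≤ n) ∧ (a + 1 = b ∨ b + 1 = a) ∧ r.idxOf b < r.idxOf a

theorem isDynkinQuiverA_orderQuiver {n : ℕ} {r : List ℕ} (hr : r.Perm (List.range' 1 n)) :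
    IsDynkinQuiverA n (orderQuiver n r) := by
  refine ⟨fun i j h => ⟨h.1, h.2.1, h.2.2.1⟩, fun i hi hi' => ?_⟩
  have h1 : r.idxOf i ≠ r.idxOf (i + 1) := by
    intro h
    have := (List.idxOf_inj ((mem_of_perm_range hr i).2 ⟨hi, by omega⟩)).1 h
    omega
  unfold orderQuiver
  rcases lt_or_gt_of_ne h1 with h | h
  · right
    exact ⟨⟨by omega, by omega, by omega, h⟩, fun h' => by omega⟩
  · left
    exact ⟨⟨by omega, by omega, by omega, h⟩, fun h' => by omega⟩

/-- The first letter of the word is a sink, and reflecting there gives the quiver of the word with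
that letter moved to the end. The list p collects the letters already used. -/
theorem isAdapted_orderQuiver {n : ℕ} {u p : List ℕ} (h : (u ++ p).Perm (List.range' 1 n)) :
    IsAdapted (orderQuiver n (u ++ p)) u := by
  induction u generalizing p with
  | nil => trivial
  | cons i u ih =>
    have hsink : IsSink (orderQuiver n (i :: u ++ p)) i := by
      rintro j ⟨_, _, _, h⟩
      simp at h
    have hperm : (u ++ (p ++ [i])).Perm (List.range' 1 n) := by
      refine List.Perm.trans ?_ h
      rw [← List.append_assoc]
      exact List.perm_append_singleton i (u ++ p)
    refine ⟨hsink, ?_⟩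
    convert ih hperm using 1
    funext a b
    rw [eq_iff_iff, reflQuiver_of_isSink hsink]
    have hnd : (i :: (u ++ p)).Nodup := h.nodup_iff.2 List.nodup_range'
    have hi : i ∉ u ++ p := (List.nodup_cons.1 hnd).1
    have e1 : ∀ a, a ≠ i → (i :: (u ++ p)).idxOf a = (u ++ p).idxOf a + 1 :=
      fun a ha => List.idxOf_cons_ne _ (Ne.symm ha)
    have e2 : ∀ a, 1 ≤ a → a ≤ n → a ≠ i → (u ++ p ++ [i]).idxOf a = (u ++ p).idxOf a ∧
        (u ++ p).idxOf a < (u ++ p).length := by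
      intro a ha ha' hai
      have := (mem_of_perm_range h a).2 ⟨ha, ha'⟩
      have h2 : a ∈ u ++ p := by
        rcases List.mem_cons.1 this with h | h
        · exact absurd h hai
        · exact h
      exact ⟨List.idxOf_append_of_mem h2, List.idxOf_lt_length_of_mem h2⟩
    have e3 : (u ++ p ++ [i]).idxOf i = (u ++ p).length := by
      rw [List.idxOf_append_of_notMem hi]
      simp
    have e4 : (i :: (u ++ p)).idxOf i = 0 := by simp
    simp only [orderQuiver, List.cons_append, ← List.append_assoc]
    by_cases hab : a = i ∨ b = i
    · rw [if_pos hab]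
      rcases hab with rfl | rfl
      · rw [e3, e4]
        constructor
        · rintro ⟨h1, h2, h3, h4⟩
          exact ⟨h2, h1, h3.symm, (e2 b h1.1 h1.2 (by omega)).1 ▸ (e2 b h1.1 h1.2 (by omega)).2⟩
        · rintro ⟨h1, h2, h3, h4⟩
          exact ⟨h2, h1, h3.symm, by rw [e1 b (by omega)]; omega⟩
      · rw [e3, e4]
        constructor
        · rintro ⟨h1, h2, h3, h4⟩
          omega
        · rintro ⟨h1, h2, h3, h4⟩
          have := e2 a h1.1 h1.2 (by omega)
          omega
    · rw [if_neg hab]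
      push Not at hab
      rw [e1 a hab.1, e1 b hab.2]
      constructor
      · rintro ⟨h1, h2, h3, h4⟩
        exact ⟨h1, h2, h3, by rw [(e2 a h1.1 h1.2 hab.1).1, (e2 b h2.1 h2.2 hab.2).1]; omega⟩
      · rintro ⟨h1, h2, h3, h4⟩
        rw [(e2 a h1.1 h1.2 hab.1).1, (e2 b h2.1 h2.2 hab.2).1] at h4
        exact ⟨h1, h2, h3, by omega⟩

theorem exists_quiver {n : ℕ} {c : List ℕ} (hn : 1 ≤ n) (hc : IsTwistedCoxeterWord n c) :
    ∃ Q, IsDynkinQuiverA n Q ∧ IsCoxeterWordOf n Q (projWord n c) := by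
  rw [projWord_eq hn hc]
  refine ⟨orderQuiver n (c.map (orb n)), isDynkinQuiverA_orderQuiver hc, hc, ?_⟩
  have := isAdapted_orderQuiver (n := n) (u := c.map (orb n)) (p := [])
    (by rwa [List.append_nil])
  simpa using this

open Classical in
theorem exists_isHeightFunction {n : ℕ} {Q : ℕ → ℕ → Prop} (hQ : IsDynkinQuiverA n Q) :
    ∃ ξ, IsHeightFunction Q ξ := by
  let ξ : ℕ → ℤ := fun i => Nat.rec 0 (fun i z => if Q i (i + 1) then z + 1 else z - 1) i
  have hξ : ∀ i, ξ (i + 1) = if Q i (i + 1) then ξ i + 1 else ξ i - 1 := fun i => rfl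
  refine ⟨ξ, fun i j h => ?_⟩
  obtain ⟨h1, h2, rfl | rfl⟩ := hQ.1 j i h
  · rw [hξ, if_pos h]
  · have h3 : ¬ Q i (i + 1) := by
      rcases hQ.2 i h2.1 h1.2 with ⟨_, h3⟩ | ⟨_, h3⟩
      · exact absurd h h3
      · exact h3
    rw [hξ, if_neg h3]
    ring

/-! ### The action of the longest element -/

theorem vee_iterate_mem {n i : ℕ} (hn : 1 ≤ n) (hi : 1 ≤ i) (hi' : i ≤ n + 1) (k : ℕ) :
    1 ≤ (vee n)^[k] i ∧ (vee n)^[k] i ≤ n + 1 := by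
  induction k with
  | zero => exact ⟨hi, hi'⟩
  | succ k ih =>
    rw [Function.iterate_succ_apply']
    generalize (vee n)^[k] i = j at ih
    unfold vee
    split_ifs <;> omega

theorem vee_iterate_even {n k : ℕ} (hk : Even k) (i : ℕ) : (vee n)^[k] i = i := by
  have h : Function.Involutive (vee n) := vee_vee n
  rw [h.iterate_even hk, id]

/-- The n + 1 blocks shift the sequence by a full period, which negates ε_j for j ≤ n. For ε_{n+1}
there are also n + 1 changes of δ, so it is multiplied by (-1)^n. This determines i^* in the
reflection functors. -/
theorem act_twistedWord {n : ℕ} {c : List ℕ} (hn : 1 ≤ n) (hc : IsTwistedCoxeterWord n c) {a : ℕ}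
    (ha : 1 ≤ a) (ha' : a ≤ n + 1) :
    act n (twistedWord n c) (simpleRoot n a) = -simpleRoot n ((vee n)^[n + 1] a) := by
  obtain ⟨Q, hQ, hcQ⟩ := exists_quiver hn hc
  obtain ⟨ξ, hξ⟩ := exists_isHeightFunction hQ
  have hx := isProfile_prof hQ hξ
  have hr := rowLegal_of_isCoxeterWordOf hQ hξ hcQ
  rw [projWord_eq hn hc] at hr
  obtain ⟨h1, h2⟩ := movesBasis_prefix hx hn (rowLegal_blocks hc hr (n + 1))
    (letterLegal_blocks hn hc (n + 1)) _ [] (List.append_nil _).symm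
  rw [← twistedWord_eq_blocks] at h1 h2
  have e1 : ∀ j, 1 ≤ j → j ≤ n → act n (twistedWord n c) (eps n j) = -eps n j := by
    intro j hj hj'
    rw [h1 j hj hj', kap_add n (prof n ξ) _ (n + 1) (fun i hi hi' => by
      rw [adv, twistedWord_eq_blocks, count_blocks hc hi hi']; push_cast; rfl) hj hj',
      cyc_add_period, hx.cyc_kap hn _ _ hj hj', neg_eq_units_smul]
  have e2 : act n (twistedWord n c) (eps n (n + 1)) = (-1 : ℤˣ) ^ n • eps n (n + 1) := by
    rw [h2, adv, twistedWord_eq_blocks, count_blocks hc hn le_rfl]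
    push_cast
    rw [add_right_comm, cyc_add_period, hx.cyc_last hn, smul_smul, smul_smul]
    congr 1
    rcases Int.units_eq_one_or (wordSign n c) with h | h <;> rw [h] <;> simp [pow_succ]
  generalize twistedWord n c = W at *
  rcases Nat.even_or_odd n with he | ho
  · rw [Function.iterate_succ_apply', vee_iterate_even he]
    rw [he.neg_one_pow, one_smul] at e2
    rcases Nat.lt_trichotomy a n with h | rfl | h
    · rw [vee, if_neg (by omega), if_neg (by omega), simpleRoot_of_le (by omega), act_sub,
        e1 _ ha (by omega), e1 _ (by omega) (by omega)]
      abel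
    · rw [vee, if_pos rfl, simpleRoot_of_le le_rfl, simpleRoot_last, act_sub, e1 _ ha le_rfl, e2]
      abel
    · obtain rfl : a = n + 1 := by omega
      rw [vee, if_neg (by omega), if_pos rfl, simpleRoot_of_le le_rfl, simpleRoot_last, act_add,
        e1 _ hn le_rfl, e2]
      abel
  · rw [vee_iterate_even ho.add_one]
    rw [ho.neg_one_pow, ← neg_eq_units_smul] at e2
    rcases Nat.lt_trichotomy a n with h | rfl | h
    · rw [simpleRoot_of_le (by omega), act_sub, e1 _ ha (by omega), e1 _ (by omega) (by omega)]
      abel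
    · rw [simpleRoot_of_le le_rfl, act_sub, e1 _ ha le_rfl, e2]
      abel
    · obtain rfl : a = n + 1 := by omega
      rw [simpleRoot_last, act_add, e1 _ hn le_rfl, e2]
      abel

/-- The product of two simple roots is 2 only if they have the same index. -/
theorem simpleRoot_injective {n a b : ℕ} (ha : 1 ≤ a) (ha' : a ≤ n + 1)
    (hb' : b ≤ n + 1) (hn : 1 ≤ n) (h : simpleRoot n a = simpleRoot n b) : a = b := by
  have h1 : simpleRoot n a ⬝ᵥ simpleRoot n a = simpleRoot n a ⬝ᵥ simpleRoot n b := by rw [← h]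
  rw [simpleRoot_dot, simpleRoot_dot] at h1
  by_cases h2 : a = n + 1
  · rw [if_pos h2, if_pos h2] at h1
    rw [eps_dot_simpleRoot hn (Nat.le_succ n), eps_dot_simpleRoot (Nat.le_add_left 1 n) le_rfl,
      eps_dot_simpleRoot hn (Nat.le_succ n), eps_dot_simpleRoot (Nat.le_add_left 1 n) le_rfl] at h1
    split_ifs at h1 <;> omega
  · rw [if_neg h2, if_neg h2] at h1
    rw [eps_dot_simpleRoot ha ha', eps_dot_simpleRoot ha ha',
      eps_dot_simpleRoot (show 1 ≤ a + 1 by omega) (show a + 1 ≤ n + 1 by omega),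
      eps_dot_simpleRoot (show 1 ≤ a + 1 by omega) (show a + 1 ≤ n + 1 by omega)] at h1
    split_ifs at h1 <;> omega

/-! ### Reflection functors and twisted Coxeter words -/

section
variable {n : ℕ}

theorem CommEquiv.append_left {w w' : List ℕ} (u : List ℕ) (h : CommEquiv n w w') :
    CommEquiv n (u ++ w) (u ++ w') := by
  induction h with
  | rel _ _ h =>
    obtain ⟨p, q, i, j, hij, rfl, rfl⟩ := h
    exact .rel _ _ ⟨u ++ p, q, i, j, hij, by simp, by simp⟩
  | refl => exact .refl _
  | symm _ _ _ ih => exact ih.symm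
  | trans _ _ _ _ _ ih1 ih2 => exact ih1.trans _ _ _ ih2

theorem CommEquiv.append_right {w w' : List ℕ} (u : List ℕ) (h : CommEquiv n w w') :
    CommEquiv n (w ++ u) (w' ++ u) := by
  induction h with
  | rel _ _ h =>
    obtain ⟨p, q, i, j, hij, rfl, rfl⟩ := h
    exact .rel _ _ ⟨p, q ++ u, i, j, hij, by simp, by simp⟩
  | refl => exact .refl _
  | symm _ _ _ ih => exact ih.symm
  | trans _ _ _ _ _ ih1 ih2 => exact ih1.trans _ _ _ ih2

theorem CommEquiv.reverse {w w' : List ℕ} (h : CommEquiv n w w') :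
    CommEquiv n w.reverse w'.reverse := by
  induction h with
  | rel _ _ h =>
    obtain ⟨p, q, i, j, hij, rfl, rfl⟩ := h
    exact .rel _ _ ⟨q.reverse, p.reverse, j, i, by rwa [dotProduct_comm], by simp, by simp⟩
  | refl => exact .refl _
  | symm _ _ _ ih => exact ih.symm
  | trans _ _ _ _ _ ih1 ih2 => exact ih1.trans _ _ _ ih2

theorem CommEquiv.perm {w w' : List ℕ} (h : CommEquiv n w w') : w.Perm w' := by
  induction h with
  | rel _ _ h =>
    obtain ⟨p, q, i, j, hij, rfl, rfl⟩ := h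
    exact (List.Perm.swap _ _ _).append_left _
  | refl => exact .refl _
  | symm _ _ _ ih => exact ih.symm
  | trans _ _ _ _ _ ih1 ih2 => exact ih1.trans ih2

/-- This makes commutation classes cancellative: a common first letter can be removed
(`CommEquiv.of_cons`), and by reversal a common last letter. -/
theorem CommEquiv.erase {w w' : List ℕ} (a : ℕ) (h : CommEquiv n w w') :
    CommEquiv n (w.erase a) (w'.erase a) := by
  induction h with
  | rel _ _ h =>
    obtain ⟨p, q, i, j, hij, rfl, rfl⟩ := h
    rw [List.erase_append, List.erase_append]
    split_ifs with h
    · exact .rel _ _ ⟨p.erase a, q, i, j, hij, rfl, rfl⟩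
    · rcases eq_or_ne i a with rfl | hi
      · rcases eq_or_ne j i with rfl | hj
        · exact .refl _
        · rw [List.erase_cons_head, List.erase_cons_tail (by simpa using hj), List.erase_cons_head]
          exact .refl _
      · rcases eq_or_ne j a with rfl | hj
        · rw [List.erase_cons_head, List.erase_cons_tail (by simpa using hi), List.erase_cons_head]
          exact .refl _
        · simp only [List.erase_cons_tail, beq_iff_eq, hi, hj, not_false_eq_true]
          exact .rel _ _ ⟨p, q.erase a, i, j, hij, rfl, rfl⟩
  | refl => exact .refl _
  | symm _ _ _ ih => exact ih.symm
  | trans _ _ _ _ _ ih1 ih2 => exact ih1.trans _ _ _ ih2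

theorem CommEquiv.of_cons {w w' : List ℕ} {a : ℕ} (h : CommEquiv n (a :: w) (a :: w')) :
    CommEquiv n w w' := by
  simpa using h.erase a

theorem CommEquiv.of_append_singleton {w w' : List ℕ} {a : ℕ}
    (h : CommEquiv n (w ++ [a]) (w' ++ [a])) : CommEquiv n w w' := by
  have h1 := h.reverse
  rw [List.reverse_append, List.reverse_append] at h1
  simpa using (CommEquiv.of_cons h1).reverse

/-- The letter `i` can be moved to the front of the word. -/
def CanLead (n i : ℕ) (w : List ℕ) : Prop :=
  ∃ p q, w = p ++ i :: q ∧ ∀ a ∈ p, simpleRoot n a ⬝ᵥ simpleRoot n i = 0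

theorem CanLead.of_commStep {i : ℕ} {w w' : List ℕ} (h : CanLead n i w) (hw : CommStep n w w') :
    CanLead n i w' := by
  obtain ⟨p, q, rfl, hp⟩ := h
  obtain ⟨U, V, a, b, hab, h, rfl⟩ := hw
  rcases pair_of_append h with ⟨s, rfl, rfl⟩ | ⟨rfl, rfl, rfl⟩ | ⟨rfl, rfl, rfl⟩ | ⟨U', rfl, rfl⟩
  · exact ⟨U ++ b :: a :: s, q, by simp, fun d hd => hp d (by simp at hd ⊢; tauto)⟩
  · exact ⟨U, a :: q, rfl, fun d hd => hp d (by simp [hd])⟩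
  · refine ⟨p ++ [b], V, by simp, fun d hd => ?_⟩
    rcases List.mem_append.1 hd with hd | hd
    · exact hp d hd
    · obtain rfl : d = b := by simpa using hd
      rwa [dotProduct_comm]
  · exact ⟨p, U' ++ b :: a :: V, by simp, hp⟩

theorem CommEquiv.canLead_iff {i : ℕ} {w w' : List ℕ} (h : CommEquiv n w w') :
    CanLead n i w ↔ CanLead n i w' := by
  induction h with
  | rel _ _ h => exact ⟨fun h' => h'.of_commStep h, fun h' => h'.of_commStep h.symm⟩
  | refl => rfl
  | symm _ _ _ ih => exact ih.symm
  | trans _ _ _ _ _ ih1 ih2 => exact ih1.trans ih2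

theorem canLead_cons (i : ℕ) (w : List ℕ) : CanLead n i (i :: w) := ⟨[], w, rfl, by simp⟩

theorem commEquiv_move_front {p q : List ℕ} {i : ℕ}
    (hp : ∀ a ∈ p, simpleRoot n a ⬝ᵥ simpleRoot n i = 0) :
    CommEquiv n (p ++ i :: q) (i :: (p ++ q)) := by
  induction p with
  | nil => exact .refl _
  | cons a p ih =>
    have h1 := (ih fun b hb => hp b (by simp [hb])).append_left [a]
    exact h1.trans _ _ _ (.rel _ _ ⟨[], p ++ q, a, i, hp a (by simp), rfl, rfl⟩)

theorem commEquiv_move_back {p q : List ℕ} {i : ℕ}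
    (hq : ∀ a ∈ q, simpleRoot n a ⬝ᵥ simpleRoot n i = 0) :
    CommEquiv n (p ++ i :: q) (p ++ q ++ [i]) := by
  have := (commEquiv_move_front (p := q.reverse) (q := p.reverse) (i := i)
    fun a ha => hq a (by simpa using ha)).reverse
  simpa using this

theorem comm_vee_iterate {a b : ℕ} (hn : 2 ≤ n) (ha : 1 ≤ a) (ha' : a ≤ n + 1) (hb : 1 ≤ b)
    (hb' : b ≤ n + 1) (h : simpleRoot n a ⬝ᵥ simpleRoot n b = 0) (k : ℕ) :
    simpleRoot n ((vee n)^[k] a) ⬝ᵥ simpleRoot n ((vee n)^[k] b) = 0 := by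
  have h1 := vee_iterate_mem (by omega) ha ha' k
  have h2 := vee_iterate_mem (by omega) hb hb' k
  have hinj : Function.Injective (vee n)^[k] :=
    (show Function.Involutive (vee n) from vee_vee n).injective.iterate k
  rw [comm_iff hn ha ha' hb', adj_iff hn ha ha'] at h
  rw [comm_iff hn h1.1 h1.2 h2.2, adj_iff hn h1.1 h1.2, orb_vee_iterate,
    orb_vee_iterate]
  exact ⟨fun h' => h.1 (hinj h'), h.2⟩

theorem commEquiv_blocks {c d : List ℕ}
    (h : ∀ k, CommEquiv n (c.map (vee n)^[k]) (d.map (vee n)^[k])) (m : ℕ) :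
    CommEquiv n (blocks n c m) (blocks n d m) := by
  induction m with
  | zero => exact .refl _
  | succ m ih =>
    rw [blocks_succ, blocks_succ]
    exact (ih.append_right _).trans _ _ _ ((h m).append_left _)

/-- The reflection functor on words. The letter ∨^{k+1} i that opens block k + 1 is regrouped as the
letter ∨^k(∨ i) that closes block k. -/
theorem blocks_rotate (n i : ℕ) (c : List ℕ) (m : ℕ) :
    blocks n (i :: c) m ++ [(vee n)^[m] i] = i :: blocks n (c ++ [vee n i]) m := by
  induction m with
  | zero => rfl
  | succ m ih =>
    have h : blocks n (i :: c) (m + 1) ++ [(vee n)^[m + 1] i] =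
        blocks n (i :: c) m ++ [(vee n)^[m] i] ++ (c.map (vee n)^[m] ++ [(vee n)^[m + 1] i]) := by
      simp [blocks_succ]
    rw [h, ih, blocks_succ]
    simp

theorem IsTwistedCoxeterWord.map_vee {c : List ℕ} (hc : IsTwistedCoxeterWord n c) (k : ℕ) :
    IsTwistedCoxeterWord n (c.map (vee n)^[k]) := by
  rwa [IsTwistedCoxeterWord, map_orb_map_vee]

/-- As n ≥ 2, the orbit of i has a neighbouring orbit, which c represents. Hence no letter can
commute past a whole block. -/
theorem exists_not_comm {c : List ℕ} (hn : 2 ≤ n) (hc : IsTwistedCoxeterWord n c) {i : ℕ}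
    (hi : 1 ≤ i) (hi' : i ≤ n + 1) : ∃ a ∈ c, simpleRoot n a ⬝ᵥ simpleRoot n i ≠ 0 := by
  have h0 : 1 ≤ orb n i ∧ orb n i ≤ n := by
    unfold orb
    split_ifs <;> omega
  obtain ⟨r, hr, hr', hri⟩ : ∃ r, 1 ≤ r ∧ r ≤ n ∧ (r + 1 = orb n i ∨ orb n i + 1 = r) := by
    by_cases h1 : orb n i = 1
    · exact ⟨2, by omega, hn, by omega⟩
    · exact ⟨orb n i - 1, by omega, by omega, by omega⟩
  obtain ⟨a, ha, rfl⟩ := List.mem_map.1 ((mem_of_perm_range hc r).2 ⟨hr, hr'⟩)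
  have h1 := letter_le hc ha
  refine ⟨a, ha, ?_⟩
  have : Adj n a i := (adj_iff hn h1.1 h1.2).2 hri
  rw [this]
  decide

theorem mem_blocks {c : List ℕ} (hc : IsTwistedCoxeterWord n c) {m i : ℕ} (hi : i ∈ blocks n c m) :
    1 ≤ i ∧ i ≤ n + 1 := by
  obtain ⟨k, _, hk⟩ := List.mem_flatMap.1 hi
  exact letter_le (hc.map_vee k) hk

theorem blocks_succ' (n : ℕ) (c : List ℕ) (m : ℕ) : ∃ r, blocks n c (m + 1) = c ++ r := by
  induction m with
  | zero => exact ⟨[], by simp [blocks]⟩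
  | succ m ih =>
    obtain ⟨r, hr⟩ := ih
    exact ⟨r ++ c.map (vee n)^[m + 1], by rw [blocks_succ, hr, List.append_assoc]⟩

/-- The letter i can lead the twisted word, so it lies in the first block and commutes with the part
p of c before it. Then it can be brought to the front of c, in all blocks at once since ∨ preserves
commutation, and rotated to the end. -/
theorem IsTwistedCoxeterWordOf.right {i : ℕ} {u c : List ℕ} (hn : 2 ≤ n)
    (h : IsTwistedCoxeterWordOf n (i :: u) c) :
    ∃ c', IsTwistedCoxeterWordOf n (u ++ [(vee n)^[n + 1] i]) c' := by
  obtain ⟨hc, hw⟩ := h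
  obtain ⟨p, q, hpq, hp⟩ := hw.canLead_iff.1 (canLead_cons i u)
  rw [twistedWord_eq_blocks] at hpq
  have hi := mem_blocks hc (i := i) (by rw [hpq]; simp)
  obtain ⟨r, hr⟩ := blocks_succ' n c n
  rw [hr] at hpq
  rcases append_cons_of_append hpq with ⟨q', rfl⟩ | ⟨u', rfl, -⟩
  · refine ⟨p ++ q' ++ [vee n i], ?_, ?_⟩
    · refine List.Perm.trans ?_ hc
      simp only [List.map_append, List.map_cons, List.map_nil, orb_vee]
      rw [List.append_assoc]
      exact List.Perm.append_left _ (List.perm_append_singleton _ _)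
    · have h1 : CommEquiv n (twistedWord n (p ++ i :: q')) (twistedWord n (i :: (p ++ q'))) := by
        refine commEquiv_blocks (fun k => ?_) (n + 1)
        simp only [List.map_append, List.map_cons]
        apply commEquiv_move_front
        intro a ha
        obtain ⟨b, hb, rfl⟩ := List.mem_map.1 ha
        have := letter_le hc (a := b) (by simp [hb])
        exact comm_vee_iterate hn this.1 this.2 hi.1 hi.2 (hp b hb) k
      obtain ⟨R, hR⟩ := blocks_succ' n (i :: (p ++ q')) n
      have h2 := blocks_rotate n i (p ++ q') (n + 1)
      have h3 := hw.trans _ _ _ h1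
      rw [twistedWord_eq_blocks, hR] at h3
      rw [hR] at h2
      rw [twistedWord_eq_blocks, ← (List.cons.inj h2).2]
      exact (CommEquiv.of_cons h3).append_right _
  · obtain ⟨a, ha, h1⟩ := exists_not_comm hn hc hi.1 hi.2
    exact absurd (hp a (by simp [ha])) h1

theorem IsTwistedCoxeterWordOf.left {i : ℕ} {u c : List ℕ} (hn : 2 ≤ n)
    (h : IsTwistedCoxeterWordOf n (u ++ [i]) c) :
    ∃ c', IsTwistedCoxeterWordOf n ((vee n)^[n + 1] i :: u) c' := by
  obtain ⟨hc, hw⟩ := h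
  have hw' := hw.reverse
  rw [List.reverse_append] at hw'
  obtain ⟨q, p, hpq, hq⟩ := hw'.canLead_iff.1 (canLead_cons i u.reverse)
  have hpq' : blocks n c n ++ c.map (vee n)^[n] = p.reverse ++ i :: q.reverse := by
    rw [← blocks_succ, ← twistedWord_eq_blocks, ← List.reverse_reverse (twistedWord n c), hpq]
    simp
  have hi := mem_blocks hc (m := n + 1) (i := i) (by rw [blocks_succ, hpq']; simp)
  have hvv : ∀ j, (vee n)^[n] ((vee n)^[n] j) = j := fun j => by
    rw [← Function.iterate_add_apply, vee_iterate_even ⟨n, rfl⟩]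
  rcases append_cons_of_append hpq' with ⟨v, hv⟩ | ⟨p', -, hc'⟩
  · obtain ⟨a, ha, h1⟩ := exists_not_comm hn (hc.map_vee n) hi.1 hi.2
    rw [hv, List.append_assoc, List.cons_append] at hpq'
    have h2 := (List.cons.inj (List.append_cancel_left hpq')).2
    have h3 : a ∈ q.reverse := by rw [← h2]; simp [ha]
    exact absurd (hq a (by simpa using h3)) h1
  -- The letter i lies in the last block, which is c with ∨^n applied; this block is pulled back to
  -- c by the involution ∨^n.
  · obtain ⟨d, rfl⟩ : ∃ d, i = (vee n)^[n] d := ⟨_, (hvv i).symm⟩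
    obtain ⟨p₀, hp₀⟩ : ∃ p₀ : List ℕ, p' = p₀.map (vee n)^[n] :=
      ⟨p'.map (vee n)^[n], by rw [List.map_map]; simp [Function.comp_def, hvv]⟩
    obtain ⟨q₀, hq₀⟩ : ∃ q₀ : List ℕ, q.reverse = q₀.map (vee n)^[n] :=
      ⟨q.reverse.map (vee n)^[n], by rw [List.map_map]; simp [Function.comp_def, hvv]⟩
    obtain rfl : c = p₀ ++ d :: q₀ := by
      have hinj : Function.Injective (vee n)^[n] :=
        (show Function.Involutive (vee n) from vee_vee n).injective.iterate n
      apply hinj.list_map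
      rw [hc', hp₀, hq₀]
      simp
    have hd := letter_le hc (a := d) (by simp)
    have hq' : ∀ a ∈ q₀, simpleRoot n a ⬝ᵥ simpleRoot n d = 0 := by
      intro a ha
      have h1 : (vee n)^[n] a ∈ q := by
        rw [← List.mem_reverse, hq₀]
        exact List.mem_map_of_mem ha
      have h2 := letter_le hc (a := a) (by simp [ha])
      have h3 := vee_iterate_mem (by omega) h2.1 h2.2 n
      have := comm_vee_iterate hn h3.1 h3.2 hi.1 hi.2 (hq _ h1) n
      rwa [hvv, hvv] at this
    refine ⟨vee n d :: (p₀ ++ q₀), ?_, ?_⟩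
    · refine List.Perm.trans ?_ hc
      simp only [List.map_append, List.map_cons, orb_vee]
      exact List.perm_middle.symm
    · have h1 : CommEquiv n (twistedWord n (p₀ ++ d :: q₀)) (twistedWord n (p₀ ++ q₀ ++ [d])) := by
        refine commEquiv_blocks (fun k => ?_) (n + 1)
        simp only [List.map_append, List.map_cons, List.map_nil]
        apply commEquiv_move_back
        intro a ha
        obtain ⟨b, hb, rfl⟩ := List.mem_map.1 ha
        have := letter_le hc (a := b) (by simp [hb])
        exact comm_vee_iterate hn this.1 this.2 hd.1 hd.2 (hq' b hb) k
      have h2 := blocks_rotate n (vee n d) (p₀ ++ q₀) (n + 1)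
      rw [vee_vee] at h2
      obtain ⟨R, hR⟩ := blocks_succ' n (vee n d :: (p₀ ++ q₀)) n
      have h3 := hw.trans _ _ _ h1
      have h4 : (vee n)^[n + 1] (vee n d) = (vee n)^[n] d := by
        rw [Function.iterate_succ_apply, vee_vee]
      have h5 : (vee n)^[n + 1] ((vee n)^[n] d) = vee n d := by
        rw [Function.iterate_succ_apply', hvv]
      rw [hR, h4] at h2
      rw [twistedWord_eq_blocks, ← (List.cons.inj h2).2] at h3
      rw [h5, twistedWord_eq_blocks, hR]
      exact (CommEquiv.of_append_singleton h3).append_left [vee n d]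

/-- The form ∏ c^{k∨} is preserved by commutations and, with a rotated c, by both reflection
functors. -/
theorem exists_isTwistedCoxeterWordOf {w : List ℕ} (hn : 2 ≤ n) (hw : IsTwistedAdapted n w) :
    ∃ c, IsTwistedCoxeterWordOf n w c := by
  induction hw with
  | refl =>
    refine ⟨List.range' 1 n, ?_, .refl _⟩
    rw [IsTwistedCoxeterWord, map_orb_of_le]
    intro i hi
    rw [List.mem_range'_1] at hi
    omega
  | tail _ h ih =>
    obtain ⟨c, hc⟩ := ih
    -- The index prescribed by w_0 in a reflection functor is ∨^{n+1}(i), the letter produced by the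
    -- rotation.
    have hact : ∀ {w i j}, IsTwistedCoxeterWordOf n w c → i ∈ w → 1 ≤ j ∧ j ≤ n + 1 →
        act n w (simpleRoot n i) = -simpleRoot n j → j = (vee n)^[n + 1] i := by
      intro w i j hc hi hj hs
      have hi' : 1 ≤ i ∧ i ≤ n + 1 := by
        have h1 := hc.2.perm.mem_iff.1 hi
        exact mem_blocks hc.1 h1
      have h1 := vee_iterate_mem (by omega) hi'.1 hi'.2 (n + 1)
      rw [hc.2.act_eq, act_twistedWord (by omega) hc.1 hi'.1 hi'.2] at hs
      exact (simpleRoot_injective h1.1 h1.2 hj.2 (by omega) (neg_injective hs)).symm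
    rcases h with h | h
    · exact ⟨c, hc.1, (h.symm).trans _ _ _ hc.2⟩
    · cases h with
      | right i j u _ hj hs =>
        rw [hact hc (by simp) hj hs]
        exact hc.right hn
      | left i j u _ hj hs =>
        rw [hact hc (by simp) hj hs]
        exact hc.left hn

end

/-! ### The upside-down symmetry of type `A` -/

/-- The lattice automorphism `-w₀` of type `A_n`, which exchanges `α_i` and `α_{n+1-i}`. -/
def flipLat (n : ℕ) (v : Lat n) : Lat n := fun k => -v k.rev

theorem flipLat_sub (n : ℕ) (v w : Lat n) : flipLat n (v - w) = flipLat n v - flipLat n w := by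
  funext k
  simp [flipLat]
  ring

theorem flipLat_smul (n : ℕ) (s : ℤ) (v : Lat n) : flipLat n (s • v) = s • flipLat n v := by
  funext k
  simp [flipLat]

theorem flipLat_dot (n : ℕ) (v w : Lat n) : flipLat n v ⬝ᵥ flipLat n w = v ⬝ᵥ w := by
  simp only [dotProduct, flipLat, neg_mul_neg]
  exact Equiv.sum_comp Fin.revPerm (fun k => v k * w k)

theorem flipLat_eps {n i : ℕ} (hi' : i ≤ n + 1) :
    flipLat n (eps n i) = -eps n (n + 2 - i) := by
  funext k
  simp only [flipLat, eps, Pi.neg_apply, Fin.val_rev]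
  congr 1
  have := k.isLt
  split_ifs <;> omega

theorem flipLat_rootA {n a b : ℕ} (hab : a ≤ b) (hb : b ≤ n) :
    flipLat n (rootA n a b) = rootA n (n + 1 - b) (n + 1 - a) := by
  rw [rootA, flipLat_sub, flipLat_eps (by omega), flipLat_eps (by omega), rootA,
    show n + 2 - (b + 1) = n + 1 - b by omega, show n + 2 - a = n + 1 - a + 1 by omega]
  abel

theorem flipLat_simpleRoot {n i : ℕ} (hi : 1 ≤ i) (hi' : i ≤ n) :
    flipLat n (simpleRoot n i) = simpleRoot n (n + 1 - i) := by
  rw [simpleRoot_of_le hi', simpleRoot_of_le (by omega)]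
  exact flipLat_rootA le_rfl hi'

theorem refl_flipLat {n i : ℕ} (hi : 1 ≤ i) (hi' : i ≤ n) (v : Lat n) :
    refl n (n + 1 - i) (flipLat n v) = flipLat n (refl n i v) := by
  rw [refl, ← flipLat_simpleRoot hi hi', flipLat_dot, refl, flipLat_sub, flipLat_smul]

theorem act_flipLat {n : ℕ} {r : List ℕ} (hr : ∀ i ∈ r, 1 ≤ i ∧ i ≤ n) (v : Lat n) :
    act n (r.map fun i => n + 1 - i) (flipLat n v) = flipLat n (act n r v) := by
  induction r with
  | nil => rfl
  | cons i r ih =>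
    have hi := hr i (by simp)
    rw [List.map_cons, act, ih (fun j hj => hr j (by simp [hj])), refl_flipLat hi.1 hi.2]
    rfl

theorem IsPosRootA.flipLat {n : ℕ} {β : Lat n} (h : IsPosRootA n β) :
    IsPosRootA n (flipLat n β) := by
  obtain ⟨a, b, ha, hab, hb, rfl⟩ := h
  exact ⟨n + 1 - b, n + 1 - a, by omega, by omega, by omega, flipLat_rootA hab hb⟩

theorem ARLabel.flip {n : ℕ} {r : List ℕ} (hr : ∀ i ∈ r, 1 ≤ i ∧ i ≤ n) {ξ η : ℕ → ℤ} {s : ℤ}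
    (hη : ∀ i, 1 ≤ i → i ≤ n → η (n + 1 - i) = ξ i + s) {z : ℕ × ℤ} {β : Lat n}
    (h : ARLabel n r ξ z β) :
    ARLabel n (r.map fun i => n + 1 - i) η (n + 1 - z.1, z.2 + s) (flipLat n β) := by
  induction h with
  | init u v i h =>
    have hi := hr i (by simp [h])
    have := ARLabel.init (n := n) (ξ := η) (u.map fun i => n + 1 - i) (v.map fun i => n + 1 - i)
      (n + 1 - i) (c := r.map fun i => n + 1 - i) (by simp [h])
    rwa [hη i hi.1 hi.2, ← flipLat_simpleRoot hi.1 hi.2,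
      act_flipLat fun j hj => hr j (by simp [h, hj])] at this
  | next i p β h hβ hφ ih =>
    have := ARLabel.next _ _ _ ih hβ.flipLat (by rw [act_flipLat hr]; exact hφ.flipLat)
    rw [act_flipLat hr] at this
    convert this using 2
    ring

theorem starQuiver_starQuiver {n : ℕ} {Q : ℕ → ℕ → Prop} (hQ : IsDynkinQuiverA n Q) :
    starQuiver n (starQuiver n Q) = Q := by
  funext i j
  rw [eq_iff_iff]
  constructor
  · rintro ⟨h1, h2, h3, h4, h⟩
    rwa [show n + 1 - (n + 1 - i) = i by omega, show n + 1 - (n + 1 - j) = j by omega] at h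
  · intro h
    have := hQ.1 i j h
    refine ⟨by omega, by omega, by omega, by omega, ?_⟩
    rwa [show n + 1 - (n + 1 - i) = i by omega, show n + 1 - (n + 1 - j) = j by omega]

theorem IsSink.star {n i : ℕ} {Q : ℕ → ℕ → Prop} (hi' : i ≤ n) (h : IsSink Q i) :
    IsSink (starQuiver n Q) (n + 1 - i) := by
  rintro j ⟨_, _, h3⟩
  rw [show n + 1 - (n + 1 - i) = i by omega] at h3
  exact h _ h3

theorem IsAdapted.star {n : ℕ} {Q : ℕ → ℕ → Prop} {r : List ℕ} (hr : ∀ i ∈ r, 1 ≤ i ∧ i ≤ n)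
    (h : IsAdapted Q r) : IsAdapted (starQuiver n Q) (r.map fun i => n + 1 - i) := by
  induction r generalizing Q with
  | nil => trivial
  | cons i r ih =>
    obtain ⟨h1, h2⟩ := h
    have hi := hr i (by simp)
    refine ⟨h1.star hi.2, ?_⟩
    convert ih (fun j hj => hr j (by simp [hj])) h2 using 1
    funext a b
    rw [eq_iff_iff, reflQuiver_of_isSink (h1.star hi.2)]
    unfold starQuiver
    rw [reflQuiver_of_isSink h1]
    by_cases hab : a ≤ n ∧ b ≤ n
    · have e : (a = n + 1 - i ∨ b = n + 1 - i) ↔ (n + 1 - a = i ∨ n + 1 - b = i) := by omega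
      simp only [e]
      split_ifs <;> tauto
    · split_ifs <;> tauto

theorem IsCoxeterWordOf.star {n : ℕ} {Q : ℕ → ℕ → Prop} {r : List ℕ} (h : IsCoxeterWordOf n Q r) :
    IsCoxeterWordOf n (starQuiver n Q) (r.map fun i => n + 1 - i) := by
  refine ⟨?_, h.2.star fun i => (mem_of_perm_range h.1 i).1⟩
  refine (h.1.map _).trans ?_
  rw [List.perm_ext_iff_of_nodup]
  · intro a
    simp only [List.mem_map, List.mem_range'_1]
    constructor
    · rintro ⟨b, hb, rfl⟩
      omega
    · intro ha
      exact ⟨n + 1 - a, by omega, by omega⟩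
  · refine List.Nodup.map_on ?_ List.nodup_range'
    intro a ha b hb
    rw [List.mem_range'_1] at ha hb
    omega
  · exact List.nodup_range'

/-- The diagram automorphism i ↦ n + 1 - i turns Γ_Q into Γ_{Q^*} and applies -w_0 to the labels.
The upside-down copy keeps the old labels, so only the vertices are compared. -/
theorem upsideDown_verts {n : ℕ} {Q : ℕ → ℕ → Prop} (hQ : IsDynkinQuiverA n Q) (ξ : ℕ → ℤ) :
    (upsideDown n (ARQuiver n Q ξ)).verts =
      (ARQuiver n (starQuiver n Q) fun i => ξ (n + 1 - i) - (n + 1)).verts := by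
  ext ⟨j, q⟩
  constructor
  · rintro ⟨β, i, p, ⟨r, hr, h⟩, hij, hq⟩
    have := h.flip (fun i => (mem_of_perm_range hr.1 i).1)
      (η := fun i => ξ (n + 1 - i) - (n + 1)) (s := -(n + 1)) (fun i hi hi' => by
        rw [show n + 1 - (n + 1 - i) = i by omega]; ring)
    refine ⟨flipLat n β, _, hr.star, ?_⟩
    convert this using 2
    · simp only at hij ⊢; omega
    · simp only at hq ⊢; omega
  · rintro ⟨β, r, hr, h⟩
    have hmem := fun i => (mem_of_perm_range hr.1 i).1
    have h1 := h.flip hmem (η := ξ) (s := n + 1) (fun i hi hi' => by ring)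
    have h2 := hr.star
    rw [starQuiver_starQuiver hQ] at h2
    have hj : 1 ≤ j ∧ j ≤ n := by
      generalize hz : (j, q) = z at h
      clear h1
      induction h generalizing q with
      | init u v i h =>
        obtain ⟨rfl, rfl⟩ : j = i ∧ q = _ := by simpa using hz
        exact hmem j (by simp [h])
      | next i p β h _ _ ih =>
        obtain ⟨rfl, rfl⟩ : j = i ∧ q = _ := by simpa using hz
        exact ih p rfl
    exact ⟨_, _, _, ⟨_, h2, h1⟩, by simp only; omega, by simp only; ring⟩

/-! ### Labels of the two copies of the quiver of type `A` -/

section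
variable {n : ℕ} {Q : ℕ → ℕ → Prop} {ξ : ℕ → ℤ} {r : List ℕ} (hn : 1 ≤ n)
  (hQ : IsDynkinQuiverA n Q) (hξ : IsHeightFunction Q ξ) (hr : IsCoxeterWordOf n Q r)
include hn hQ hξ hr

theorem ARQuiver_label_iff (i : ℕ) (p : ℤ) (β : Lat n) :
    (ARQuiver n Q ξ).label (i, p) β ↔ 1 ≤ i ∧ i ≤ n ∧ ∃ t : ℕ, t ≤ n ∧ p = ξ i - 2 * t ∧
      lvl n (prof n ξ) (prof n ξ i + t) < lvl n (prof n ξ) (prof n ξ i + t + i) ∧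
      β = eps n (lvl n (prof n ξ) (prof n ξ i + t)) -
        eps n (lvl n (prof n ξ) (prof n ξ i + t + i)) := by
  constructor
  · rintro ⟨r', hr', h⟩
    exact (ARLabel_iff hn hQ hξ hr' i p β).1 h
  · intro h
    exact ⟨r, hr, (ARLabel_iff hn hQ hξ hr i p β).2 h⟩

/-- Turning upside down and shifting by n + 1 replaces an interval [k, k + j] by [k + j, k + n + 1].
The old right end becomes the left end, and the new right end is the old left end one period later,
with the same level. -/
theorem upsideDown_label_iff (i : ℕ) (p : ℤ) (β : Lat n) :
    (upsideDown n (ARQuiver n Q ξ)).label (i, p) β ↔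
      1 ≤ i ∧ i ≤ n ∧ ∃ t : ℕ, t ≤ n ∧ p = ξ i - 2 * t ∧
      lvl n (prof n ξ) (prof n ξ i + t + i) < lvl n (prof n ξ) (prof n ξ i + t) ∧
      β = eps n (lvl n (prof n ξ) (prof n ξ i + t + i)) -
        eps n (lvl n (prof n ξ) (prof n ξ i + t)) := by
  have hx := isProfile_prof hQ hξ
  have hX := ARQuiver_label_iff hn hQ hξ hr
  have h2 := fun i => two_mul_prof (i := i) hQ hξ
  generalize prof n ξ = x at *
  constructor
  · rintro ⟨j, q, h, hij, hq⟩
    simp only at hij hq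
    obtain ⟨hj, hj', t, ht, rfl, hlt, rfl⟩ := (hX _ _ _).1 h
    have hi' : i ≤ n := by omega
    rcases Nat.eq_zero_or_pos i with rfl | hi
    · omega
    have b1 := hx.le_of_lvl_gt hn hj hi (by omega) (k := x j + t) (by omega) hlt
    have b2 := hx.mono le_rfl hi (by omega)
    have b3 := hx.mono le_rfl hj (by omega)
    have e1 := h2 i hi hi'
    have e2 := h2 j hj hj'
    -- The truncation is harmless: by nesting x i ≤ x 1 < x j + j.
    have e3 : x i + ((x j + t + j - x i).toNat : ℤ) = x j + t + j := by omega
    have e4 : x j + t + j + i = x j + t + (n + 1) := by omega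
    refine ⟨hi, hi', (x j + t + j - x i).toNat, by omega, by omega, ?_, ?_⟩
    · rwa [e3, e4, lvl_add_period]
    · rw [e3, e4, lvl_add_period]
  · rintro ⟨hi, hi', t, ht, rfl, hlt, rfl⟩
    have hij : i + (n + 1 - i) = n + 1 := by omega
    have hj : 1 ≤ n + 1 - i := by omega
    generalize n + 1 - i = j at hij hj
    have b1 := hx.le_of_lvl_lt hn hi hj hij (k := x i + t) (by omega) hlt
    have b2 := hx.mono le_rfl hi (by omega)
    have b3 := hx.mono le_rfl hj (by omega)
    have e1 := h2 i hi hi'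
    have e2 := h2 j hj (by omega)
    have e3 : x j + ((x i + t - j - x j).toNat : ℤ) = x i + t - j := by omega
    have e4 : lvl n x (x i + t - j) = lvl n x (x i + t + i) := by
      rw [← lvl_add_period]; congr 1; omega
    refine ⟨j, ξ j - 2 * (x i + t - j - x j).toNat, (hX _ _ _).2 ⟨hj, by omega, _, ?_, rfl, ?_, ?_⟩,
      hij, ?_⟩
    · omega
    · rwa [e3, sub_add_cancel, e4]
    · rw [e3, sub_add_cancel, e4]
    · simp only
      omega

end

/-! ### Sectional paths -/

theorem eq_map_iterate_of_isChain {α : Type*} {g : α → α} {R : α → α → Prop}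
    (hR : ∀ x y, R x y → y = g x) (a : α) (l : List α) (h : (a :: l).IsChain R) :
    a :: l = (List.range (l.length + 1)).map fun k => g^[k] a := by
  induction l generalizing a with
  | nil => rfl
  | cons b l ih =>
    rw [List.isChain_cons_cons] at h
    obtain rfl := hR _ _ h.1
    rw [List.length_cons, ih _ h.2, List.range_succ_eq_map (n := l.length + 1), List.map_cons,
      List.map_map]
    rfl

theorem isChain_map_range {α : Type*} {R : α → α → Prop} {f : ℕ → α} {m : ℕ}
    (h : ∀ k, k + 1 < m → R (f k) (f (k + 1))) : ((List.range m).map f).IsChain R := by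
  rw [List.isChain_iff_getElem]
  intro i hi
  simp only [List.length_map, List.length_range] at hi
  simpa using h i hi

/-- The list of points on the `S`-sectional path of length `n - 1` whose vertex in row `i` has
position `m + i`. -/
def sPath (n : ℕ) (m : ℤ) : List (ℕ × ℤ) := (List.range n).map fun k => (1 + k, m + 1 + k)

/-- The list of points on the `N`-sectional path of length `n - 1` whose vertex in row `i` has
position `m - i`. -/
def nPath (n : ℕ) (m : ℤ) : List (ℕ × ℤ) := (List.range n).map fun k => (n - k, m - n + k)

theorem mem_sPath {n : ℕ} {m : ℤ} {i : ℕ} {p : ℤ} :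
    (i, p) ∈ sPath n m ↔ 1 ≤ i ∧ i ≤ n ∧ p = m + i := by
  simp only [sPath, List.mem_map, List.mem_range, Prod.mk.injEq]
  constructor
  · rintro ⟨k, hk, rfl, rfl⟩
    exact ⟨by omega, by omega, by push_cast; ring⟩
  · rintro ⟨h1, h2, rfl⟩
    exact ⟨i - 1, by omega, by omega, by omega⟩

theorem mem_nPath {n : ℕ} {m : ℤ} {i : ℕ} {p : ℤ} :
    (i, p) ∈ nPath n m ↔ 1 ≤ i ∧ i ≤ n ∧ p = m - i := by
  simp only [nPath, List.mem_map, List.mem_range, Prod.mk.injEq]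
  constructor
  · rintro ⟨k, hk, rfl, rfl⟩
    exact ⟨by omega, by omega, by omega⟩
  · rintro ⟨h1, h2, rfl⟩
    exact ⟨n - i, by omega, by omega, by omega⟩

/-- A path with n vertices that descends one row at a time within rows 1, …, n must start in row 1,
so only its position is free. -/
theorem eq_sPath {n : ℕ} (hn : 1 ≤ n) {L : ℕ × ℤ → Lat n → Prop} {l : List (ℕ × ℤ)}
    (h : IsSPath (CoordQuiver.ofLabels L) l) (hl : l.length = n)
    (hrow : ∀ x ∈ l, 1 ≤ x.1 ∧ x.1 ≤ n) : ∃ m, l = sPath n m := by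
  obtain ⟨h1, -, h3⟩ := h
  obtain ⟨⟨i, p⟩, l, rfl⟩ := List.exists_cons_of_ne_nil h1
  have h4 := eq_map_iterate_of_isChain (g := fun x : ℕ × ℤ => (x.1 + 1, x.2 + 1)) (by
    rintro ⟨i, p⟩ ⟨j, q⟩ ⟨⟨-, -, h, h'⟩, h''⟩
    simp only at h h' h''
    ext <;> simp only <;> omega) _ _ h3
  have h5 : ∀ k, (fun x : ℕ × ℤ => (x.1 + 1, x.2 + 1))^[k] (i, p) = (i + k, p + k) := by
    intro k
    induction k with
    | zero => simp
    | succ k ih =>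
      rw [Function.iterate_succ_apply', ih]
      push_cast
      ext <;> simp only <;> ring
  simp only [h5] at h4
  rw [List.length_cons] at hl
  rw [hl] at h4
  have h6 := hrow (i, p) (by simp)
  have h7 := hrow (i + (n - 1 : ℕ), p + (n - 1 : ℕ)) (by
    rw [h4]
    exact List.mem_map.2 ⟨n - 1, by rw [List.mem_range]; omega, rfl⟩)
  simp only at h6 h7
  obtain rfl : i = 1 := by omega
  refine ⟨p - 1, ?_⟩
  rw [h4, sPath]
  simp

theorem eq_nPath {n : ℕ} (hn : 1 ≤ n) {L : ℕ × ℤ → Lat n → Prop} {l : List (ℕ × ℤ)}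
    (h : IsNPath (CoordQuiver.ofLabels L) l) (hl : l.length = n)
    (hrow : ∀ x ∈ l, 1 ≤ x.1 ∧ x.1 ≤ n) : ∃ m, l = nPath n m := by
  obtain ⟨h1, -, h3⟩ := h
  obtain ⟨⟨i, p⟩, l, rfl⟩ := List.exists_cons_of_ne_nil h1
  have h4 := eq_map_iterate_of_isChain (g := fun x : ℕ × ℤ => (x.1 - 1, x.2 + 1)) (by
    rintro ⟨i, p⟩ ⟨j, q⟩ ⟨⟨-, -, h, h'⟩, h''⟩
    simp only at h h' h''
    ext <;> simp only <;> omega) _ _ h3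
  have h5 : ∀ k, (fun x : ℕ × ℤ => (x.1 - 1, x.2 + 1))^[k] (i, p) = (i - k, p + k) := by
    intro k
    induction k with
    | zero => simp
    | succ k ih =>
      rw [Function.iterate_succ_apply', ih]
      push_cast
      ext <;> simp only
      · omega
      · ring
  simp only [h5] at h4
  rw [List.length_cons] at hl
  rw [hl] at h4
  have h6 := hrow (i, p) (by simp)
  have h7 := hrow (i - (n - 1 : ℕ), p + (n - 1 : ℕ)) (by
    rw [h4]
    exact List.mem_map.2 ⟨n - 1, by rw [List.mem_range]; omega, rfl⟩)
  simp only at h6 h7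
  obtain rfl : i = n := by omega
  refine ⟨p + i, ?_⟩
  rw [h4, nPath]
  simp

section
variable {n : ℕ} {Q : ℕ → ℕ → Prop} {ξ : ℕ → ℤ} {r : List ℕ} (hn : 1 ≤ n)
  (hQ : IsDynkinQuiverA n Q) (hξ : IsHeightFunction Q ξ) (hr : IsCoxeterWordOf n Q r)
include hn hQ hξ hr

/-- All intervals of the path share a right end K, and being vertices of type A they give lvl (K -
i) < lvl K for i = 1, …, n. These points and K fill a period, so K has the maximal level n + 1. -/
theorem isSPath_iff (l : List (ℕ × ℤ)) :
    IsSPath (ARQuiver n Q ξ) l ∧ l.length = n ↔ l = sPath n (ξ n - n) := by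
  have hx := isProfile_prof hQ hξ
  have hX := ARQuiver_label_iff hn hQ hξ hr
  have h2 := fun i => two_mul_prof (i := i) hQ hξ
  generalize prof n ξ = x at *
  have h21 := h2 1 le_rfl hn
  have h2n := h2 n hn le_rfl
  have hmono := hx.mono le_rfl hn (by omega)
  push_cast at h21
  constructor
  · rintro ⟨h, hl⟩
    have hv := h.2.1
    obtain ⟨m, rfl⟩ := eq_sPath hn h hl (by
      rintro ⟨i, p⟩ hx
      obtain ⟨β, hβ⟩ := hv _ hx
      have := (hX _ _ _).1 hβ
      exact ⟨this.1, this.2.1⟩)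
    have key : ∀ i, 1 ≤ i → i ≤ n → ∃ t : ℕ, t ≤ n ∧ m + i = ξ i - 2 * t ∧
        lvl n x (x i + t) < lvl n x (x i + t + i) := by
      intro i hi hi'
      obtain ⟨β, hβ⟩ := hv _ (mem_sPath.2 ⟨hi, hi', rfl⟩)
      obtain ⟨-, -, t, ht, h1, h2, -⟩ := (hX _ _ _).1 hβ
      exact ⟨t, ht, h1, h2⟩
    obtain ⟨t, ht, hm, hlt⟩ := key 1 le_rfl hn
    have hlt' : ∀ i : ℕ, 1 ≤ i → i ≤ n → lvl n x (x 1 + t + 1 - i) < lvl n x (x 1 + t + 1) := by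
      intro i hi hi'
      obtain ⟨s, hs, hms, hlts⟩ := key i hi hi'
      have e1 := h2 i hi hi'
      push_cast at hm
      have e2 : x i + s = x 1 + t + 1 - i := by omega
      rwa [e2, sub_add_cancel] at hlts
    have hlast : lvl n x (x 1 + t + 1) = lvl n x (x n + n) := by
      have hnn := Int.emod_nonneg (x 1 + t + 1 - (x n + n)) (b := (n : ℤ) + 1) (by omega)
      have hlt2 := Int.emod_lt_of_pos (x 1 + t + 1 - (x n + n)) (b := (n : ℤ) + 1) (by omega)
      have hdiv := Int.emod_add_mul_ediv (x 1 + t + 1 - (x n + n)) ((n : ℤ) + 1)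
      generalize (x 1 + t + 1 - (x n + n)) % ((n : ℤ) + 1) = d at *
      generalize (x 1 + t + 1 - (x n + n)) / ((n : ℤ) + 1) = b at *
      obtain ⟨e, rfl⟩ := Int.eq_ofNat_of_zero_le hnn
      have h3 : lvl n x (x n + n) = lvl n x (x 1 + t + 1 - e) :=
        hx.lvl_eq_iff.2 ⟨b, by linarith⟩
      -- Here e is the distance from K = x 1 + t + 1 back to the nearest point of level n + 1. If e
      -- > 0, that level would be less than lvl K.
      rcases Nat.eq_zero_or_pos e with rfl | he
      · simpa using h3.symm
      · have h4 := hlt' e he (by omega)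
        have h5 := hx.lvl_le (x 1 + t + 1)
        rw [← h3, hx.lvl_last hn] at h4
        omega
    have : x 1 + t + 1 = x n + n := by
      rcases lt_trichotomy (x 1 + t + 1) (x n + n) with h3 | h3 | h3
      · exact absurd hlast (hx.lvl_ne h3 (by omega))
      · exact h3
      · exact absurd hlast.symm (hx.lvl_ne h3 (by omega))
    congr 1
    push_cast at hm
    omega
  · rintro rfl
    have hv : ∀ z ∈ sPath n (ξ n - n), z ∈ (ARQuiver n Q ξ).verts := by
      rintro ⟨i, p⟩ hz
      obtain ⟨hi, hi', rfl⟩ := mem_sPath.1 hz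
      have e1 := h2 i hi hi'
      have e2 := hx.mono hi hi' (by omega)
      have e3 : x i + ((x n + n - i - x i).toNat : ℤ) = x n + n - i := by omega
      refine ⟨_, (hX _ _ _).2 ⟨hi, hi', (x n + n - i - x i).toNat, by omega, by omega, ?_, rfl⟩⟩
      rw [e3, sub_add_cancel]
      have := hx.lvl_ne (k := x n + n - i) (l := x n + n) (by omega) (by omega)
      have h3 := hx.lvl_le (x n + n - i)
      rw [hx.lvl_last hn] at this ⊢
      omega
    refine ⟨⟨?_, hv, ?_⟩, by simp [sPath]⟩
    · intro h
      have := congrArg List.length h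
      simp [sPath] at this
      omega
    · refine isChain_map_range fun k hk => ⟨⟨?_, ?_, ?_, ?_⟩, ?_⟩
      · exact hv _ (mem_sPath.2 ⟨by omega, by omega, by push_cast; ring⟩)
      · exact hv _ (mem_sPath.2 ⟨by omega, by omega, by push_cast; ring⟩)
      · left; rfl
      · simp only; push_cast; ring
      · simp only; omega

/-- All intervals share the left end x n + t. If t < n, the one in row n - t would have right end x
n + n, whose level n + 1 cannot be smaller than that of its left end. -/
theorem isNPath_iff (l : List (ℕ × ℤ)) :
    IsNPath (upsideDown n (ARQuiver n Q ξ)) l ∧ l.length = n ↔ l = nPath n (ξ n - n) := by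
  have hx := isProfile_prof hQ hξ
  have hX := upsideDown_label_iff hn hQ hξ hr
  have h2 := fun i => two_mul_prof (i := i) hQ hξ
  generalize prof n ξ = x at *
  have h2n := h2 n hn le_rfl
  constructor
  · rintro ⟨h, hl⟩
    have hv := h.2.1
    obtain ⟨m, rfl⟩ := eq_nPath hn h hl (by
      rintro ⟨i, p⟩ hx
      obtain ⟨β, hβ⟩ := hv _ hx
      have := (hX _ _ _).1 hβ
      exact ⟨this.1, this.2.1⟩)
    have key : ∀ i, 1 ≤ i → i ≤ n → ∃ t : ℕ, t ≤ n ∧ m - i = ξ i - 2 * t ∧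
        lvl n x (x i + t + i) < lvl n x (x i + t) := by
      intro i hi hi'
      obtain ⟨β, hβ⟩ := hv _ (mem_nPath.2 ⟨hi, hi', rfl⟩)
      obtain ⟨-, -, t, ht, h1, h2, -⟩ := (hX _ _ _).1 hβ
      exact ⟨t, ht, h1, h2⟩
    obtain ⟨t, ht, hm, hlt⟩ := key n hn le_rfl
    have htn : (t : ℤ) = n := by
      by_contra hne
      obtain ⟨s, hs, hms, hlts⟩ := key (n - t) (by omega) (by omega)
      have e1 := h2 (n - t) (by omega) (by omega)
      have e2 : x (n - t) + s = x n + t := by omega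
      rw [e2, show x n + t + (n - t : ℕ) = x n + n by omega, hx.lvl_last hn] at hlts
      have := hx.lvl_le (x n + t)
      omega
    congr 1
    omega
  · rintro rfl
    have hv : ∀ z ∈ nPath n (ξ n - n), z ∈ (upsideDown n (ARQuiver n Q ξ)).verts := by
      rintro ⟨i, p⟩ hz
      obtain ⟨hi, hi', rfl⟩ := mem_nPath.1 hz
      have e1 := h2 i hi hi'
      have e2 := hx.mono hi hi' (by omega)
      have e3 : x i + ((x n + n - x i).toNat : ℤ) = x n + n := by omega
      refine ⟨_, (hX _ _ _).2 ⟨hi, hi', (x n + n - x i).toNat, by omega, by omega, ?_, rfl⟩⟩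
      rw [e3]
      have := hx.lvl_ne (k := x n + n) (l := x n + n + i) (by omega) (by omega)
      have h3 := hx.lvl_le (x n + n + i)
      rw [hx.lvl_last hn] at this ⊢
      omega
    refine ⟨⟨?_, hv, ?_⟩, by simp [nPath]⟩
    · intro h
      have := congrArg List.length h
      simp [nPath] at this
      omega
    · refine isChain_map_range fun k hk => ⟨⟨?_, ?_, ?_, ?_⟩, ?_⟩
      · exact hv _ (mem_nPath.2 ⟨by omega, by omega, by omega⟩)
      · exact hv _ (mem_nPath.2 ⟨by omega, by omega, by omega⟩)
      · simp only; omega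
      · simp only; push_cast; ring
      · simp only; omega

/-- Along ρ the right end has level n + 1, while the left end runs through the other points of the
window, hence through all levels 1, …, n. -/
theorem sPath_labels :
    {β | ∃ z ∈ sPath n (ξ n - n), (ARQuiver n Q ξ).label z β} =
      {β | ∃ i, 1 ≤ i ∧ i ≤ n ∧ β = rootA n i n} := by
  have hx := isProfile_prof hQ hξ
  have hX := ARQuiver_label_iff hn hQ hξ hr
  have h2 := fun i => two_mul_prof (i := i) hQ hξ
  generalize prof n ξ = x at *
  have h2n := h2 n hn le_rfl
  ext β
  constructor
  · rintro ⟨⟨i, p⟩, hz, hβ⟩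
    obtain ⟨hi, hi', rfl⟩ := mem_sPath.1 hz
    obtain ⟨-, -, t, ht, h1, hlt, rfl⟩ := (hX _ _ _).1 hβ
    have e1 := h2 i hi hi'
    rw [show x i + t + i = x n + n by omega, hx.lvl_last hn] at hlt ⊢
    exact ⟨_, hx.lvl_pos _, by omega, rfl⟩
  · rintro ⟨j, hj, hj', rfl⟩
    obtain ⟨k, hk, hk', rfl⟩ := hx.exists_lvl hn hj (by omega)
    have hk2 : k ≠ x n + n := by
      rintro rfl
      rw [hx.lvl_last hn] at hj'
      omega
    obtain ⟨i, hi⟩ := Int.eq_ofNat_of_zero_le (a := x n + n - k) (by omega)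
    have e1 := h2 i (by omega) (by omega)
    have e2 := hx.mono (i := i) (by omega) (show i ≤ n by omega) (by omega)
    have e3 : x i + ((x n + n - i - x i).toNat : ℤ) = k := by omega
    refine ⟨(i, ξ n - n + i), mem_sPath.2 ⟨by omega, by omega, rfl⟩, (hX _ _ _).2
      ⟨by omega, by omega, (x n + n - i - x i).toNat, by omega, by omega, ?_, ?_⟩⟩
    · rw [e3, show k + i = x n + n by omega, hx.lvl_last hn]
      omega
    · rw [e3, show k + i = x n + n by omega, hx.lvl_last hn]
      rfl

theorem nPath_labels :
    {β | ∃ z ∈ nPath n (ξ n - n), (upsideDown n (ARQuiver n Q ξ)).label z β} =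
      {β | ∃ i, 1 ≤ i ∧ i ≤ n ∧ β = rootA n i n} := by
  have hx := isProfile_prof hQ hξ
  have hX := upsideDown_label_iff hn hQ hξ hr
  have h2 := fun i => two_mul_prof (i := i) hQ hξ
  generalize prof n ξ = x at *
  have h2n := h2 n hn le_rfl
  ext β
  constructor
  · rintro ⟨⟨i, p⟩, hz, hβ⟩
    obtain ⟨hi, hi', rfl⟩ := mem_nPath.1 hz
    obtain ⟨-, -, t, ht, h1, hlt, rfl⟩ := (hX _ _ _).1 hβ
    have e1 := h2 i hi hi'
    rw [show x i + t = x n + n by omega, hx.lvl_last hn] at hlt ⊢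
    exact ⟨_, hx.lvl_pos _, by omega, rfl⟩
  · rintro ⟨j, hj, hj', rfl⟩
    obtain ⟨k, hk, hk', rfl⟩ := hx.exists_lvl hn hj (by omega)
    have hk2 : k ≠ x n + n := by
      rintro rfl
      rw [hx.lvl_last hn] at hj'
      omega
    -- Right ends on ρ' lie in the next period, so row i is chosen with x n + n + i = k + (n + 1).
    obtain ⟨i, hi⟩ := Int.eq_ofNat_of_zero_le (a := k + 1 - x n) (by omega)
    have e1 := h2 i (by omega) (by omega)
    have e2 := hx.mono (i := i) (by omega) (show i ≤ n by omega) (by omega)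
    have e3 : x i + ((x n + n - x i).toNat : ℤ) = x n + n := by omega
    refine ⟨(i, ξ n - n - i), mem_nPath.2 ⟨by omega, by omega, rfl⟩, (hX _ _ _).2
      ⟨by omega, by omega, (x n + n - x i).toNat, by omega, by omega, ?_, ?_⟩⟩
    · rw [e3, show x n + n + i = k + (n + 1) by omega, lvl_add_period, hx.lvl_last hn]
      omega
    · rw [e3, show x n + n + i = k + (n + 1) by omega, lvl_add_period, hx.lvl_last hn]
      rfl

/-! ### The glued quiver -/

theorem ARQuiver_label_rootA_iff {i : ℕ} {p : ℤ} {a b : ℕ} (ha : 1 ≤ a) (hab : a ≤ b)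
    (hb : b ≤ n) :
    (ARQuiver n Q ξ).label (i, p) (rootA n a b) ↔ 1 ≤ i ∧ i ≤ n ∧ ∃ t : ℕ, t ≤ n ∧
      p = ξ i - 2 * t ∧ lvl n (prof n ξ) (prof n ξ i + t) = a ∧
      lvl n (prof n ξ) (prof n ξ i + t + i) = b + 1 := by
  have hx := isProfile_prof hQ hξ
  rw [ARQuiver_label_iff hn hQ hξ hr]
  generalize prof n ξ = x at *
  refine and_congr_right fun hi => and_congr_right fun hi' => exists_congr fun t =>
    and_congr_right fun _ => and_congr_right fun _ => ?_
  constructor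
  · rintro ⟨h1, h2⟩
    have h3 := hx.lvl_pos (x i + t)
    have h4 := hx.lvl_le (x i + t + i)
    have := rootA_injective ha hab hb h3 (d := lvl n x (x i + t + i) - 1) (by omega) (by omega)
      (by rw [h2, rootA, Nat.sub_add_cancel (by omega)])
    omega
  · rintro ⟨h1, h2⟩
    rw [h1, h2]
    exact ⟨by omega, rfl⟩

theorem upsideDown_label_rootA_iff {i : ℕ} {p : ℤ} {a b : ℕ} (ha : 1 ≤ a) (hab : a ≤ b)
    (hb : b ≤ n) :
    (upsideDown n (ARQuiver n Q ξ)).label (i, p) (rootA n a b) ↔ 1 ≤ i ∧ i ≤ n ∧ ∃ t : ℕ, t ≤ n ∧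
      p = ξ i - 2 * t ∧ lvl n (prof n ξ) (prof n ξ i + t + i) = a ∧
      lvl n (prof n ξ) (prof n ξ i + t) = b + 1 := by
  have hx := isProfile_prof hQ hξ
  rw [upsideDown_label_iff hn hQ hξ hr]
  generalize prof n ξ = x at *
  refine and_congr_right fun hi => and_congr_right fun hi' => exists_congr fun t =>
    and_congr_right fun _ => and_congr_right fun _ => ?_
  constructor
  · rintro ⟨h1, h2⟩
    have h3 := hx.lvl_pos (x i + t + i)
    have h4 := hx.lvl_le (x i + t)
    have := rootA_injective ha hab hb h3 (d := lvl n x (x i + t) - 1) (by omega) (by omega)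
      (by rw [h2, rootA, Nat.sub_add_cancel (by omega)])
    omega
  · rintro ⟨h1, h2⟩
    rw [h1, h2]
    exact ⟨by omega, rfl⟩

theorem disjoint_verts :
    Disjoint (ARQuiver n Q ξ).verts (upsideDown n (ARQuiver n Q ξ)).verts := by
  rw [Set.disjoint_left]
  rintro ⟨i, p⟩ ⟨β, hβ⟩ ⟨γ, hγ⟩
  obtain ⟨-, -, t, -, h1, h2, -⟩ := (ARQuiver_label_iff hn hQ hξ hr _ _ _).1 hβ
  obtain ⟨-, -, s, -, h3, h4, -⟩ := (upsideDown_label_iff hn hQ hξ hr _ _ _).1 hγ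
  obtain rfl : s = t := by omega
  omega

theorem exists_glue_label_iff (i : ℕ) (p : ℤ) :
    (∃ β, (glue (ARQuiver n Q ξ) (upsideDown n (ARQuiver n Q ξ))).label (i, p) β) ↔
      1 ≤ i ∧ i ≤ n ∧ ∃ t : ℕ, t ≤ n ∧ p = ξ i - 2 * t := by
  have hx := isProfile_prof hQ hξ
  constructor
  · rintro ⟨β, hβ | hβ⟩
    · obtain ⟨h1, h2, t, h3, h4, -⟩ := (ARQuiver_label_iff hn hQ hξ hr _ _ _).1 hβ
      exact ⟨h1, h2, t, h3, h4⟩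
    · obtain ⟨h1, h2, t, h3, h4, -⟩ := (upsideDown_label_iff hn hQ hξ hr _ _ _).1 hβ
      exact ⟨h1, h2, t, h3, h4⟩
  · rintro ⟨h1, h2, t, h3, h4⟩
    rcases Nat.lt_or_gt_of_ne (hx.lvl_ne (k := prof n ξ i + t) (l := prof n ξ i + t + i) (by omega)
      (by omega)) with h | h
    · exact ⟨_, Or.inl ((ARQuiver_label_iff hn hQ hξ hr _ _ _).2 ⟨h1, h2, t, h3, h4, h, rfl⟩)⟩
    · exact ⟨_, Or.inr ((upsideDown_label_iff hn hQ hξ hr _ _ _).2 ⟨h1, h2, t, h3, h4, h, rfl⟩)⟩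

theorem glue_label_unique {z : ℕ × ℤ} {β γ : Lat n}
    (hβ : (glue (ARQuiver n Q ξ) (upsideDown n (ARQuiver n Q ξ))).label z β)
    (hγ : (glue (ARQuiver n Q ξ) (upsideDown n (ARQuiver n Q ξ))).label z γ) : β = γ := by
  have hd := Set.disjoint_left.1 (disjoint_verts hn hQ hξ hr)
  obtain ⟨i, p⟩ := z
  rcases hβ with hβ | hβ <;> rcases hγ with hγ | hγ
  · obtain ⟨-, -, t, -, h1, -, rfl⟩ := (ARQuiver_label_iff hn hQ hξ hr _ _ _).1 hβ
    obtain ⟨-, -, s, -, h3, -, rfl⟩ := (ARQuiver_label_iff hn hQ hξ hr _ _ _).1 hγ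
    obtain rfl : s = t := by omega
    rfl
  · exact absurd ⟨_, hγ⟩ (hd ⟨_, hβ⟩)
  · exact absurd ⟨_, hβ⟩ (hd ⟨_, hγ⟩)
  · obtain ⟨-, -, t, -, h1, -, rfl⟩ := (upsideDown_label_iff hn hQ hξ hr _ _ _).1 hβ
    obtain ⟨-, -, s, -, h3, -, rfl⟩ := (upsideDown_label_iff hn hQ hξ hr _ _ _).1 hγ
    obtain rfl : s = t := by omega
    rfl

end

/-! ### Comparison of the two labellings -/

theorem rootDneg_ne_rootDpos {n a b c d : ℕ} (ha : 1 ≤ a) (hab : a < b) (hb : b ≤ n + 1)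
    (hc : 1 ≤ c) (hcd : c < d) (hd : d ≤ n + 1) : rootDneg n a b ≠ rootDpos n c d := by
  intro h
  have := signed_pair_unique (n := n) (a := a) (b := b) (c := c) (d := d) 1 (-1) 1 1 ha (by omega)
    (by omega) hb hc (by omega) (by omega) hd (by omega) (by omega)
    (by simpa [rootDneg, rootDpos, sub_eq_add_neg] using h)
  rcases this with ⟨_, _, _, h⟩ | ⟨_, _, _, h⟩ <;> revert h <;> decide

theorem rootDpos_injective {n a b c d : ℕ} (ha : 1 ≤ a) (hab : a < b) (hb : b ≤ n + 1)
    (hc : 1 ≤ c) (hcd : c < d) (hd : d ≤ n + 1) (h : rootDpos n a b = rootDpos n c d) :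
    a = c ∧ b = d := by
  have := signed_pair_unique (n := n) (a := a) (b := b) (c := c) (d := d) 1 1 1 1 ha (by omega)
    (by omega) hb hc (by omega) (by omega) hd (by omega) (by omega)
    (by simpa [rootDpos] using h)
  omega

theorem rootDpos_comm (n a b : ℕ) : rootDpos n a b = rootDpos n b a := add_comm _ _

section
variable {n : ℕ} {Q : ℕ → ℕ → Prop} {ξ : ℕ → ℤ} {c : List ℕ} (hn : 1 ≤ n)
  (hQ : IsDynkinQuiverA n Q) (hξ : IsHeightFunction Q ξ) (hc : IsTwistedCoxeterWord n c)
  (hcQ : IsCoxeterWordOf n Q (projWord n c))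
include hn hQ hξ hc hcQ

/-- The five cases of `labelD` correspond to the clauses of `NewLabel`, because comparing positions
with ρ and ρ' amounts to comparing the ends of the interval with x n + n. -/
theorem FoldedLabel.newLabel {z : ℕ × ℤ} {β : Lat n} (h : FoldedLabel n c ξ z β) :
    NewLabel n c (ARQuiver n Q ξ) (upsideDown n (ARQuiver n Q ξ)) (sPath n (ξ n - n))
      (nPath n (ξ n - n)) z β := by
  obtain ⟨i, p⟩ := z
  obtain ⟨hi, hi', t, ht, rfl, rfl⟩ := (FoldedLabel_iff hn hQ hξ hc hcQ _ _ _).1 h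
  have hx := isProfile_prof hQ hξ
  have e1 := two_mul_prof hQ hξ hi hi'
  have e2 := two_mul_prof hQ hξ hn le_rfl
  have hX := fun a b => ARQuiver_label_rootA_iff hn hQ hξ hcQ (i := i) (p := ξ i - 2 * t) (a := a)
    (b := b)
  have hY := fun a b => upsideDown_label_rootA_iff hn hQ hξ hcQ (i := i) (p := ξ i - 2 * t)
    (a := a) (b := b)
  generalize prof n ξ = x at *
  have hk : x i ≤ x i + t := by omega
  have hk' : x i + t ≤ x i + n := by omega
  have hp1 := hx.lvl_pos (x i + t)
  have hp2 := hx.lvl_pos (x i + t + i)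
  have hne := hx.lvl_ne (k := x i + t) (l := x i + t + i) (by omega) (by omega)
  have hS : (i, ξ n - n + i) ∈ sPath n (ξ n - n) := mem_sPath.2 ⟨hi, hi', rfl⟩
  have hN : (i, ξ n - n - i) ∈ nPath n (ξ n - n) := mem_nPath.2 ⟨hi, hi', rfl⟩
  generalize hka : lvl n x (x i + t) = a at *
  generalize hkb : lvl n x (x i + t + i) = b at *
  obtain ⟨a, rfl⟩ : ∃ a', a = a' + 1 := ⟨a - 1, by omega⟩
  obtain ⟨b, rfl⟩ : ∃ b', b = b' + 1 := ⟨b - 1, by omega⟩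
  rcases lt_trichotomy (x n + n) (x i + t) with h1 | h1 | h1
  · obtain ⟨h2, h3, h4⟩ := labelD_left hx hn (wordSign n c) hi hi' hk' h1
    rw [hka, hkb] at h2 h3
    rw [hka] at h4
    rw [h2]
    exact .outside _ _ _ hp2 (by omega) (by omega)
      (.inr ((hY _ _ hp2 (by omega) (by omega)).2 ⟨hi, hi', t, ht, rfl, hkb, hka⟩))
      (.inr ⟨_, hN, by simp only; omega⟩)
  · obtain ⟨h2, h3, h4⟩ := labelD_rho' hx hn (wordSign n c) hi hi' h1.symm
    rw [hkb] at h2 h4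
    rw [hka] at h3
    rw [h2]
    have hlab := (hY (b + 1) n hp2 h4 le_rfl).2 ⟨hi, hi', t, ht, rfl, hkb, hka.trans h3⟩
    have hmem : (i, ξ i - 2 * (t : ℤ)) ∈ nPath n (ξ n - n) := mem_nPath.2 ⟨hi, hi', by omega⟩
    by_cases hnc : n ∈ c
    · rw [wordSign, if_pos hnc, one_smul, add_comm]
      exact .left_n _ _ hp2 h4 hlab hmem hnc
    · rw [wordSign, if_neg hnc, ← neg_eq_units_smul, neg_add_eq_sub]
      exact .left_succ _ _ hp2 h4 hlab hmem ((mem_or_mem hn hc).resolve_left hnc)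
  · rcases lt_trichotomy (x i + t + i) (x n + n) with h1' | h1' | h1'
    · obtain ⟨h2, h3, h4⟩ := labelD_right hx hn (wordSign n c) hi hi' hk h1'
      rw [hka, hkb] at h2 h3
      rw [hkb] at h4
      rw [h2]
      exact .outside _ _ _ hp1 (by omega) (by omega)
        (.inl ((hX _ _ hp1 (by omega) (by omega)).2 ⟨hi, hi', t, ht, rfl, hka, hkb⟩))
        (.inl ⟨_, hS, by simp only; omega⟩)
    · obtain ⟨h2, h3, h4⟩ := labelD_rho hx hn (wordSign n c) hi hi' h1'
      rw [hka] at h2 h4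
      rw [hkb] at h3
      rw [h2]
      have hlab := (hX (a + 1) n hp1 h4 le_rfl).2 ⟨hi, hi', t, ht, rfl, hka, hkb.trans h3⟩
      have hmem : (i, ξ i - 2 * (t : ℤ)) ∈ sPath n (ξ n - n) := mem_sPath.2 ⟨hi, hi', by omega⟩
      by_cases hnc : n ∈ c
      · rw [wordSign, if_pos hnc, one_smul]
        exact .right_n _ _ hp1 h4 hlab hmem hnc
      · rw [wordSign, if_neg hnc, ← neg_eq_units_smul, sub_neg_eq_add]
        exact .right_succ _ _ hp1 h4 hlab hmem ((mem_or_mem hn hc).resolve_left hnc)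
    · obtain ⟨h2, h3, h4⟩ := labelD_between hx hn (wordSign n c) hi hi' hk' h1 h1'
      rw [hka, hkb] at h2
      rw [hka] at h3
      rw [hkb] at h4
      have hbetween : LeftOf (sPath n (ξ n - n)) (i, ξ i - 2 * (t : ℤ)) ∧
          RightOf (nPath n (ξ n - n)) (i, ξ i - 2 * (t : ℤ)) :=
        ⟨⟨_, hS, by simp only; omega⟩, ⟨_, hN, by simp only; omega⟩⟩
      rw [h2]
      -- Between the paths both copies occur: increasing end levels belong to Γ_Q and decreasing
      -- ones to the upside-down copy. The sum does not see the difference.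
      rcases Nat.lt_or_gt_of_ne hne with h5 | h5
      · exact .inside _ _ _ hp1 (by omega) (by omega)
          (.inl ((hX _ _ hp1 (by omega) (by omega)).2 ⟨hi, hi', t, ht, rfl, hka, hkb⟩)) hbetween
      · rw [rootDpos_comm]
        exact .inside _ _ _ hp2 (by omega) (by omega)
          (.inr ((hY _ _ hp2 (by omega) (by omega)).2 ⟨hi, hi', t, ht, rfl, hkb, hka⟩)) hbetween

theorem NewLabel.foldedLabel {z : ℕ × ℤ} {β : Lat n}
    (h : NewLabel n c (ARQuiver n Q ξ) (upsideDown n (ARQuiver n Q ξ)) (sPath n (ξ n - n))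
      (nPath n (ξ n - n)) z β) : FoldedLabel n c ξ z β := by
  have hx := isProfile_prof hQ hξ
  have hF := FoldedLabel_iff hn hQ hξ hc hcQ
  have e1 := fun i => two_mul_prof hQ hξ (i := i)
  have e2 := two_mul_prof hQ hξ hn le_rfl
  have hX := fun i p a b => ARQuiver_label_rootA_iff hn hQ hξ hcQ (i := i) (p := p) (a := a)
    (b := b)
  have hY := fun i p a b => upsideDown_label_rootA_iff hn hQ hξ hcQ (i := i) (p := p) (a := a)
    (b := b)
  have hnot : n + 1 ∈ c → wordSign n c = -1 := fun h => by
    rw [wordSign, if_neg fun h' => not_mem_both hn hc h' h]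
  generalize prof n ξ = x at *
  have hG : ∀ {i p a b}, 1 ≤ a → a ≤ b → b ≤ n →
      (glue (ARQuiver n Q ξ) (upsideDown n (ARQuiver n Q ξ))).label (i, p) (rootA n a b) →
      1 ≤ i ∧ i ≤ n ∧ ∃ t : ℕ, t ≤ n ∧ p = ξ i - 2 * t ∧
        (lvl n x (x i + t) = a ∧ lvl n x (x i + t + i) = b + 1 ∨
        lvl n x (x i + t + i) = a ∧ lvl n x (x i + t) = b + 1) := by
    intro i p a b ha hab hb h
    rcases h with h | h
    · obtain ⟨h1, h2, t, h3, h4, h5⟩ := (hX _ _ _ _ ha hab hb).1 h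
      exact ⟨h1, h2, t, h3, h4, .inl h5⟩
    · obtain ⟨h1, h2, t, h3, h4, h5⟩ := (hY _ _ _ _ ha hab hb).1 h
      exact ⟨h1, h2, t, h3, h4, .inr h5⟩
  cases h with
  | outside a b ha hab hb h hz =>
    obtain ⟨i, p⟩ := z
    obtain ⟨hi, hi', t, ht, rfl, hl⟩ := hG ha hab hb h
    refine (hF _ _ _).2 ⟨hi, hi', t, ht, rfl, ?_⟩
    have e3 := e1 i hi hi'
    rcases hz with ⟨q, hq, hlt⟩ | ⟨q, hq, hlt⟩
    · obtain ⟨-, -, rfl⟩ := mem_sPath.1 hq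
      simp only at hlt
      obtain ⟨h2, h3, h4⟩ := labelD_right hx hn (wordSign n c) hi hi' (k := x i + t)
        (by omega) (by omega)
      rcases hl with hl | hl
      · rw [h2, hl.1, hl.2]
      -- Right of ρ the levels increase, so the label cannot come from the upside-down copy. Left of
      -- ρ' the situation is reversed.
      · omega
    · obtain ⟨-, -, rfl⟩ := mem_nPath.1 hq
      simp only at hlt
      obtain ⟨h2, h3, h4⟩ := labelD_left hx hn (wordSign n c) hi hi' (k := x i + t)
        (by omega) (by omega)
      rcases hl with hl | hl
      · omega
      · rw [h2, hl.1, hl.2]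
  | inside a b ha hab hb h hz =>
    obtain ⟨i, p⟩ := z
    obtain ⟨hi, hi', t, ht, rfl, hl⟩ := hG ha hab hb h
    refine (hF _ _ _).2 ⟨hi, hi', t, ht, rfl, ?_⟩
    have e3 := e1 i hi hi'
    obtain ⟨⟨q, hq, hlt⟩, ⟨q', hq', hlt'⟩⟩ := hz
    obtain ⟨-, -, rfl⟩ := mem_sPath.1 hq
    obtain ⟨-, -, rfl⟩ := mem_nPath.1 hq'
    simp only at hlt hlt'
    obtain ⟨h2, h3, h4⟩ := labelD_between hx hn (wordSign n c) hi hi' (k := x i + t)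
      (by omega) (by omega) (by omega)
    rcases hl with hl | hl
    · rw [h2, hl.1, hl.2]
    · rw [h2, hl.1, hl.2, rootDpos_comm]
  | right_n a ha ha' h hz hnc =>
    obtain ⟨i, p⟩ := z
    obtain ⟨hi, hi', t, ht, rfl, hl⟩ := (hX _ _ _ _ ha ha' le_rfl).1 h
    refine (hF _ _ _).2 ⟨hi, hi', t, ht, rfl, ?_⟩
    have e3 := e1 i hi hi'
    obtain ⟨-, -, hp⟩ := mem_sPath.1 hz
    rw [(labelD_rho hx hn (wordSign n c) hi hi' (k := x i + t)
      (by omega)).1, hl.1, wordSign, if_pos hnc, one_smul]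
    rfl
  | right_succ a ha ha' h hz hnc =>
    obtain ⟨i, p⟩ := z
    obtain ⟨hi, hi', t, ht, rfl, hl⟩ := (hX _ _ _ _ ha ha' le_rfl).1 h
    refine (hF _ _ _).2 ⟨hi, hi', t, ht, rfl, ?_⟩
    have e3 := e1 i hi hi'
    obtain ⟨-, -, hp⟩ := mem_sPath.1 hz
    rw [(labelD_rho hx hn (wordSign n c) hi hi' (k := x i + t)
      (by omega)).1, hl.1, hnot hnc, ← neg_eq_units_smul, sub_neg_eq_add]
    rfl
  | left_n a ha ha' h hz hnc =>
    obtain ⟨i, p⟩ := z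
    obtain ⟨hi, hi', t, ht, rfl, hl⟩ := (hY _ _ _ _ ha ha' le_rfl).1 h
    refine (hF _ _ _).2 ⟨hi, hi', t, ht, rfl, ?_⟩
    have e3 := e1 i hi hi'
    obtain ⟨-, -, hp⟩ := mem_nPath.1 hz
    rw [(labelD_rho' hx hn (wordSign n c) hi hi' (k := x i + t)
      (by omega)).1, hl.1, wordSign, if_pos hnc, one_smul]
    exact add_comm _ _
  | left_succ a ha ha' h hz hnc =>
    obtain ⟨i, p⟩ := z
    obtain ⟨hi, hi', t, ht, rfl, hl⟩ := (hY _ _ _ _ ha ha' le_rfl).1 h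
    refine (hF _ _ _).2 ⟨hi, hi', t, ht, rfl, ?_⟩
    have e3 := e1 i hi hi'
    obtain ⟨-, -, hp⟩ := mem_nPath.1 hz
    rw [(labelD_rho' hx hn (wordSign n c) hi hi' (k := x i + t)
      (by omega)).1, hl.1, hnot hnc, ← neg_eq_units_smul, neg_add_eq_sub]
    rfl

theorem exists_FoldedLabel_iff (i : ℕ) (p : ℤ) : (∃ β, FoldedLabel n c ξ (i, p) β) ↔
    1 ≤ i ∧ i ≤ n ∧ ∃ t : ℕ, t ≤ n ∧ p = ξ i - 2 * t := by
  constructor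
  · rintro ⟨β, h⟩
    obtain ⟨h1, h2, t, h3, h4, -⟩ := (FoldedLabel_iff hn hQ hξ hc hcQ _ _ _).1 h
    exact ⟨h1, h2, t, h3, h4⟩
  · rintro ⟨h1, h2, t, h3, h4⟩
    exact ⟨_, (FoldedLabel_iff hn hQ hξ hc hcQ _ _ _).2 ⟨h1, h2, t, h3, h4, rfl⟩⟩

theorem isPosRootD_of_foldedLabel {z : ℕ × ℤ} {β : Lat n} (h : FoldedLabel n c ξ z β) :
    IsPosRootD n β := by
  obtain ⟨i, p⟩ := z
  obtain ⟨h1, h2, t, h3, -, rfl⟩ := (FoldedLabel_iff hn hQ hξ hc hcQ _ _ _).1 h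
  exact isPosRootD_labelD (isProfile_prof hQ hξ) hn _ h1 h2 (by omega) (by omega)

theorem existsUnique_foldedLabel {β : Lat n} (hβ : IsPosRootD n β) :
    ∃! z, FoldedLabel n c ξ z β := by
  have hx := isProfile_prof hQ hξ
  have hF := FoldedLabel_iff hn hQ hξ hc hcQ
  obtain ⟨i, hi, hi', t, ht, rfl⟩ := hx.exists_labelD hn (wordSign n c) hβ
  refine ⟨(i, ξ i - 2 * t), (hF _ _ _).2 ⟨hi, hi', t, ht, rfl, rfl⟩, ?_⟩
  rintro ⟨j, q⟩ h
  obtain ⟨hj, hj', s, hs, rfl, h1⟩ := (hF _ _ _).1 h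
  obtain ⟨rfl, m, hm⟩ := hx.labelD_injective hi hi' hj hj' h1
  have : m = 0 := by
    by_contra h6
    rcases lt_or_gt_of_ne h6 with h6 | h6 <;> nlinarith
  rw [this] at hm
  congr 2
  omega

theorem foldedLabel_unique {z : ℕ × ℤ} {β γ : Lat n} (hβ : FoldedLabel n c ξ z β)
    (hγ : FoldedLabel n c ξ z γ) : β = γ := by
  obtain ⟨i, p⟩ := z
  obtain ⟨-, -, t, -, h1, rfl⟩ := (FoldedLabel_iff hn hQ hξ hc hcQ _ _ _).1 hβ
  obtain ⟨-, -, s, -, h2, rfl⟩ := (FoldedLabel_iff hn hQ hξ hc hcQ _ _ _).1 hγ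
  obtain rfl : s = t := by omega
  rfl

end

/-- For the arrows it is enough that both quivers have the same vertices, since on either side the
arrows are all unit steps between vertices. -/
theorem foldedARQuiver_eq_relabel {n : ℕ} {Q : ℕ → ℕ → Prop} {ξ : ℕ → ℤ} {w c : List ℕ}
    (hn : 2 ≤ n) (hQ : IsDynkinQuiverA n Q) (hξ : IsHeightFunction Q ξ)
    (hc : IsTwistedCoxeterWordOf n w c) (hcQ : IsCoxeterWordOf n Q (projWord n c)) :
    FoldedARQuiver n w c ξ = relabel c (ARQuiver n Q ξ) (upsideDown n (ARQuiver n Q ξ))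
      (sPath n (ξ n - n)) (nPath n (ξ n - n)) := by
  have hn1 : 1 ≤ n := by omega
  apply CoordQuiver.ext
  · funext z β
    rw [eq_iff_iff]
    exact ⟨fun h => h.newLabel hn1 hQ hξ hc.1 hcQ, fun h => h.foldedLabel hn1 hQ hξ hc.1 hcQ⟩
  · funext z z'
    rw [eq_iff_iff]
    have h1 : (FoldedARQuiver n w c ξ).arrow z z' ↔ ∃ β γ, FoldedLabel n c ξ z β ∧
        FoldedLabel n c ξ z' γ ∧ CombArrow n (twistedWord n c) β γ := by
      simp only [FoldedARQuiver, hc.2.combArrow_iff]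
    rw [h1, combArrow_iff_isStep hn hQ hξ hc.1 hcQ]
    obtain ⟨i, p⟩ := z
    obtain ⟨j, q⟩ := z'
    rw [exists_FoldedLabel_iff hn1 hQ hξ hc.1 hcQ, exists_FoldedLabel_iff hn1 hQ hξ hc.1 hcQ,
      ← exists_glue_label_iff hn1 hQ hξ hcQ, ← exists_glue_label_iff hn1 hQ hξ hcQ]
    rfl

/-- Of the clauses of `NewLabel`, those on ρ and ρ' involve the index n + 1 and the outer one gives
differences. Only the region strictly between the paths produces ⟨i, j⟩ with j ≤ n. -/
theorem glue_label_of_rootDpos {n : ℕ} {Q : ℕ → ℕ → Prop} {ξ : ℕ → ℤ} {c : List ℕ}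
    (hn : 1 ≤ n) (hQ : IsDynkinQuiverA n Q) (hξ : IsHeightFunction Q ξ)
    (hc : IsTwistedCoxeterWord n c) (hcQ : IsCoxeterWordOf n Q (projWord n c)) {i j : ℕ}
    {z : ℕ × ℤ} (hi : 1 ≤ i) (hij : i < j) (hj : j ≤ n)
    (h : FoldedLabel n c ξ z (rootDpos n i j)) :
    (glue (ARQuiver n Q ξ) (upsideDown n (ARQuiver n Q ξ))).label z (rootA n i (j - 1)) := by
  have h1 := h.newLabel hn hQ hξ hc hcQ
  generalize hβ : rootDpos n i j = β at h1
  cases h1 with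
  | outside a b ha hab hb h hz =>
    exact absurd hβ.symm (rootDneg_ne_rootDpos ha (by omega) (by omega) hi hij (by omega))
  | inside a b ha hab hb h' hz =>
    obtain ⟨rfl, rfl⟩ := rootDpos_injective hi hij (by omega) ha (by omega) (by omega) hβ
    simpa using h'
  | right_n a ha ha' h hz hnc =>
    exact absurd hβ.symm (rootDneg_ne_rootDpos ha (by omega) (by omega) hi hij (by omega))
  | right_succ a ha ha' h hz hnc =>
    have := rootDpos_injective hi hij (by omega) ha (by omega) le_rfl hβ
    omega
  | left_n a ha ha' h hz hnc =>
    have := rootDpos_injective hi hij (by omega) ha (by omega) le_rfl hβ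
    omega
  | left_succ a ha ha' h hz hnc =>
    exact absurd hβ.symm (rootDneg_ne_rootDpos ha (by omega) (by omega) hi hij (by omega))

end FoldedAR

theorem mainTheorem7 (n : ℕ) (hn : 2 ≤ n) (w : List ℕ) (hw : IsTwistedAdapted n w) :
    -- the class has a twisted Coxeter element and an image `[Q]` under the projection to `A_n`
    (∃ (c : List ℕ) (Q : ℕ → ℕ → Prop), IsTwistedCoxeterWordOf n w c ∧ IsDynkinQuiverA n Q ∧
      IsCoxeterWordOf n Q (projWord n c)) ∧
    ∀ (c : List ℕ) (Q : ℕ → ℕ → Prop) (ξ : ℕ → ℤ), IsTwistedCoxeterWordOf n w c →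
      IsDynkinQuiverA n Q → IsCoxeterWordOf n Q (projWord n c) → IsHeightFunction Q ξ →
      ∀ X Y Z : CoordQuiver (Lat n),
      X = ARQuiver n Q ξ → Y = upsideDown n X → Z = FoldedARQuiver n w c ξ →
      -- the upside-down copy has the shape of the AR-quiver of `Q^*`
      Y.verts = (ARQuiver n (starQuiver n Q) fun i => ξ (n + 1 - i) - (n + 1)).verts ∧
      -- the two copies fit together without overlaps or gaps
      Disjoint X.verts Y.verts ∧
      X.verts ∪ Y.verts =
        {x | 1 ≤ x.1 ∧ x.1 ≤ n ∧ ∃ t : ℕ, t ≤ n ∧ x.2 = ξ x.1 - 2 * (t : ℤ)} ∧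
      -- the labels of the folded AR-quiver are the positive roots of `D_{n+1}`, one at each vertex
      (∀ x β, Z.label x β → IsPosRootD n β) ∧
      (∀ β, IsPosRootD n β → ∃! x, Z.label x β) ∧
      (∀ x β γ, Z.label x β → Z.label x γ → β = γ) ∧
      -- the two sectional paths of length `n - 1`, and their labels
      (∃! ρ : List (ℕ × ℤ), IsSPath X ρ ∧ ρ.length = n) ∧
      (∃! ρ' : List (ℕ × ℤ), IsNPath Y ρ' ∧ ρ'.length = n) ∧
      (∀ ρ ρ' : List (ℕ × ℤ), IsSPath X ρ → ρ.length = n → IsNPath Y ρ' → ρ'.length = n →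
        {β | ∃ x ∈ ρ, X.label x β} = {β | ∃ i, 1 ≤ i ∧ i ≤ n ∧ β = rootA n i n} ∧
        {β | ∃ x ∈ ρ', Y.label x β} = {β | ∃ i, 1 ≤ i ∧ i ≤ n ∧ β = rootA n i n} ∧
        -- the glued and relabelled quiver is the folded AR-quiver
        Z = relabel c X Y ρ ρ') ∧
      -- the vertex labelled `⟨i, j⟩` in the folded AR-quiver comes from `[i, j - 1]`
      ∀ i j x, 1 ≤ i → i < j → j ≤ n → Z.label x (rootDpos n i j) →
        ∀ β, (glue X Y).label x β ↔ β = rootA n i (j - 1) := by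

  have hn1 : 1 ≤ n := by omega
  constructor
  · obtain ⟨c, hc⟩ := exists_isTwistedCoxeterWordOf hn hw
    obtain ⟨Q, hQ, hcQ⟩ := exists_quiver hn1 hc.1
    exact ⟨c, Q, hc, hQ, hcQ⟩
  rintro c Q ξ hc hQ hcQ hξ X Y Z rfl rfl rfl
  refine ⟨upsideDown_verts hQ ξ, disjoint_verts hn1 hQ hξ hcQ, ?_,
    fun z β h => isPosRootD_of_foldedLabel hn1 hQ hξ hc.1 hcQ h,
    fun β h => existsUnique_foldedLabel hn1 hQ hξ hc.1 hcQ h,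
    fun z β γ h h' => foldedLabel_unique hn1 hQ hξ hc.1 hcQ h h', ?_, ?_, ?_, ?_⟩
  · ext ⟨i, p⟩
    refine Iff.trans ?_ (exists_glue_label_iff hn1 hQ hξ hcQ i p)
    exact exists_or.symm
  · exact ⟨_, (isSPath_iff hn1 hQ hξ hcQ _).2 rfl, fun l => (isSPath_iff hn1 hQ hξ hcQ l).1⟩
  · exact ⟨_, (isNPath_iff hn1 hQ hξ hcQ _).2 rfl, fun l => (isNPath_iff hn1 hQ hξ hcQ l).1⟩
  · intro ρ ρ' h1 h2 h3 h4
    obtain rfl := (isSPath_iff hn1 hQ hξ hcQ ρ).1 ⟨h1, h2⟩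
    obtain rfl := (isNPath_iff hn1 hQ hξ hcQ ρ').1 ⟨h3, h4⟩
    exact ⟨sPath_labels hn1 hQ hξ hcQ, nPath_labels hn1 hQ hξ hcQ,
      foldedARQuiver_eq_relabel hn hQ hξ hc hcQ⟩
  · intro i j z hi hij hj h β
    have h1 := glue_label_of_rootDpos hn1 hQ hξ hc.1 hcQ hi hij hj h
    exact ⟨fun h2 => glue_label_unique hn1 hQ hξ hcQ h2 h1, fun h2 => h2 ▸ h1⟩
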